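/- **Setting.** Fix values, channels, node names, interpreted function and predicate symbols for data expressions, and an environment of process definitions $A(\tilde x)\Leftarrow s$. Processes are $p::=s\mid p\,{}_r\!\oplus p$ (probabilistic choice, $r\in[0,1]$) and states are $s::=c!\langle e\rangle.p\mid c?(x).p\mid \omega.0\mid s+s\mid \text{if } b \text{ then } s \text{ else } s\mid\tau.p\mid A(\tilde e)\mid 0$. A closed process $p$ denotes a distribution $[\![p]\!]$ of closed states. A system term $M$ is a parallel composition of nodes $n[\![s]\!]$ running closed states. A network $\mathcal M=\Gamma\rhd M$ consists of a finite irreflexive digraph $\Gamma$ and a system term $M$ in which node names occur at most once and belong to $\Gamma$; the other vertices of $\Gamma$ are its external nodes. Networks are well-formed: every edge has an internal endpoint, and every external node has an edge. $\mathrm{inp}(\mathcal M)$ (resp. $\mathrm{outp}(\mathcal M)$) is the set of external nodes with an outgoing (resp. incoming) edge. Transitions $\Gamma\rhd M\xrightarrow{\mu}\Delta$ ($\Delta$ a distribution of system terms, $\mu$ one of $n.\tau$, $n.c!v$, $n.c?v$) are those of reliable local broadcast: a broadcast by $n$ is received by every node that has an edge from $n$ and is able to receive on that channel, and leaves all other nodes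 unchanged. $\mathcal M$ is *successful*, $\omega(\mathcal M)$, if $M\equiv M'\mid n[\![\omega.0+s]\!]$ for some $M',n,s$, where $\equiv$ is structural congruence. **Hyper-derivations.** Given a relation $s\to\Delta$ from states to distributions and a success predicate $\omega$, lift $\to$ to sub-distributions (closure of $\overline s\to\Delta$ under finite sums with weights of total at most $1$). Write $\Delta\Rightarrow\Delta'$ if there are sub-distributions with $\Delta=\Delta_0^{\to}+\Delta_0^{\times}$, $\Delta_k^{\to}\to\Delta_{k+1}^{\to}+\Delta_{k+1}^{\times}$ for all $k\ge 0$, no $\omega$-successful state in the support of any $\Delta_k^{\to}$, and $\Delta'=\sum_k\Delta_k^\times$. It is *extreme* if only $\omega$-successful states in the support of $\Delta'$ have a transition $\to$. **Testing.** A reduction of a network is an internal move $n.\tau$ or a broadcast $n.c!v$. $\mathrm{Results}(\mathcal M)$ is the set of masses that the extreme derivatives of $\overline{\mathcal M}$ under reductions give to successful networks. $\mathcal M\rhd\!\!|\,\mathcal T=(\Gamma_M\cup\Gamma_T)\rhd(M\mid T)$ is defined if no internal node of $\mathcal M$ is a vertex of $\Gamma_T$. For networks with equal input nodes and equal output nodes,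 $\mathcal M\sqsubseteq_{must}\mathcal N$ means: for every well-formed network $\mathcal T$ such that $\mathcal M\rhd\!\!|\,\mathcal T$ and $\mathcal N\rhd\!\!|\,\mathcal T$ are defined, for every $q\in\mathrm{Results}(\mathcal N\rhd\!\!|\,\mathcal T)$ there is $p\in\mathrm{Results}(\mathcal M\rhd\!\!|\,\mathcal T)$ with $p\le q$. **Extensional actions.** Only non-successful networks have extensional actions: $\tau$ (an internal move, or a broadcast by a node with no edge to an external node); $n.c?v$ with $n\in\mathrm{inp}(\mathcal M)$; and $c!v\rhd\eta$, a broadcast of $v$ on $c$ by a node whose set $\eta$ of external targets is non-empty. Let $\Rightarrow$ denote hyper-derivation along extensional $\tau$. The weak actions are: $\overset{\tau}{\Rightarrow}$ is $\Rightarrow$; $\overset{n.c?v}{\Longrightarrow}$ is $\Rightarrow\xrightarrow{n.c?v}\Rightarrow$; and $\overset{c!v\rhd\eta}{\Longrightarrow}$ is the least relation that contains $\Rightarrow\xrightarrow{c!v\rhd\eta}\Rightarrow$ and contains $\overset{c!v\rhd\eta_1}{\Longrightarrow}\overset{c!v\rhd\eta_2}{\Longrightarrow}$ whenever $\eta=\eta_1\cup\eta_2$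 with $\eta_1\cap\eta_2=\emptyset$ (the second relation lifted to sub-distributions). $\mathcal M$ is *deadlocked* if it is not successful and has no extensional $\tau$ or output action. The divergence-free deadlock simulation $\precsim$ is the largest relation between well-formed networks such that $\mathcal M\precsim\mathcal N$ implies: (i) if $\mathcal M$ is deadlocked, then $\mathcal N\overset{\tau}{\Rightarrow}\Theta$ for some full distribution $\Theta$ all of whose support is deadlocked; (ii) if $\mathcal M\overset{\lambda}{\Rightarrow}\Delta$ with $\Delta$ a full distribution, then $\mathcal N\overset{\lambda}{\Rightarrow}\Theta$ for some full distribution $\Theta$ such that $\Delta$ and $\Theta$ are related by the lifting of $\precsim$ to distributions. Consider the networks reachable from $\mathcal M$ by strong extensional actions. $\mathcal M$ is *convergent* if none of them has the empty sub-distribution as a hyper-derivative under $\Rightarrow$. $\mathcal M$ is *finitary* if there are finitely many of them, and each has finitely many distributions as targets of its strong extensional actions. $\mathcal M$ is *proper* if the success clause $\omega$ does not occur in its code, nor in the bodies of the definitions that this code uses, directly or indirectly. **Theorem.** Let $\mathcal M,\mathcal N$ be finitary convergent well-formed networks with $\mathrm{inp}(\mathcal M)=\mathrm{inp}(\mathcal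 N)$ and $\mathrm{outp}(\mathcal M)=\mathrm{outp}(\mathcal N)$, and let $\mathcal M$ be proper. If $\mathcal N\precsim\mathcal M$, then $\mathcal M\sqsubseteq_{must}\mathcal N$. -/

import Mathlib

open scoped ENNReal NNReal

universe u

noncomputable section

/-! # Probabilistic broadcast networks, testing preorders and simulations -/

namespace WNet

/-! ## Sub-distributions, lifting, testing structures, hyper-derivations -/

/-- Sub-distributions over `S`: weight functions of total mass at most `1`
(full distributions are elements of Mathlib's `PMF S`). -/
def SubDist (S : Type u) : Type u := {Δ : S → ℝ≥0∞ // ∑' s, Δ s ≤ 1}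

instance (S : Type u) : CoeFun (SubDist S) (fun _ => S → ℝ≥0∞) := ⟨Subtype.val⟩

namespace SubDist

variable {S : Type u}

/-- The support `⌈Δ⌉`. -/
def support (Δ : SubDist S) : Set S := {s | Δ s ≠ 0}

/-- A full distribution, seen as a sub-distribution. -/
def ofPMF (Δ : PMF S) : SubDist S := ⟨Δ, Δ.tsum_coe.le⟩

/-- The point distribution at `s`. -/
def point (s : S) : SubDist S := ofPMF (PMF.pure s)

/-- The empty sub-distribution `ε`. -/
def empty : SubDist S := ⟨fun _ => 0, by simp⟩

end SubDist

/-- The lifting of a relation between states and sub-distributions: the smallest relation between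
sub-distributions that contains `(point s, Θ)` whenever `R s Θ`, and that is closed under finite
weighted sums of total weight at most `1`. -/
inductive Lift {S T : Type u} (R : S → SubDist T → Prop) : SubDist S → SubDist T → Prop
  | base {s : S} {Θ : SubDist T} : R s Θ → Lift R (SubDist.point s) Θ
  | comb {k : ℕ} (p : Fin k → ℝ≥0∞) (Δi : Fin k → SubDist S) (Θi : Fin k → SubDist T)
      {Δ : SubDist S} {Θ : SubDist T} :
      (∀ i, Lift R (Δi i) (Θi i)) → ∑ i, p i ≤ 1 →
      (∀ s, Δ s = ∑ i, p i * Δi i s) → (∀ t, Θ t = ∑ i, p i * Θi i t) → Lift R Δ Θ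

/-- A relation between states, seen as a relation between states and (point) distributions. -/
def ptRel {S T : Type u} (R : S → T → Prop) (s : S) (Θ : SubDist T) : Prop :=
  ∃ t, Θ = SubDist.point t ∧ R s t

/-- A relation between states and full distributions, seen as a relation between states and
sub-distributions. -/
def fullRel {S : Type u} (r : S → PMF S → Prop) (s : S) (Θ : SubDist S) : Prop :=
  ∃ Δ : PMF S, Θ = SubDist.ofPMF Δ ∧ r s Δ

/-- Testing structures: states, reductions to full distributions, and a success predicate. -/
structure TestingStructure (S : Type u) where
  red : S → PMF S → Prop
  succ : S → Prop

namespace TestingStructure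

variable {S : Type u} (T : TestingStructure S)

/-- `T.Hyper Δ Δ'`: the sub-distribution `Δ'` is a hyper-derivative of `Δ`. Here `go k` and `halt k`
are the parts of the mass that proceed, respectively halt, at stage `k`; successful states never
proceed. -/
def Hyper (Δ Δ' : SubDist S) : Prop :=
  ∃ go halt : ℕ → SubDist S,
    (∀ s, Δ s = go 0 s + halt 0 s) ∧
    (∀ k, ∃ Ξ : SubDist S, Lift (fullRel T.red) (go k) Ξ ∧
      ∀ s, Ξ s = go (k + 1) s + halt (k + 1) s) ∧
    (∀ k, ∀ s ∈ (go k).support, ¬ T.succ s) ∧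
    (∀ s, Δ' s = ∑' k, halt k s)

/-- Extreme derivatives: the hyper-derivatives in whose support only successful states can still
perform a reduction. -/
def Extreme (Δ Δ' : SubDist S) : Prop :=
  T.Hyper Δ Δ' ∧ ∀ s ∈ Δ'.support, (∃ Ξ, T.red s Ξ) → T.succ s

/-- The value of a sub-distribution: the mass that it gives to successful states. -/
def value (Δ : SubDist S) : ℝ≥0∞ := ∑' s, Set.indicator {s | T.succ s} Δ s

/-- The set of possible results from a sub-distribution. -/
def results (Δ : SubDist S) : Set ℝ≥0∞ := {v | ∃ Δ', T.Extreme Δ Δ' ∧ v = T.value Δ'}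

end TestingStructure

/-- The Smyth preorder on sets of outcomes. -/
def SmythLE (O₁ O₂ : Set ℝ≥0∞) : Prop := ∀ p₂ ∈ O₂, ∃ p₁ ∈ O₁, p₁ ≤ p₂

/-! ## Syntax -/

/-- The parameters of the calculus: values, channels, node names, function symbols and predicate
symbols for data expressions together with their meaning, and names of process definitions. -/
structure Sig where
  Val : Type u
  Chan : Type u
  Node : Type u
  Fn : Type u
  fnArity : Fn → ℕ
  fn : (f : Fn) → (Fin (fnArity f) → Val) → Val
  Pred : Type u
  predArity : Pred → ℕ
  pred : (b : Pred) → (Fin (predArity b) → Val) → Bool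
  Def : Type u
  defArity : Def → ℕ

variable {L : Sig.{u}}

/-- Data expressions with free variables among `Fin n`. -/
inductive Exp (L : Sig.{u}) (n : ℕ) : Type u
  | var (i : Fin n) : Exp L n
  | val (v : L.Val) : Exp L n
  | app (f : L.Fn) (e : Fin (L.fnArity f) → Exp L n) : Exp L n

/-- Simultaneous substitution in data expressions. -/
def Exp.subst {n m : ℕ} (σ : Fin n → Exp L m) : Exp L n → Exp L m
  | .var i => σ i
  | .val v => .val v
  | .app f e => .app f (fun i => (e i).subst σ)

/-- The value of a closed data expression. -/
def Exp.eval : Exp L 0 → L.Val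
  | .var i => i.elim0
  | .val v => v
  | .app f e => L.fn f (fun i => (e i).eval)

/-- Boolean expressions with free variables among `Fin n`: a predicate applied to data. -/
structure BExp (L : Sig.{u}) (n : ℕ) : Type u where
  sym : L.Pred
  args : Fin (L.predArity sym) → Exp L n

/-- Simultaneous substitution in boolean expressions. -/
def BExp.subst {n m : ℕ} (σ : Fin n → Exp L m) (b : BExp L n) : BExp L m :=
  ⟨b.sym, fun i => (b.args i).subst σ⟩

/-- The truth value of a closed boolean expression. -/
def BExp.eval (b : BExp L 0) : Bool := L.pred b.sym (fun i => (b.args i).eval)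

/-- The two syntactic categories of code. -/
inductive Kind : Type
  | proc
  | state

/-- Code with free variables among `Fin n` (so code with `n = 0` is closed, and alpha-equivalent
terms are equal): probabilistic processes and states. -/
inductive Code (L : Sig.{u}) : Kind → ℕ → Type u
  /-- a state, seen as a process -/
  | ret {n : ℕ} (s : Code L .state n) : Code L .proc n
  /-- probabilistic choice: `q` with probability `p`, and `r` with probability `1 - p` -/
  | choice {n : ℕ} (p : ℝ≥0) (hp : p ≤ 1) (q r : Code L .proc n) : Code L .proc n
  /-- broadcast `c!⟨e⟩.q` -/
  | send {n : ℕ} (c : L.Chan) (e : Exp L n) (q : Code L .proc n) : Code L .state n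
  /-- receive `c?(x).q`; the bound variable is the variable `0` of `q` -/
  | recv {n : ℕ} (c : L.Chan) (q : Code L .proc (n + 1)) : Code L .state n
  /-- the success clause `ω.0` -/
  | test {n : ℕ} : Code L .state n
  /-- choice `s + t` -/
  | sum {n : ℕ} (s t : Code L .state n) : Code L .state n
  /-- branch `if b then s else t` -/
  | branch {n : ℕ} (b : BExp L n) (s t : Code L .state n) : Code L .state n
  /-- preemption `τ.q` -/
  | tau {n : ℕ} (q : Code L .proc n) : Code L .state n
  /-- definition call `A⟨e₁, …⟩` -/
  | call {n : ℕ} (A : L.Def) (e : Fin (L.defArity A) → Exp L n) : Code L .state n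
  /-- terminate `0` -/
  | nil {n : ℕ} : Code L .state n

/-- Processes with free variables among `Fin n`. -/
abbrev Proc (L : Sig.{u}) (n : ℕ) : Type u := Code L .proc n

/-- States with free variables among `Fin n`. -/
abbrev State (L : Sig.{u}) (n : ℕ) : Type u := Code L .state n

/-- Extending a substitution under the binder of `recv`. -/
def liftSubst {n m : ℕ} (σ : Fin n → Exp L m) : Fin (n + 1) → Exp L (m + 1) :=
  Fin.cons (.var 0) (fun i => (σ i).subst (fun j => .var j.succ))

/-- Simultaneous (capture-avoiding) substitution in code. -/
def Code.subst {κ : Kind} {n m : ℕ} (σ : Fin n → Exp L m) : Code L κ n → Code L κ m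
  | .ret s => .ret (s.subst σ)
  | .choice p hp q r => .choice p hp (q.subst σ) (r.subst σ)
  | .send c e q => .send c (e.subst σ) (q.subst σ)
  | .recv c q => .recv c (q.subst (liftSubst σ))
  | .test => .test
  | .sum s t => .sum (s.subst σ) (t.subst σ)
  | .branch b s t => .branch (b.subst σ) (s.subst σ) (t.subst σ)
  | .tau q => .tau (q.subst σ)
  | .call A e => .call A (fun i => (e i).subst σ)
  | .nil => .nil

/-- Instantiating the single free variable of a process by a value. -/
def Code.inst {κ : Kind} (q : Code L κ 1) (v : L.Val) : Code L κ 0 := q.subst (fun _ => .val v)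

/-- An environment of process definitions `A(x₁, …) ⇐ s`: the body of `A` is a state whose free
variables are the parameters of `A`. -/
abbrev Defs (L : Sig.{u}) : Type u := (A : L.Def) → State L (L.defArity A)

/-- System terms. -/
inductive Sys (L : Sig.{u}) : Type u
  | nil : Sys L
  | node (s : State L 0) (n : L.Node) : Sys L
  | par (M N : Sys L) : Sys L

/-- The list of occurrences of node names in a system term. -/
def Sys.nodeList : Sys L → List L.Node
  | .nil => []
  | .node _ n => [n]
  | .par M N => M.nodeList ++ N.nodeList

/-- The set of node names in a system term. -/
def Sys.nodes (M : Sys L) : Set L.Node := {n | n ∈ M.nodeList}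

/-- Connectivity graphs: finite irreflexive digraphs; `Γ.E m n` means that `n` can detect the
broadcasts of `m`. -/
structure Graph (L : Sig.{u}) : Type u where
  V : Set L.Node
  E : L.Node → L.Node → Prop
  finite : V.Finite
  mem : ∀ m n, E m n → m ∈ V ∧ n ∈ V
  irrefl : ∀ n, ¬ E n n

/-- The union of two connectivity graphs. -/
def Graph.union (Γ Γ' : Graph L) : Graph L where
  V := Γ.V ∪ Γ'.V
  E m n := Γ.E m n ∨ Γ'.E m n
  finite := Γ.finite.union Γ'.finite
  mem m n h := h.elim (fun h => ⟨.inl (Γ.mem m n h).1, .inl (Γ.mem m n h).2⟩)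
    (fun h => ⟨.inr (Γ'.mem m n h).1, .inr (Γ'.mem m n h).2⟩)
  irrefl n h := h.elim (Γ.irrefl n) (Γ'.irrefl n)

/-- A pair `Γ ▷ M`; see `Network.WF` for the conditions. -/
structure Network (L : Sig.{u}) : Type u where
  graph : Graph L
  sys : Sys L

namespace Network

/-- The interface: the external nodes. -/
def interface (M : Network L) : Set L.Node := M.graph.V \ M.sys.nodes

/-- The input nodes: the external nodes that are connected to some node. -/
def inp (M : Network L) : Set L.Node := {i ∈ M.interface | ∃ m, M.graph.E i m}

/-- The output nodes: the external nodes to which some node is connected. -/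
def outp (M : Network L) : Set L.Node := {o ∈ M.interface | ∃ m, M.graph.E m o}

/-- `M` is a well-formed network (an element of `Nets`): node names occur at most once in the system
term and belong to the graph, external nodes are not connected with each other, and every
unconnected node is internal. -/
structure WF (M : Network L) : Prop where
  nodup : M.sys.nodeList.Nodup
  subset : M.sys.nodes ⊆ M.graph.V
  conn : ∀ m n, M.graph.E m n → m ∈ M.sys.nodes ∨ n ∈ M.sys.nodes
  isolated : ∀ m ∈ M.graph.V, (∀ n, ¬ M.graph.E m n ∧ ¬ M.graph.E n m) → m ∈ M.sys.nodes

/-- The composition of `M` with `P` is defined. -/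
def Composable (M P : Network L) : Prop := M.sys.nodes ∩ P.graph.V = ∅

/-- The (asymmetric) composition, extending `M` by `P`; only used where `M.Composable P`. -/
def comp (M P : Network L) : Network L := ⟨M.graph.union P.graph, .par M.sys P.sys⟩

end Network

/-! ## Intensional semantics -/

/-- The distribution on two outcomes with probabilities `p` and `1 - p`. -/
def coin (p : ℝ≥0) (hp : p ≤ 1) : PMF Bool :=
  PMF.ofFintype (fun b => if b then (p : ℝ≥0∞) else 1 - (p : ℝ≥0∞)) (by
    have h : (p : ℝ≥0∞) ≤ 1 := by exact_mod_cast hp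
    simp [h])

/-- The distribution of states denoted by a closed process. -/
def interp : Proc L 0 → PMF (State L 0)
  | .ret s => PMF.pure s
  | .choice p hp q r => (coin p hp).bind (fun b => if b then interp q else interp r)

/-- Labels of the pre-semantics of states. -/
inductive SAct (L : Sig.{u}) : Type u
  | send (c : L.Chan) (v : L.Val)
  | recv (c : L.Chan) (v : L.Val)
  | tau

/-- Pre-semantics of states. -/
inductive STrans (D : Defs L) : State L 0 → SAct L → PMF (State L 0) → Prop
  | snd (c : L.Chan) (e : Exp L 0) (q : Proc L 0) : STrans D (.send c e q) (.send c e.eval) (interp q)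
  | rcv (c : L.Chan) (q : Proc L 1) (v : L.Val) :
      STrans D (.recv c q) (.recv c v) (interp (q.inst v))
  | tau (q : Proc L 0) : STrans D (.tau q) .tau (interp q)
  | sumL {s t : State L 0} {a : SAct L} {Δ : PMF (State L 0)} :
      STrans D s a Δ → STrans D (.sum s t) a Δ
  | sumR {s t : State L 0} {a : SAct L} {Δ : PMF (State L 0)} :
      STrans D t a Δ → STrans D (.sum s t) a Δ
  | thn {b : BExp L 0} {s t : State L 0} {a : SAct L} {Δ : PMF (State L 0)} :
      b.eval = true → STrans D s a Δ → STrans D (.branch b s t) a Δ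
  | els {b : BExp L 0} {s t : State L 0} {a : SAct L} {Δ : PMF (State L 0)} :
      b.eval = false → STrans D t a Δ → STrans D (.branch b s t) a Δ
  | call {A : L.Def} {e : Fin (L.defArity A) → Exp L 0} {a : SAct L} {Δ : PMF (State L 0)} :
      STrans D ((D A).subst e) a Δ → STrans D (.call A e) a Δ

/-- Labels of the intensional semantics; each carries the node that acts (for `recv`, the node from
which the message comes). -/
inductive IAct (L : Sig.{u}) : Type u
  | send (n : L.Node) (c : L.Chan) (v : L.Val)
  | recv (n : L.Node) (c : L.Chan) (v : L.Val)
  | tau (n : L.Node)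

/-- The image of a distribution of states under `s ↦ n⟦s⟧`. -/
def nodeDist (Δ : PMF (State L 0)) (n : L.Node) : PMF (Sys L) := Δ.map (fun s => .node s n)

/-- The product of two distributions of system terms, under parallel composition. -/
def parDist (Δ Θ : PMF (Sys L)) : PMF (Sys L) := Δ.bind (fun M => Θ.map (fun N => .par M N))

/-- Intensional semantics `Γ ▷ M —μ→ Δ` of networks. -/
inductive ITrans (D : Defs L) (Γ : Graph L) : Sys L → IAct L → PMF (Sys L) → Prop
  | broad {s : State L 0} {n : L.Node} {c : L.Chan} {v : L.Val} {Δ : PMF (State L 0)} :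
      STrans D s (.send c v) Δ → ITrans D Γ (.node s n) (.send n c v) (nodeDist Δ n)
  | hear {s : State L 0} {n m : L.Node} {c : L.Chan} {v : L.Val} {Δ : PMF (State L 0)} :
      STrans D s (.recv c v) Δ → Γ.E m n → ITrans D Γ (.node s n) (.recv m c v) (nodeDist Δ n)
  | deaf {s : State L 0} {n m : L.Node} {c : L.Chan} {v : L.Val} :
      (∀ Δ, ¬ STrans D s (.recv c v) Δ) →
      ITrans D Γ (.node s n) (.recv m c v) (PMF.pure (.node s n))
  | disc {s : State L 0} {n m : L.Node} {c : L.Chan} {v : L.Val} :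
      ¬ Γ.E m n → ITrans D Γ (.node s n) (.recv m c v) (PMF.pure (.node s n))
  | nil {m : L.Node} {c : L.Chan} {v : L.Val} : ITrans D Γ .nil (.recv m c v) (PMF.pure .nil)
  | tau {s : State L 0} {n : L.Node} {Δ : PMF (State L 0)} :
      STrans D s .tau Δ → ITrans D Γ (.node s n) (.tau n) (nodeDist Δ n)
  | tauPropL {M N : Sys L} {n : L.Node} {Δ : PMF (Sys L)} :
      ITrans D Γ M (.tau n) Δ → ITrans D Γ (.par M N) (.tau n) (parDist Δ (PMF.pure N))
  | tauPropR {M N : Sys L} {n : L.Node} {Θ : PMF (Sys L)} :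
      ITrans D Γ N (.tau n) Θ → ITrans D Γ (.par M N) (.tau n) (parDist (PMF.pure M) Θ)
  | prop {M N : Sys L} {m : L.Node} {c : L.Chan} {v : L.Val} {Δ Θ : PMF (Sys L)} :
      ITrans D Γ M (.recv m c v) Δ → ITrans D Γ N (.recv m c v) Θ →
      ITrans D Γ (.par M N) (.recv m c v) (parDist Δ Θ)
  | syncL {M N : Sys L} {m : L.Node} {c : L.Chan} {v : L.Val} {Δ Θ : PMF (Sys L)} :
      ITrans D Γ M (.send m c v) Δ → ITrans D Γ N (.recv m c v) Θ →
      ITrans D Γ (.par M N) (.send m c v) (parDist Δ Θ)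
  | syncR {M N : Sys L} {m : L.Node} {c : L.Chan} {v : L.Val} {Δ Θ : PMF (Sys L)} :
      ITrans D Γ M (.recv m c v) Δ → ITrans D Γ N (.send m c v) Θ →
      ITrans D Γ (.par M N) (.send m c v) (parDist Δ Θ)

/-- Structural congruence of states. -/
inductive SCong (D : Defs L) : State L 0 → State L 0 → Prop
  | refl (s : State L 0) : SCong D s s
  | symm {s t : State L 0} : SCong D s t → SCong D t s
  | trans {s t r : State L 0} : SCong D s t → SCong D t r → SCong D s r
  | sumCongr {s s' t t' : State L 0} : SCong D s s' → SCong D t t' → SCong D (.sum s t) (.sum s' t')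
  | comm (s t : State L 0) : SCong D (.sum s t) (.sum t s)
  | assoc (s t r : State L 0) : SCong D (.sum (.sum s t) r) (.sum s (.sum t r))
  | zero (s : State L 0) : SCong D (.sum s .nil) s
  | thn {b : BExp L 0} (s t : State L 0) : b.eval = true → SCong D (.branch b s t) s
  | els {b : BExp L 0} (s t : State L 0) : b.eval = false → SCong D (.branch b s t) t
  | call (A : L.Def) (e : Fin (L.defArity A) → Exp L 0) : SCong D (.call A e) ((D A).subst e)

/-- Structural congruence of system terms. -/
inductive Cong (D : Defs L) : Sys L → Sys L → Prop
  | refl (M : Sys L) : Cong D M M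
  | symm {M N : Sys L} : Cong D M N → Cong D N M
  | trans {M N P : Sys L} : Cong D M N → Cong D N P → Cong D M P
  | parCongr {M M' N N' : Sys L} : Cong D M M' → Cong D N N' → Cong D (.par M N) (.par M' N')
  | comm (M N : Sys L) : Cong D (.par M N) (.par N M)
  | assoc (M N P : Sys L) : Cong D (.par (.par M N) P) (.par M (.par N P))
  | zero (M : Sys L) : Cong D (.par M .nil) M
  | node {s t : State L 0} (n : L.Node) : SCong D s t → Cong D (.node s n) (.node t n)

/-- The success predicate `ω`: some node has the success clause enabled. -/
def Sys.Successful (D : Defs L) (M : Sys L) : Prop :=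
  ∃ (M' : Sys L) (s : State L 0) (n : L.Node), Cong D M (.par M' (.node (.sum .test s) n))

/-- The success predicate on networks. -/
def Network.Successful (D : Defs L) (M : Network L) : Prop := M.sys.Successful D

/-- `Γ ▷ Δ`: the distribution of networks given by a distribution of system terms. -/
def netDist (Γ : Graph L) (Δ : PMF (Sys L)) : PMF (Network L) := Δ.map (fun M => ⟨Γ, M⟩)

/-! ## Testing preorder -/

/-- Reductions of networks: internal moves and broadcasts. -/
inductive Red (D : Defs L) : Network L → PMF (Network L) → Prop
  | tau {M : Network L} {n : L.Node} {Δ : PMF (Sys L)} :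
      ITrans D M.graph M.sys (.tau n) Δ → Red D M (netDist M.graph Δ)
  | send {M : Network L} {n : L.Node} {c : L.Chan} {v : L.Val} {Δ : PMF (Sys L)} :
      ITrans D M.graph M.sys (.send n c v) Δ → Red D M (netDist M.graph Δ)

/-- The testing structure of networks. -/
def netTS (D : Defs L) : TestingStructure (Network L) := ⟨Red D, Network.Successful D⟩

/-- The results of a network. -/
def Network.results (D : Defs L) (M : Network L) : Set ℝ≥0∞ :=
  (netTS D).results (SubDist.point M)

/-- The must-testing preorder `M ⊑must N`. -/
def MustLE (D : Defs L) (M N : Network L) : Prop :=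
  M.inp = N.inp ∧ M.outp = N.outp ∧
    ∀ T : Network L, T.WF → M.Composable T → N.Composable T →
      SmythLE ((M.comp T).results D) ((N.comp T).results D)

/-! ## Extensional semantics -/

/-- Extensional actions. -/
inductive EAct (L : Sig.{u}) : Type u
  | tau
  | input (n : L.Node) (c : L.Chan) (v : L.Val)
  | output (c : L.Chan) (v : L.Val) (η : Set L.Node)

/-- Strong extensional actions of networks. -/
inductive ETrans (D : Defs L) : Network L → EAct L → PMF (Network L) → Prop
  | tau {M : Network L} {n : L.Node} {Δ : PMF (Sys L)} :
      ¬ M.Successful D → ITrans D M.graph M.sys (.tau n) Δ → ETrans D M .tau (netDist M.graph Δ)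
  | broad {M : Network L} {n : L.Node} {c : L.Chan} {v : L.Val} {Δ : PMF (Sys L)} :
      ¬ M.Successful D → ITrans D M.graph M.sys (.send n c v) Δ →
      (∀ m, M.graph.E n m → m ∈ M.sys.nodes) → ETrans D M .tau (netDist M.graph Δ)
  | input {M : Network L} {n : L.Node} {c : L.Chan} {v : L.Val} {Δ : PMF (Sys L)} :
      ¬ M.Successful D → ITrans D M.graph M.sys (.recv n c v) Δ → n ∈ M.inp →
      ETrans D M (.input n c v) (netDist M.graph Δ)
  | output {M : Network L} {m : L.Node} {c : L.Chan} {v : L.Val} {Δ : PMF (Sys L)}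
      {η : Set L.Node} :
      ¬ M.Successful D → ITrans D M.graph M.sys (.send m c v) Δ →
      η = {n ∈ M.outp | M.graph.E m n} → η.Nonempty →
      ETrans D M (.output c v η) (netDist M.graph Δ)

/-- The testing structure given by the extensional `τ`-actions. -/
def extTS (D : Defs L) : TestingStructure (Network L) :=
  ⟨fun M Δ => ETrans D M .tau Δ, Network.Successful D⟩

/-- Hyper-derivations of the extensional semantics. -/
def EHyper (D : Defs L) (Δ Δ' : SubDist (Network L)) : Prop := (extTS D).Hyper Δ Δ'

/-- A strong action preceded and followed by hyper-derivations. -/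
def AroundWeak (D : Defs L) (a : EAct L) (M : Network L) (Δ : SubDist (Network L)) : Prop :=
  ∃ Δ₁ Δ₂, EHyper D (SubDist.point M) Δ₁ ∧ Lift (fullRel (fun N Θ => ETrans D N a Θ)) Δ₁ Δ₂ ∧
    EHyper D Δ₂ Δ

/-- `W M η Δ` is closed under the two rules for weak outputs of `v` on `c`: a strong output between
hyper-derivations, and the sequencing of two weak outputs to disjoint sets of nodes. -/
structure WeakOutClosed (D : Defs L) (c : L.Chan) (v : L.Val)
    (W : Network L → Set L.Node → SubDist (Network L) → Prop) : Prop where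
  single : ∀ M η Δ, AroundWeak D (.output c v η) M Δ → W M η Δ
  seq : ∀ M η₁ η₂ Δ' Δ, W M η₁ Δ' → Lift (fun N Θ => W N η₂ Θ) Δ' Δ → Disjoint η₁ η₂ →
    W M (η₁ ∪ η₂) Δ

/-- Weak extensional actions; the weak outputs are the least relation closed under the two rules. -/
def EWeak (D : Defs L) : EAct L → Network L → SubDist (Network L) → Prop
  | .tau, M, Δ => EHyper D (SubDist.point M) Δ
  | .input n c v, M, Δ => AroundWeak D (.input n c v) M Δ
  | .output c v η, M, Δ => ∀ W, WeakOutClosed D c v W → W M η Δ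

/-! ## Divergence-free deadlock simulations -/

/-- Deadlocked networks. -/
def Deadlocked (D : Defs L) (M : Network L) : Prop :=
  ¬ M.Successful D ∧ (∀ Δ, ¬ ETrans D M .tau Δ) ∧ ∀ c v η Δ, ¬ ETrans D M (.output c v η) Δ

/-- `R` is a divergence-free deadlock simulation on well-formed networks; all the distributions in
it are full. -/
structure IsDFDeadSim (D : Defs L) (R : Network L → Network L → Prop) : Prop where
  wf : ∀ M N, R M N → M.WF ∧ N.WF
  dead : ∀ M N, R M N → Deadlocked D M →
    ∃ Θ : PMF (Network L), EWeak D .tau N (SubDist.ofPMF Θ) ∧ ∀ K ∈ Θ.support, Deadlocked D K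
  act : ∀ M N, R M N → ∀ (a : EAct L) (Δ : PMF (Network L)), EWeak D a M (SubDist.ofPMF Δ) →
    ∃ Θ : PMF (Network L), EWeak D a N (SubDist.ofPMF Θ) ∧
      Lift (ptRel R) (SubDist.ofPMF Δ) (SubDist.ofPMF Θ)

/-- The largest divergence-free deadlock simulation: `N` simulates `M`. -/
def DFDeadSim (D : Defs L) (M N : Network L) : Prop := ∃ R, IsDFDeadSim D R ∧ R M N

/-! ## Convergent, finitary and proper networks -/

/-- `K` is a state of the pLTS generated from `M` by the strong extensional actions. -/
def Reaches (D : Defs L) : Network L → Network L → Prop :=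
  Relation.ReflTransGen (fun M N => ∃ (a : EAct L) (Δ : PMF (Network L)),
    ETrans D M a Δ ∧ N ∈ Δ.support)

/-- Convergent networks: no state of the generated pLTS has the empty hyper-derivative. -/
def Convergent (D : Defs L) (M : Network L) : Prop :=
  ∀ K, Reaches D M K → ¬ EHyper D (SubDist.point K) SubDist.empty

/-- Finitary networks: the generated pLTS is finite state and finite branching. -/
structure Finitary (D : Defs L) (M : Network L) : Prop where
  states : {K | Reaches D M K}.Finite
  branching : ∀ K, Reaches D M K → {Δ | ∃ a, ETrans D K a Δ}.Finite

/-- The success clause occurs in a piece of code, or in the code of a definition that it uses,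
directly or indirectly. -/
inductive UsesTest (D : Defs L) : {κ : Kind} → {n : ℕ} → Code L κ n → Prop
  | test {n : ℕ} : UsesTest D (.test : State L n)
  | ret {n : ℕ} {s : State L n} : UsesTest D s → UsesTest D (.ret s)
  | choiceL {n : ℕ} {p : ℝ≥0} {hp : p ≤ 1} {q r : Proc L n} :
      UsesTest D q → UsesTest D (.choice p hp q r)
  | choiceR {n : ℕ} {p : ℝ≥0} {hp : p ≤ 1} {q r : Proc L n} :
      UsesTest D r → UsesTest D (.choice p hp q r)
  | send {n : ℕ} {c : L.Chan} {e : Exp L n} {q : Proc L n} : UsesTest D q → UsesTest D (.send c e q)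
  | recv {n : ℕ} {c : L.Chan} {q : Proc L (n + 1)} : UsesTest D q → UsesTest D (.recv c q)
  | sumL {n : ℕ} {s t : State L n} : UsesTest D s → UsesTest D (.sum s t)
  | sumR {n : ℕ} {s t : State L n} : UsesTest D t → UsesTest D (.sum s t)
  | thn {n : ℕ} {b : BExp L n} {s t : State L n} : UsesTest D s → UsesTest D (.branch b s t)
  | els {n : ℕ} {b : BExp L n} {s t : State L n} : UsesTest D t → UsesTest D (.branch b s t)
  | tau {n : ℕ} {q : Proc L n} : UsesTest D q → UsesTest D (.tau q)
  | call {n : ℕ} {A : L.Def} {e : Fin (L.defArity A) → Exp L n} :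
      UsesTest D (D A) → UsesTest D (.call A e)

/-- A system term in whose code the success clause does not occur. -/
def Sys.Proper (D : Defs L) : Sys L → Prop
  | .nil => True
  | .node s _ => ¬ UsesTest D s
  | .par M N => M.Proper D ∧ N.Proper D

/-- Proper networks. -/
def Network.Proper (D : Defs L) (M : Network L) : Prop := M.sys.Proper D

end WNet

end

open scoped ENNReal NNReal

noncomputable section

/-! Only inequalities between results matter, so a result `q` is replaced by the statement that some
strategy of the composed network has expected success at most `q`. This is the greatest fixed point
`Low Final`: a run may stop at a success for a price of at least 1, or at an unsuccessful network
without reductions for any price; it proceeds by reductions, and runs that never stop cost nothing.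
`low_of_mem_results` and `Low.exists_mem_results` are the two translations. It remains to turn a
strategy for N with the test into one for M with the test. This is done by coinduction on `Sim`: J
with the test term B has the bound, J is reachable from N, and K, which simulates J, stands beside
the same B.

Each reduction of the J side is followed on the K side. Extensional τ-moves are invisible to the
test, so hyper-derivations of K run beside a fixed B (`low_comp`). A strong input or output happens
together with the change of the test. A weak output may consist of several broadcasts, but they
reach disjoint sets of nodes, so every test node still hears the message once and the rounds add up
to one reception (`Receives.split`). The coupling given by the simulation turns prices after the
step of J into prices for K (`Lift.pushforward`), and these are carried back through the weak action
of K (`Lift.pullback`, `Hyper.pullback`). If J with B is stuck, J is deadlocked, K can reach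
deadlock, and the composition is stuck there too. Properness of M keeps K unsuccessful, so success
on the K side comes from the test alone.

The difficulty is guardedness: K may answer a τ of J by not moving, wholly or in part, and
coinduction needs a reduction in each round. Suppose that K with B has no strategy and no guarded
step at the price u. Then every part of an answer that moves costs more than u. Let G(J) be the
largest amount by which J, related to K, undercuts u. The price inequality makes G at most one of
its τ-averages; as N has finitely many reachable states and is convergent, a maximum principle gives
G = 0. So no J related to K undercuts u, and a J of price exactly u can only be answered by not
moving at all, with all its successors again related to K and of price u. These J form a set in
which τ-moves continue forever, against convergence (`Sim.progress`). -/

namespace WNet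

/-! ## Expectations -/

/-- The expectation of `g` with respect to the weights `p`. -/
def expect {α : Type*} (p g : α → ℝ≥0∞) : ℝ≥0∞ := ∑' a, p a * g a

section Expect

variable {α β : Type*}

theorem expect_le_of_support {p f g : α → ℝ≥0∞} (h : ∀ a, p a ≠ 0 → f a ≤ g a) :
    expect p f ≤ expect p g := by
  refine ENNReal.tsum_le_tsum fun a => ?_
  by_cases ha : p a = 0
  · simp [ha]
  · gcongr
    exact h a ha

theorem expect_add_right (p f g : α → ℝ≥0∞) :
    expect p (fun a => f a + g a) = expect p f + expect p g := by
  simp [expect, mul_add, ENNReal.tsum_add]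

theorem expect_add_left (p q g : α → ℝ≥0∞) :
    expect (fun a => p a + q a) g = expect p g + expect q g := by
  simp [expect, add_mul, ENNReal.tsum_add]

theorem expect_const (p : α → ℝ≥0∞) (c : ℝ≥0∞) : expect p (fun _ => c) = (∑' a, p a) * c :=
  ENNReal.tsum_mul_right

theorem expect_pmf_const (p : PMF α) (c : ℝ≥0∞) : expect p (fun _ => c) = c := by
  rw [expect_const, p.tsum_coe, one_mul]

theorem expect_pure (a : α) (g : α → ℝ≥0∞) : expect (PMF.pure a) g = g a := by
  classical
  rw [expect, tsum_eq_single a]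
  · simp
  · intro b hb
    simp [PMF.pure_apply_of_ne _ _ hb]

theorem expect_tsum_left {ι : Type*} (w : ι → ℝ≥0∞) (f : ι → α → ℝ≥0∞) (g : α → ℝ≥0∞) :
    expect (fun a => ∑' i, w i * f i a) g = ∑' i, w i * expect (f i) g := by
  simp only [expect, ← ENNReal.tsum_mul_right, ← ENNReal.tsum_mul_left]
  rw [ENNReal.tsum_comm]
  simp only [mul_assoc]

theorem expect_sum_left {ι : Type*} [Fintype ι] (w : ι → ℝ≥0∞) (f : ι → α → ℝ≥0∞)
    (g : α → ℝ≥0∞) :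
    expect (fun a => ∑ i, w i * f i a) g = ∑ i, w i * expect (f i) g := by
  simpa only [tsum_fintype] using expect_tsum_left w f g

theorem expect_bind (p : PMF α) (f : α → PMF β) (g : β → ℝ≥0∞) :
    expect (p.bind f) g = expect p (fun a => expect (f a) g) :=
  expect_tsum_left p (fun a => f a) g

theorem expect_map (p : PMF α) (f : α → β) (g : β → ℝ≥0∞) :
    expect (p.map f) g = expect p (fun a => g (f a)) := by
  rw [← PMF.bind_pure_comp, expect_bind]
  simp [expect_pure]

theorem expect_comm (p : α → ℝ≥0∞) (q : β → ℝ≥0∞) (g : α → β → ℝ≥0∞) :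
    expect p (fun a => expect q (g a)) = expect q (fun b => expect p (fun a => g a b)) := by
  simp only [expect, ← ENNReal.tsum_mul_left]
  rw [ENNReal.tsum_comm]
  refine tsum_congr fun b => tsum_congr fun a => ?_
  ring

/-- Monotone convergence; it carries the estimates for finitely many stages of a derivation over to
the whole derivation. -/
theorem expect_iSup (p : α → ℝ≥0∞) (f : ℕ → α → ℝ≥0∞) (hf : Monotone f) :
    expect p (fun a => ⨆ n, f n a) = ⨆ n, expect p (f n) := by
  apply le_antisymm
  · rw [expect, ENNReal.tsum_eq_iSup_sum]
    refine iSup_le fun F => ?_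
    simp only [ENNReal.mul_iSup]
    rw [ENNReal.finsetSum_iSup_of_monotone]
    · exact iSup_mono fun n => ENNReal.sum_le_tsum F
    · intro a m n hmn
      dsimp only
      gcongr
      exact hf hmn a
  · exact iSup_le fun n => expect_le_of_support fun a _ => le_iSup (fun n => f n a) n

/-- A weighted sum that stays below the total weight times `w` has a summand below `w`. -/
theorem exists_le_of_sum_mul_le {ι : Type*} {F : Finset ι} {a v : ι → ℝ≥0∞} {w : ℝ≥0∞}
    (h0 : ∑ i ∈ F, a i ≠ 0) (htop : ∑ i ∈ F, a i ≠ ∞)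
    (h : ∑ i ∈ F, a i * v i ≤ (∑ i ∈ F, a i) * w) : ∃ i ∈ F, a i ≠ 0 ∧ v i ≤ w := by
  classical
  have hne : (F.filter (fun i => a i ≠ 0)).Nonempty := by
    obtain ⟨i, hi, hai⟩ := Finset.exists_ne_zero_of_sum_ne_zero h0
    exact ⟨i, by simp [hi, hai]⟩
  obtain ⟨i, hi, hmin⟩ := Finset.exists_min_image _ v hne
  rw [Finset.mem_filter] at hi
  refine ⟨i, hi.1, hi.2, ?_⟩
  rw [← ENNReal.mul_le_mul_iff_right h0 htop]
  refine le_trans ?_ h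
  rw [Finset.sum_mul]
  refine Finset.sum_le_sum fun j hj => ?_
  by_cases hj0 : a j = 0
  · simp [hj0]
  · gcongr
    exact hmin j (by simp [hj, hj0])

theorem sum_subtype_ne_zero {ι : Type*} [Fintype ι] (p f : ι → ℝ≥0∞) [DecidablePred (p · ≠ 0)]
    (hf : ∀ i, p i = 0 → f i = 0) : ∑ i : {i // p i ≠ 0}, f i = ∑ i, f i := by
  rw [← Finset.sum_subtype (Finset.univ.filter (p · ≠ 0)) (by simp) f]
  exact Finset.sum_filter_of_ne fun i _ hi h0 => hi (hf i h0)

end Expect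

/-! ## Lifted relations -/

theorem SubDist.point_apply_of_ne {S : Type u} {s t : S} (h : t ≠ s) : SubDist.point s t = 0 :=
  PMF.pure_apply_of_ne _ _ h

theorem SubDist.point_apply_self {S : Type u} (s : S) : SubDist.point s s = 1 :=
  PMF.pure_apply_self s

theorem SubDist.apply_le_one {S : Type u} (Δ : SubDist S) (s : S) : Δ s ≤ 1 :=
  (ENNReal.le_tsum s).trans Δ.2

theorem expect_point {S : Type u} (s : S) (g : S → ℝ≥0∞) : expect (SubDist.point s) g = g s :=
  expect_pure s g

theorem expect_ofPMF {S : Type u} (Δ : PMF S) (g : S → ℝ≥0∞) :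
    expect (SubDist.ofPMF Δ) g = expect Δ g := rfl

/-- A lifted relation is given by finitely many weighted instances of the relation. -/
theorem Lift.normalForm {S T : Type u} {R : S → SubDist T → Prop} {Δ : SubDist S} {Θ : SubDist T}
    (h : Lift R Δ Θ) :
    ∃ (ι : Type) (_ : Fintype ι) (p : ι → ℝ≥0∞) (x : ι → S) (Ξ : ι → SubDist T),
      (∀ i, p i ≠ 0) ∧ ∑ i, p i ≤ 1 ∧ (∀ i, R (x i) (Ξ i)) ∧
      (∀ s, Δ s = ∑ i, p i * SubDist.point (x i) s) ∧ (∀ t, Θ t = ∑ i, p i * Ξ i t) := by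
  classical
  induction h with
  | @base s Θ h => exact ⟨Unit, inferInstance, fun _ => 1, fun _ => s, fun _ => Θ, by simp [h]⟩
  | @comb k p Δi Θi Δ Θ _ hp hΔ hΘ ih =>
    choose ι hι q x Ξ hq hq1 hR hx hΞ using ih
    -- Summands of weight zero are discarded, so that every remaining instance really lies in the
    -- supports.
    refine ⟨Σ i : {i // p i ≠ 0}, ι i, inferInstance, fun j => p j.1 * q j.1 j.2,
      fun j => x j.1 j.2, fun j => Ξ j.1 j.2, fun j => mul_ne_zero j.1.2 (hq _ _), ?_,
      fun j => hR _ _, fun s => ?_, fun t => ?_⟩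
    · rw [Fintype.sum_sigma]
      simp only [← Finset.mul_sum]
      calc ∑ i : {i // p i ≠ 0}, p i * ∑ j, q i j ≤ ∑ i : {i // p i ≠ 0}, p i :=
            Finset.sum_le_sum fun i _ => mul_le_of_le_one_right' (hq1 i)
        _ = ∑ i, p i := sum_subtype_ne_zero p p fun _ h => h
        _ ≤ 1 := hp
    · rw [hΔ, Fintype.sum_sigma]
      simp only [mul_assoc, ← Finset.mul_sum, ← hx]
      exact (sum_subtype_ne_zero p (fun i => p i * Δi i s) fun i h => by simp [h]).symm
    · rw [hΘ, Fintype.sum_sigma]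
      simp only [mul_assoc, ← Finset.mul_sum, ← hΞ]
      exact (sum_subtype_ne_zero p (fun i => p i * Θi i t) fun i h => by simp [h]).symm

/-- Finitely many weighted instances of a relation are in its lifting. -/
theorem Lift.of_finset {S T : Type u} {R : S → SubDist T → Prop} {ι : Type*} (F : Finset ι)
    (p : ι → ℝ≥0∞) (x : ι → S) (Ξ : ι → SubDist T) {Δ : SubDist S} {Θ : SubDist T}
    (hp : ∑ i ∈ F, p i ≤ 1) (hR : ∀ i ∈ F, R (x i) (Ξ i))
    (hΔ : ∀ s, Δ s = ∑ i ∈ F, p i * SubDist.point (x i) s)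
    (hΘ : ∀ t, Θ t = ∑ i ∈ F, p i * Ξ i t) : Lift R Δ Θ := by
  have key : ∀ f : ι → ℝ≥0∞, ∑ i ∈ F, f i = ∑ j : Fin F.card, f (F.equivFin.symm j) := fun f => by
    rw [← Finset.sum_coe_sort F f]
    exact (Equiv.sum_comp F.equivFin.symm (fun i : F => f i)).symm
  refine Lift.comb (fun j : Fin F.card => p (F.equivFin.symm j))
    (fun j => SubDist.point (x (F.equivFin.symm j))) (fun j => Ξ (F.equivFin.symm j))
    (fun j => .base (hR _ (F.equivFin.symm j).2)) ?_ ?_ ?_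
  · rwa [← key]
  · intro s; rw [hΔ, key]
  · intro t; rw [hΘ, key]

/-- Rewards after a lifted relation can be pulled back to rewards before it. -/
theorem Lift.pullback {S T : Type u} {R : S → SubDist T → Prop} {Δ : SubDist S} {Θ : SubDist T}
    (h : Lift R Δ Θ) (U : T → ℝ≥0∞) :
    ∃ V : S → ℝ≥0∞, (∀ s ∈ Δ.support, ∃ Ξ, R s Ξ ∧ expect Ξ U ≤ V s) ∧
      expect Δ V ≤ expect Θ U := by
  classical
  obtain ⟨ι, _, p, x, Ξ, hp, hp1, hR, hΔ, hΘ⟩ := h.normalForm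
  -- At `s`, the cheapest of the instances that start at `s`. The infimum is attained on the
  -- support; elsewhere it is `∞`, which does no harm at weight zero.
  refine ⟨fun s => ⨅ i ∈ Finset.univ.filter (fun i => x i = s), expect (Ξ i) U, ?_, ?_⟩
  · intro s hs
    have hne : (Finset.univ.filter (fun i => x i = s)).Nonempty := by
      rw [SubDist.support, Set.mem_ofPred_eq, hΔ] at hs
      obtain ⟨i, -, hi⟩ := Finset.exists_ne_zero_of_sum_ne_zero hs
      refine ⟨i, ?_⟩
      by_contra hne
      apply hi
      have : s ≠ x i := fun h => hne (by simp [h])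
      rw [SubDist.point_apply_of_ne this, mul_zero]
    obtain ⟨i, hi, h⟩ := Finset.exists_mem_eq_inf' hne (fun i => expect (Ξ i) U)
    have hi' : x i = s := by simpa using hi
    refine ⟨Ξ i, hi' ▸ hR i, ?_⟩
    refine le_iInf₂ fun j hj => ?_
    rw [← h]
    exact Finset.inf'_le _ hj
  · rw [show (Δ : S → ℝ≥0∞) = _ from funext hΔ, show (Θ : T → ℝ≥0∞) = _ from funext hΘ,
      expect_sum_left, expect_sum_left]
    refine Finset.sum_le_sum fun i _ => ?_
    gcongr
    rw [expect_point]
    exact iInf₂_le i (by simp)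

/-! ## Upper bounds for the rewards of hyper-derivations -/

namespace TestingStructure

variable {S : Type u} (T : TestingStructure S)

/-- From the unsuccessful state `s` some reduction leads into `P`, with expected bound `u`. -/
def Step (P : S → ℝ≥0∞ → Prop) (s : S) (u : ℝ≥0∞) : Prop :=
  ¬ T.succ s ∧ ∃ Δ : PMF S, T.red s Δ ∧ ∃ u' : S → ℝ≥0∞,
    (∀ t ∈ Δ.support, P t (u' t)) ∧ expect Δ u' ≤ u

/-- `T.Low Q s u`: some strategy from `s` that stops only where `Q` allows to stop with a certain
bound achieves the expected bound `u`. This is a greatest fixed point: runs that never stop count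
as `0`. -/
def Low (Q : S → ℝ≥0∞ → Prop) (s : S) (u : ℝ≥0∞) : Prop :=
  ∃ P : S → ℝ≥0∞ → Prop, (∀ s u, P s u → (∃ w ≤ u, Q s w) ∨ T.Step P s u) ∧ P s u

variable {T} {P Q Q' : S → ℝ≥0∞ → Prop} {s : S} {u v : ℝ≥0∞}

theorem Step.mono (h : T.Step P s u) (hu : u ≤ v) (hP : ∀ s u, P s u → Q s u) : T.Step Q s v := by
  obtain ⟨hs, Δ, hΔ, u', hu', hle⟩ := h
  exact ⟨hs, Δ, hΔ, u', fun t ht => hP _ _ (hu' t ht), hle.trans hu⟩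

theorem Low.unfold (h : T.Low Q s u) : (∃ w ≤ u, Q s w) ∨ T.Step (T.Low Q) s u := by
  obtain ⟨P, hP, hs⟩ := h
  exact (hP _ _ hs).imp_right fun h => h.mono le_rfl fun t w ht => ⟨P, hP, ht⟩

theorem Low.of_unfold (h : (∃ w ≤ u, Q s w) ∨ T.Step (T.Low Q) s u) : T.Low Q s u :=
  ⟨fun s u => (∃ w ≤ u, Q s w) ∨ T.Step (T.Low Q) s u,
    fun _ _ h => h.imp_right fun h => h.mono le_rfl fun _ _ => Low.unfold, h⟩

theorem Low.halt (h : Q s u) : T.Low Q s u := .of_unfold (.inl ⟨u, le_rfl, h⟩)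

theorem Low.step (h : T.Step (T.Low Q) s u) : T.Low Q s u := .of_unfold (.inr h)

theorem Low.mono_right (h : T.Low Q s u) (hu : u ≤ v) : T.Low Q s v :=
  .of_unfold (h.unfold.imp (fun ⟨w, hw, hQ⟩ => ⟨w, hw.trans hu, hQ⟩)
    fun h => h.mono hu fun _ _ => id)

/-- Strategies compose: wherever the first one stops, the second one takes over at the price reached
there. -/
theorem Low.bind (h : T.Low Q s u) (hQ : ∀ s u, Q s u → T.Low Q' s u) : T.Low Q' s u := by
  refine ⟨fun s u => T.Low Q s u ∨ T.Low Q' s u, ?_, .inl h⟩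
  have key : ∀ s u, T.Low Q' s u →
      (∃ w ≤ u, Q' s w) ∨ T.Step (fun s u => T.Low Q s u ∨ T.Low Q' s u) s u := fun s u h =>
    h.unfold.imp_right fun h => h.mono le_rfl fun _ _ => .inr
  rintro s u (h | h)
  · rcases h.unfold with ⟨w, hw, h⟩ | h
    · exact key _ _ ((hQ _ _ h).mono_right hw)
    · exact .inr (h.mono le_rfl fun _ _ => .inl)
  · exact key _ _ h

theorem Low.mono (h : T.Low Q s u) (hQ : ∀ s u, Q s u → Q' s u) : T.Low Q' s u :=
  h.bind fun _ _ h => .halt (hQ _ _ h)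

/-- Coinduction, where each round takes at least one reduction. -/
theorem Low.coinduction (hP : ∀ s u, P s u → T.Low Q s u ∨ T.Step (T.Low P) s u) (h : P s u) :
    T.Low Q s u := by
  have key : ∀ s u, T.Low Q s u →
      (∃ w ≤ u, Q s w) ∨ T.Step (fun s u => T.Low P s u ∨ T.Low Q s u) s u := fun s u h =>
    h.unfold.imp_right fun h => h.mono le_rfl fun _ _ => .inr
  -- Where the strategy towards `P` stops, `hP` offers a strategy towards `Q` or an actual
  -- reduction. Without that reduction the unfolding could return to `P` forever at the same state.
  refine ⟨fun s u => T.Low P s u ∨ T.Low Q s u, ?_, .inl (.halt h)⟩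
  rintro s u (h | h)
  · rcases h.unfold with ⟨w, hw, h⟩ | h
    · rcases hP _ _ h with h | h
      · exact key _ _ (h.mono_right hw)
      · exact .inr (h.mono hw fun _ _ => .inl)
    · exact .inr (h.mono le_rfl fun _ _ => .inl)
  · exact key _ _ h

/-- A strategy that ends with a reduction starts with one. -/
theorem Low.step_of_step (h : T.Low (T.Step (T.Low Q)) s u) : T.Step (T.Low Q) s u := by
  rcases h.unfold with ⟨w, hw, h⟩ | h
  · exact h.mono hw fun _ _ => id
  · exact h.mono le_rfl fun _ _ h => h.bind fun _ _ => .step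

/-- The bounds that are allowed when a run of a test ends. -/
def Final (T : TestingStructure S) (s : S) (u : ℝ≥0∞) : Prop :=
  (T.succ s ∧ 1 ≤ u) ∨ (¬ T.succ s ∧ ∀ Δ, ¬ T.red s Δ)

/-- No run earns more than 1, so the strategy that proceeds until a success or a stuck state is good
enough. -/
theorem low_final_of_one_le (h : 1 ≤ u) : T.Low T.Final s u := by
  refine ⟨fun _ u => 1 ≤ u, fun s u h => ?_, h⟩
  by_cases hs : T.succ s
  · exact .inl ⟨u, le_rfl, .inl ⟨hs, h⟩⟩
  by_cases hr : ∃ Δ, T.red s Δ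
  · obtain ⟨Δ, hΔ⟩ := hr
    exact .inr ⟨hs, Δ, hΔ, fun _ => 1, fun _ _ => le_rfl, by rwa [expect_pmf_const]⟩
  · push Not at hr
    exact .inl ⟨u, le_rfl, .inr ⟨hs, hr⟩⟩

theorem Low.one_le_of_succ (h : T.Low T.Final s u) (hs : T.succ s) : 1 ≤ u := by
  rcases h.unfold with ⟨w, hw, ⟨-, h⟩ | ⟨h, -⟩⟩ | ⟨h, -⟩
  · exact h.trans hw
  · exact absurd hs h
  · exact absurd hs h

/-! ### Hyper-derivations realising a bound -/

section Realize

variable (go : S × ℝ≥0∞ → Prop) (κ : S × ℝ≥0∞ → PMF (S × ℝ≥0∞))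

open Classical in
/-- One step of the chain that follows `κ` on `go`, and disappears elsewhere. -/
def chainStep (go : S × ℝ≥0∞ → Prop) (κ : S × ℝ≥0∞ → PMF (S × ℝ≥0∞)) :
    Option (S × ℝ≥0∞) → PMF (Option (S × ℝ≥0∞))
  | none => PMF.pure none
  | some x => if go x then (κ x).map some else PMF.pure none

/-- The chain after `k` steps. -/
def chain (x : S × ℝ≥0∞) : ℕ → PMF (Option (S × ℝ≥0∞))
  | 0 => PMF.pure (some x)
  | k + 1 => (chain x k).bind (chainStep go κ)

open Classical in
/-- The part of the mass of the chain that satisfies `A`, as a sub-distribution of states. -/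
def chainPart (p : PMF (Option (S × ℝ≥0∞))) (A : S × ℝ≥0∞ → Prop) : SubDist S :=
  ⟨fun s => expect p (fun o => o.elim 0 fun x => if A x ∧ x.1 = s then 1 else 0), by
    simp only [expect]
    rw [ENNReal.tsum_comm, ← p.tsum_coe]
    refine ENNReal.tsum_le_tsum fun o => ?_
    rw [ENNReal.tsum_mul_left]
    refine mul_le_of_le_one_right' ?_
    cases o with
    | none => simp
    | some x =>
      simp only [Option.elim]
      rw [tsum_eq_single x.1]
      · split_ifs <;> simp
      · intro s hs
        simp [Ne.symm hs]⟩

open Classical in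
theorem expect_chainPart (p : PMF (Option (S × ℝ≥0∞))) (A : S × ℝ≥0∞ → Prop) (r : S → ℝ≥0∞) :
    expect (chainPart p A) r = expect p (fun o => o.elim 0 fun x => if A x then r x.1 else 0) := by
  simp only [expect, chainPart, ← ENNReal.tsum_mul_right]
  rw [ENNReal.tsum_comm]
  refine tsum_congr fun o => ?_
  cases o with
  | none => simp
  | some x =>
    rw [tsum_eq_single x.1]
    · by_cases h : A x <;> simp [h]
    · intro s hs
      simp [Ne.symm hs]

theorem mem_support_chainPart {p : PMF (Option (S × ℝ≥0∞))} {A : S × ℝ≥0∞ → Prop} {s : S} :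
    s ∈ (chainPart p A).support ↔ ∃ x, some x ∈ p.support ∧ A x ∧ x.1 = s := by
  classical
  simp only [SubDist.support, Set.mem_ofPred_eq, chainPart, expect, ne_eq, ENNReal.tsum_eq_zero,
    not_forall, PMF.mem_support_iff, mul_eq_zero, not_or]
  constructor
  · rintro ⟨o, h1, h2⟩
    cases o with
    | none => simp at h2
    | some x => exact ⟨x, h1, by simpa using h2⟩
  · rintro ⟨x, h1, h2⟩
    exact ⟨some x, h1, by simpa using h2⟩

end Realize

theorem expect_option_elim {α : Type*} (p : PMF (Option α)) (F : Finset α) (f : α → ℝ≥0∞)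
    (hF : ∀ x, some x ∈ p.support → f x ≠ 0 → x ∈ F) :
    expect p (fun o => o.elim 0 f) = ∑ x ∈ F, p (some x) * f x := by
  rw [expect, tsum_eq_sum (s := F.map .some)]
  · simp
  · intro o ho
    cases o with
    | none => simp
    | some x =>
      simp only [Option.elim, mul_eq_zero]
      by_contra! h
      exact ho (by simpa using hF x ((PMF.mem_support_iff _ _).2 h.1) h.2)

/-- The strategy is run as a Markov chain on states paired with their current price, with `none` as
a sink for mass that has stopped. Expected prices never increase, which bounds the reward collected.
Finite supports are needed because the lifting admits finite sums only. -/
theorem Low.exists_hyper (hfin : ∀ s Δ, T.red s Δ → Δ.support.Finite) (h : T.Low Q s u) :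
    ∃ Δ', T.Hyper (SubDist.point s) Δ' ∧ (∀ t ∈ Δ'.support, ∃ w, Q t w) ∧
      ∀ r : S → ℝ≥0∞, (∀ t w, Q t w → r t ≤ w) → expect Δ' r ≤ u := by
  classical
  -- The chain stops as soon as `Q` permits it within the current price. The second conjunct holds
  -- on all of the chain, by `hinv`; stating it here lets the next reduction be chosen as a
  -- function.
  set go : S × ℝ≥0∞ → Prop := fun x => (¬ ∃ w ≤ x.2, Q x.1 w) ∧ T.Low Q x.1 x.2 with hgo
  have hstep : ∀ x, go x → T.Step (T.Low Q) x.1 x.2 := fun x hx =>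
    hx.2.unfold.resolve_left hx.1
  have : Nonempty (PMF S) := ⟨PMF.pure s⟩
  choose! hns Δ hΔ u' hu' hle using hstep
  set κ : S × ℝ≥0∞ → PMF (S × ℝ≥0∞) := fun x => (Δ x).map (fun t => (t, u' x t)) with hκ
  set p := chain go κ (s, u) with hp
  have hchain : ∀ o o', o' ∈ (chainStep go κ o).support ↔
      (∃ x, o = some x ∧ go x ∧ ∃ t ∈ (Δ x).support, o' = some (t, u' x t)) ∨
        ((∀ x, o = some x → ¬ go x) ∧ o' = none) := by
    intro o o'
    cases o with
    | none => simp [chainStep]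
    | some x =>
      by_cases hx : go x
      · have h : o' ∈ ((κ x).map some).support ↔
            ∃ t ∈ (Δ x).support, o' = some (t, u' x t) := by
          simp only [hκ, PMF.support_map, Set.image_image, Set.mem_image, eq_comm]
        simp only [chainStep, hx, if_true, h, Option.some.injEq, exists_eq_left', true_and]
        simp [hx]
      · simp [chainStep, hx]
  have hinv : ∀ k x, some x ∈ (p k).support → T.Low Q x.1 x.2 := by
    intro k
    induction k with
    | zero =>
      intro x hx
      simp only [hp, chain, PMF.support_pure, Set.mem_singleton_iff, Option.some.injEq] at hx
      simpa [hx] using h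
    | succ k ih =>
      intro x hx
      simp only [hp, chain, PMF.mem_support_bind_iff] at hx
      obtain ⟨o, ho, hx⟩ := hx
      rcases (hchain _ _).1 hx with ⟨y, rfl, hy, t, ht, hxt⟩ | ⟨-, h⟩
      · cases hxt
        exact hu' y hy t ht
      · cases h
  have hfinp : ∀ k, (p k).support.Finite := by
    intro k
    induction k with
    | zero => simp [hp, chain]
    | succ k ih =>
      simp only [hp, chain, PMF.support_bind]
      refine ih.biUnion fun o _ => ?_
      cases o with
      | none => simp [chainStep]
      | some x =>
        by_cases hx : go x
        · simp only [chainStep, hx, if_true, hκ, PMF.support_map]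
          exact ((hfin _ _ (hΔ x hx)).image _).image _
        · simp [chainStep, hx]
  have hstepval : ∀ f : S × ℝ≥0∞ → ℝ≥0∞, ∀ o,
      expect (chainStep go κ o) (fun o => o.elim 0 f) =
        o.elim 0 (fun x => if go x then expect (Δ x) (fun t => f (t, u' x t)) else 0) := by
    intro f o
    cases o with
    | none => simp [chainStep, expect_pure]
    | some x =>
      by_cases hx : go x
      · simp [chainStep, hx, hκ, expect_map]
      · simp [chainStep, hx, expect_pure]
  have hsplit : ∀ k (t : S), chainPart (p k) (fun _ => True) t =
      chainPart (p k) go t + chainPart (p k) (fun x => ¬ go x) t := by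
    intro k t
    simp only [chainPart]
    rw [← expect_add_right]
    congr 1
    funext o
    cases o with
    | none => simp
    | some x => by_cases hx : go x <;> simp [hx]
  -- Mass that halts at stage `k` sits in the sink from stage `k + 1` on, so the total halted mass
  -- is at most 1.
  have hmass : ∀ n, ∑ k ∈ Finset.range n, ∑' t, chainPart (p k) (fun x => ¬ go x) t
      ≤ p n none := by
    intro n
    induction n with
    | zero => simp
    | succ n ih =>
      rw [Finset.sum_range_succ]
      have h1 : p (n + 1) none = expect (p n) (fun o => chainStep go κ o none) := rfl
      have h2 : ∑' t, chainPart (p n) (fun x => ¬ go x) t =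
          expect (chainPart (p n) (fun x => ¬ go x)) (fun _ => 1) := by simp [expect]
      have h3 : p n none = expect (p n) (fun o => o.elim 1 fun _ => 0) := by
        rw [expect, tsum_eq_single none]
        · simp
        · intro o ho
          cases o with
          | none => exact absurd rfl ho
          | some x => simp
      rw [h2, expect_chainPart, h1]
      rw [h3] at ih
      refine (add_le_add_left ih _).trans ?_
      rw [← expect_add_right]
      refine expect_le_of_support fun o _ => ?_
      cases o with
      | none => simp [chainStep]
      | some x => by_cases hx : go x <;> simp [hx, chainStep]
  refine ⟨⟨fun t => ∑' k, chainPart (p k) (fun x => ¬ go x) t, ?_⟩,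
    ⟨fun k => chainPart (p k) go, fun k => chainPart (p k) (fun x => ¬ go x), ?_, ?_, ?_,
      fun t => rfl⟩, ?_, ?_⟩
  · rw [ENNReal.tsum_comm]
    exact ENNReal.tsum_le_of_sum_range_le fun n => (hmass n).trans (PMF.coe_le_one _ _)
  · intro t
    rw [← hsplit]
    simp only [chainPart, hp, chain, expect_pure]
    by_cases hst : s = t
    · simp [hst, SubDist.point_apply_self]
    · simp [hst, SubDist.point_apply_of_ne (Ne.symm hst)]
  · intro k
    refine ⟨chainPart (p (k + 1)) (fun _ => True), ?_, hsplit (k + 1)⟩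
    have hF : {x | some x ∈ (p k).support ∧ go x}.Finite :=
      ((hfinp k).preimage (Option.some_injective _).injOn).subset fun x hx => hx.1
    refine Lift.of_finset hF.toFinset (fun x => p k (some x)) (fun x => x.1)
      (fun x => SubDist.ofPMF (Δ x)) ?_ ?_ ?_ ?_
    · have := expect_option_elim (p k) hF.toFinset (fun x => if go x then 1 else 0)
        (by intro x hx hx'; simpa using ⟨(PMF.mem_support_iff _ _).1 hx, by simpa using hx'⟩)
      refine (Finset.sum_le_sum ?_).trans (this.symm.le.trans ?_)
      · intro x hx
        have : go x := by simp at hx; exact hx.2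
        simp [this]
      · refine (expect_le_of_support fun o _ => ?_).trans (expect_pmf_const (p k) 1).le
        cases o with
        | none => simp
        | some x => by_cases hx : go x <;> simp [hx]
    · intro x hx
      exact ⟨Δ x, rfl, hΔ x (by simp at hx; exact hx.2)⟩
    · intro t
      refine Eq.trans (b := expect (p k) (fun o => o.elim 0 fun x =>
        if go x ∧ x.1 = t then 1 else 0)) (by simp only [chainPart]; congr!) ?_
      refine (expect_option_elim (p k) hF.toFinset
        (fun x => if go x ∧ x.1 = t then 1 else 0) ?_).trans ?_
      · intro x hx hx'
        have : go x ∧ x.1 = t := by simpa using hx'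
        simpa using ⟨(PMF.mem_support_iff _ _).1 hx, this.1⟩
      · refine Finset.sum_congr rfl fun x hx => ?_
        have hgx : go x := by simp at hx; exact hx.2
        by_cases hxt : x.1 = t
        · simp [hgx, hxt, SubDist.point_apply_self]
        · simp [hxt, SubDist.point_apply_of_ne (Ne.symm hxt)]
    · intro t
      have h1 : chainPart (p (k + 1)) (fun _ => True) t =
          expect (p k) (fun o => o.elim 0 (fun x => if go x then
            expect (Δ x) (fun t' => if t' = t then 1 else 0) else 0)) := by
        simp only [chainPart, hp, chain, true_and]
        rw [expect_bind]
        simp only [hstepval]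
      rw [h1, expect_option_elim (p k) hF.toFinset]
      · refine Finset.sum_congr rfl fun x hx => ?_
        have hgx : go x := by simp at hx; exact hx.2
        simp only [hgx, if_true]
        congr 1
        rw [expect, tsum_eq_single t]
        · simp [SubDist.ofPMF]
        · intro t' ht'
          simp [ht']
      · intro x hx hx'
        have : go x := by
          by_contra hgx
          simp [hgx] at hx'
        simpa using ⟨(PMF.mem_support_iff _ _).1 hx, this⟩
  · intro k t ht
    obtain ⟨x, -, hx, rfl⟩ := mem_support_chainPart.1 ht
    exact hns x hx
  · intro t ht
    have : ∃ k, chainPart (p k) (fun x => ¬ go x) t ≠ 0 := by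
      by_contra! h0
      exact ht (by simp [h0])
    obtain ⟨k, hk⟩ := this
    obtain ⟨x, hx, hgx, rfl⟩ := mem_support_chainPart.1 hk
    by_contra hno
    exact hgx ⟨fun ⟨w, _, hw⟩ => hno ⟨w, hw⟩, hinv k x hx⟩
  · intro r hr
    -- Supermartingale: reward already collected plus the expected price of the mass still present
    -- stays below `u`.
    have hdec : ∀ n, ∑ k ∈ Finset.range n, expect (chainPart (p k) (fun x => ¬ go x)) r +
        expect (p n) (fun o => o.elim 0 Prod.snd) ≤ u := by
      intro n
      induction n with
      | zero => simp [hp, chain, expect_pure]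
      | succ n ih =>
        refine le_trans ?_ ih
        rw [Finset.sum_range_succ, add_assoc]
        gcongr
        have h1 : expect (p (n + 1)) (fun o => o.elim 0 Prod.snd) =
            expect (p n) (fun o => o.elim 0 (fun x => if go x then expect (Δ x) (u' x) else 0)) := by
          simp only [hp, chain]
          rw [expect_bind]
          simp only [hstepval]
        rw [h1, expect_chainPart, ← expect_add_right]
        refine expect_le_of_support fun o ho => ?_
        cases o with
        | none => simp
        | some x =>
          by_cases hx : go x
          · simpa [hx] using hle x hx
          · have : ∃ w ≤ x.2, Q x.1 w := by
              by_contra hno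
              exact hx ⟨hno, hinv n x ((PMF.mem_support_iff _ _).2 ho)⟩
            obtain ⟨w, hw, hQ⟩ := this
            simpa [hx] using (hr _ _ hQ).trans hw
    have h1 : expect (fun t => ∑' k, chainPart (p k) (fun x => ¬ go x) t) r =
        ∑' k, expect (chainPart (p k) (fun x => ¬ go x)) r := by
      simpa using expect_tsum_left (fun _ => 1) (fun k => chainPart (p k) (fun x => ¬ go x)) r
    refine h1.trans_le ?_
    exact ENNReal.tsum_le_of_sum_range_le fun n => le_self_add.trans (hdec n)

/-! ### The expected reward of a hyper-derivation, stage by stage -/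

section Split

variable {ι : ℕ → Type} [∀ k, Fintype (ι k)] (p : ∀ k, ι k → ℝ≥0∞) (x : ∀ k, ι k → S)
  (Ξ : ∀ k, ι k → PMF S) (go halt : ℕ → SubDist S) (r : S → ℝ≥0∞)

open Classical in
/-- The expected reward, within `n` stages, of the mass that proceeds at stage `k` from `t`; the
derivation moves by the weighted reductions `x k j → Ξ k j` at stage `k`. -/
def goValue : ℕ → ℕ → S → ℝ≥0∞
  | 0, _, _ => 0
  | n + 1, k, t => (∑ j, if x k j = t then p k j * expect (Ξ k j) (fun y =>
      (halt (k + 1) y * r y + go (k + 1) y * goValue n (k + 1) y) /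
        (go (k + 1) y + halt (k + 1) y)) else 0) / go k t

/-- The expected reward, within `n` stages, of the mass at stage `k` at `t`. -/
def stageValue (n k : ℕ) (t : S) : ℝ≥0∞ :=
  (halt k t * r t + go k t * goValue p x Ξ go halt r n k t) / (go k t + halt k t)

theorem goValue_mono : Monotone (goValue p x Ξ go halt r) := by
  classical
  refine monotone_nat_of_le_succ fun n => ?_
  induction n with
  | zero => intro k t; simp [goValue]
  | succ n ih =>
    intro k t
    simp only [goValue]
    gcongr with j
    split_ifs
    · gcongr
      refine expect_le_of_support fun y _ => ?_
      gcongr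
      exact ih _ _
    · rfl

theorem stageValue_mono (k : ℕ) : Monotone (fun n => stageValue p x Ξ go halt r n k) := by
  intro m n hmn t
  simp only [stageValue]
  gcongr
  exact goValue_mono p x Ξ go halt r hmn k t

/-- Induction on the horizon: what the mass proceeding at stage `k` still earns is paid by mass
halting at later stages. Multiplying a quotient back by its denominator gives at most the numerator,
also when the denominator is 0. -/
theorem expect_goValue_le
    (hnext : ∀ k t, go (k + 1) t + halt (k + 1) t = ∑ j, p k j * Ξ k j t) (n k : ℕ) :
    expect (go k) (goValue p x Ξ go halt r n k) ≤ ∑' i, expect (halt (k + 1 + i)) r := by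
  classical
  induction n generalizing k with
  | zero => simp [goValue, expect]
  | succ n ih =>
    have h1 : expect (go k) (goValue p x Ξ go halt r (n + 1) k) ≤
        ∑' t, ∑ j, if x k j = t then p k j * expect (Ξ k j)
          (stageValue p x Ξ go halt r n (k + 1)) else 0 := by
      refine ENNReal.tsum_le_tsum fun t => ?_
      exact ENNReal.mul_div_le
    refine h1.trans ?_
    rw [Summable.tsum_finsetSum (fun _ _ => ENNReal.summable)]
    refine (Finset.sum_congr rfl fun j _ => (tsum_eq_single (x k j) fun t ht =>
      if_neg (Ne.symm ht)).trans (if_pos rfl)).trans_le ?_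
    have h2 : ∑ j, p k j * expect (Ξ k j) (stageValue p x Ξ go halt r n (k + 1)) =
        expect (fun t => go (k + 1) t + halt (k + 1) t)
          (stageValue p x Ξ go halt r n (k + 1)) := by
      rw [← expect_sum_left]
      simp only [hnext]
    rw [h2, tsum_eq_zero_add' ENNReal.summable]
    have h3 : expect (fun t => go (k + 1) t + halt (k + 1) t)
          (stageValue p x Ξ go halt r n (k + 1)) ≤
        expect (halt (k + 1)) r + expect (go (k + 1)) (goValue p x Ξ go halt r n (k + 1)) := by
      simp only [expect]
      rw [← ENNReal.tsum_add]
      refine ENNReal.tsum_le_tsum fun t => ?_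
      exact ENNReal.mul_div_le
    refine h3.trans ?_
    rw [add_zero]
    gcongr
    refine (ih (k + 1)).trans (le_of_eq (tsum_congr fun i => ?_))
    rw [show k + 1 + 1 + i = k + 1 + (i + 1) by omega]

/-- From every state in `go k` one of the weighted reductions achieves the expected reward. -/
theorem exists_step_goValue (k : ℕ) (t : S) (ht : go k t ≠ 0)
    (hgo : ∀ k t, go k t = ∑ j, p k j * SubDist.point (x k j) t) :
    ∃ j, x k j = t ∧ p k j ≠ 0 ∧
      expect (Ξ k j) (fun y => ⨆ n, stageValue p x Ξ go halt r n (k + 1) y) ≤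
        ⨆ n, goValue p x Ξ go halt r n k t := by
  classical
  set F : Finset (ι k) := Finset.univ.filter (fun j => x k j = t) with hF
  have hsum : ∑ j ∈ F, p k j = go k t := by
    rw [hgo, hF, Finset.sum_filter]
    refine Finset.sum_congr rfl fun j _ => ?_
    by_cases hj : x k j = t
    · simp [hj, SubDist.point_apply_self]
    · simp [hj, SubDist.point_apply_of_ne (Ne.symm hj)]
  have htop : go k t ≠ ∞ := ((SubDist.apply_le_one _ _).trans_lt ENNReal.one_lt_top).ne
  -- The value at `t` is the mean over the reductions taken from `t`, so one of them does not exceed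
  -- it. The horizon grows by one with the reduction, hence the `n + 1` in the supremum below.
  obtain ⟨j, hj, hp, hle⟩ := exists_le_of_sum_mul_le (F := F) (a := p k)
    (v := fun j => expect (Ξ k j) (fun y => ⨆ n, stageValue p x Ξ go halt r n (k + 1) y))
    (w := ⨆ n, goValue p x Ξ go halt r n k t) (by rwa [hsum]) (by rwa [hsum]) (by
      rw [hsum]
      simp only [expect_iSup _ _ (stageValue_mono p x Ξ go halt r (k + 1)), ENNReal.mul_iSup]
      rw [ENNReal.finsetSum_iSup_of_monotone]
      · refine iSup_le fun n => ?_
        refine le_trans ?_ (le_iSup _ (n + 1))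
        simp only [goValue]
        rw [ENNReal.mul_div_cancel ht htop, hF, Finset.sum_filter]
        rfl
      · intro j m n hmn
        dsimp only
        gcongr
        exact expect_le_of_support fun y _ => stageValue_mono p x Ξ go halt r (k + 1) hmn y)
  exact ⟨j, by simpa [hF] using hj, hp, hle⟩

end Split

/-- The reward of a hyper-derivation, split into the rewards of the mass that stops at once, and
bounds that are achieved after at least one reduction. -/
theorem Hyper.split {Δ Θ : SubDist S} (h : T.Hyper Δ Θ) {r : S → ℝ≥0∞}
    (hr : ∀ t ∈ Θ.support, Q t (r t)) :
    ∃ go halt V : S → ℝ≥0∞, (∀ t, Δ t = go t + halt t) ∧ (∀ t, halt t ≤ Θ t) ∧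
      (∀ t, go t ≠ 0 → T.Step (T.Low Q) t (V t)) ∧
      expect halt r + expect go V ≤ expect Θ r := by
  classical
  obtain ⟨go, halt, h0, hstep, hns, hΘ⟩ := h
  choose Ξ' hlift hΞ' using hstep
  choose ι hι p x Ξs hp hp1 hred hgo hΞs using fun k => (hlift k).normalForm
  choose Ξ hΞ hred using hred
  have hnext : ∀ k t, go (k + 1) t + halt (k + 1) t = ∑ j, p k j * Ξ k j t := by
    intro k t
    rw [← hΞ', hΞs]
    refine Finset.sum_congr rfl fun j _ => ?_
    rw [hΞ]
    rfl
  have hhalt : ∀ k t, halt k t ≤ Θ t := fun k t => by rw [hΘ]; exact ENNReal.le_tsum k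
  -- `U k t` is the price of all mass at `t` in stage `k`, and `V k t` that of its proceeding part.
  set U : ℕ → S → ℝ≥0∞ := fun k t => ⨆ n, stageValue p x Ξ go halt r n k t with hU
  set V : ℕ → S → ℝ≥0∞ := fun k t => ⨆ n, goValue p x Ξ go halt r n k t with hV
  have hUV : ∀ k t, (go k t + halt k t) * U k t = halt k t * r t + go k t * V k t := by
    intro k t
    simp only [hU, hV, stageValue, ← ENNReal.iSup_div, ENNReal.mul_iSup, ENNReal.add_iSup]
    by_cases hz : go k t + halt k t = 0
    · simp only [add_eq_zero] at hz
      simp [hz.1, hz.2]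
    · have ht : go k t + halt k t ≠ ∞ :=
        (ENNReal.add_lt_top.2 ⟨(SubDist.apply_le_one _ _).trans_lt ENNReal.one_lt_top,
          (SubDist.apply_le_one _ _).trans_lt ENNReal.one_lt_top⟩).ne
      rw [ENNReal.mul_div_cancel hz ht]
  have hstepV : ∀ k t, go k t ≠ 0 → T.Step (fun t w => ∃ k, go k t + halt k t ≠ 0 ∧ U k t ≤ w)
      t (V k t) := by
    intro k t ht
    obtain ⟨j, rfl, hpj, hle⟩ := exists_step_goValue p x Ξ go halt r k t ht hgo
    refine ⟨hns k _ ht, Ξ k j, hred k j, U (k + 1), fun y hy => ⟨k + 1, ?_, le_rfl⟩, hle⟩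
    rw [hnext]
    intro h0
    have := (Finset.sum_eq_zero_iff.1 h0) j (Finset.mem_univ _)
    exact (mul_ne_zero hpj ((PMF.mem_support_iff _ _).1 hy)) this
  have hlow : ∀ t w, (∃ k, go k t + halt k t ≠ 0 ∧ U k t ≤ w) → T.Low Q t w := by
    intro t w h
    -- A derivation may treat the same state differently at different stages, so the invariant lets
    -- the stage vary.
    refine ⟨fun t w => ∃ k, go k t + halt k t ≠ 0 ∧ U k t ≤ w, ?_, h⟩
    rintro t w ⟨k, hk, hw⟩
    have key := hUV k t
    by_cases hrt : halt k t ≠ 0 ∧ r t ≤ U k t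
    · left
      exact ⟨r t, hrt.2.trans hw, hr t fun h => hrt.1 (le_antisymm (h ▸ hhalt k t) zero_le)⟩
    · right
      have hgo0 : go k t ≠ 0 ∧ V k t ≤ U k t := by
        have htop : go k t + halt k t ≠ ∞ :=
          (ENNReal.add_lt_top.2 ⟨(SubDist.apply_le_one _ _).trans_lt ENNReal.one_lt_top,
            (SubDist.apply_le_one _ _).trans_lt ENNReal.one_lt_top⟩).ne
        -- `U k t` is the mean of the price of halting and the price of proceeding; since halting is
        -- impossible or too dear, proceeding is not.
        obtain ⟨b, -, hb0, hb⟩ := exists_le_of_sum_mul_le (F := Finset.univ)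
          (a := fun b : Bool => if b then go k t else halt k t)
          (v := fun b : Bool => if b then V k t else r t) (w := U k t)
          (by simpa using hk) (by simpa using htop) (by simp [hUV k t, add_comm])
        cases b with
        | false => exact absurd ⟨by simpa using hb0, by simpa using hb⟩ hrt
        | true => exact ⟨by simpa using hb0, by simpa using hb⟩
      exact (hstepV k t hgo0.1).mono (hgo0.2.trans hw) fun _ _ => id
  refine ⟨go 0, halt 0, V 0, h0, hhalt 0, fun t ht => (hstepV 0 t ht).mono le_rfl hlow, ?_⟩
  have h1 : expect Θ r = ∑' k, expect (halt k) r := by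
    have : expect (fun t => ∑' k, halt k t) r = ∑' k, expect (halt k) r := by
      simpa using expect_tsum_left (fun _ => 1) (fun k => halt k) r
    rw [← this]
    congr 1
    exact funext hΘ
  rw [h1, tsum_eq_zero_add' ENNReal.summable]
  gcongr
  simp only [hV]
  rw [expect_iSup _ _ fun m n hmn => goValue_mono p x Ξ go halt r hmn 0]
  refine iSup_le fun n => ?_
  refine (expect_goValue_le p x Ξ go halt r hnext n 0).trans (le_of_eq ?_)
  refine tsum_congr fun i => ?_
  rw [show 0 + 1 + i = i + 1 by omega]

/-- The rewards after a hyper-derivation can be pulled back to bounds before it. -/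
theorem Hyper.pullback {Δ Θ : SubDist S} (h : T.Hyper Δ Θ) {r : S → ℝ≥0∞}
    (hr : ∀ t ∈ Θ.support, Q t (r t)) :
    ∃ U : S → ℝ≥0∞, (∀ t ∈ Δ.support, T.Low Q t (U t)) ∧ expect Δ U ≤ expect Θ r := by
  classical
  obtain ⟨go, halt, V, hΔ, hhalt, hgo, hle⟩ := h.split hr
  -- Of the options that the derivation uses at `t`, the cheaper one.
  refine ⟨fun t => if halt t ≠ 0 ∧ (go t = 0 ∨ r t ≤ V t) then r t else V t, ?_, ?_⟩
  · intro t ht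
    dsimp only
    split_ifs with hc
    · exact .halt (hr t fun h => hc.1 (le_antisymm (h ▸ hhalt t) zero_le))
    · refine .step (hgo t fun h0 => hc ⟨fun h1 => ht ?_, .inl h0⟩)
      simp [hΔ, h0, h1]
  · refine le_trans ?_ hle
    rw [show (Δ : S → ℝ≥0∞) = _ from funext hΔ, expect_add_left, add_comm]
    gcongr
    · refine expect_le_of_support fun t ht => ?_
      split_ifs with hc
      · rfl
      · push Not at hc
        exact (hc ht).2.le
    · refine expect_le_of_support fun t ht => ?_
      split_ifs with hc
      · exact hc.2.resolve_left ht
      · rfl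

/-- The reward is the indicator of success. An unsuccessful state in an extreme derivative has no
reduction, so `Final` lets the run stop there for 0. -/
theorem low_of_mem_results {q : ℝ≥0∞} (h : q ∈ T.results (SubDist.point s)) :
    T.Low T.Final s q := by
  classical
  obtain ⟨Δ', ⟨hhyp, hext⟩, rfl⟩ := h
  obtain ⟨U, hU, hle⟩ := hhyp.pullback (Q := T.Final)
    (r := fun t => if T.succ t then 1 else 0) (by
      intro t ht
      by_cases hs : T.succ t
      · exact .inl ⟨hs, by simp [hs]⟩
      · exact .inr ⟨hs, fun Ξ hΞ => hs (hext t ht ⟨Ξ, hΞ⟩)⟩)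
  have hs : s ∈ (SubDist.point s).support := by simp [SubDist.support, SubDist.point_apply_self]
  rw [expect_point] at hle
  refine (hU s hs).mono_right (hle.trans (le_of_eq ?_))
  refine tsum_congr fun t => ?_
  by_cases ht : T.succ t <;> simp [ht]

/-- A strategy that stops only at final states produces a derivative that is extreme, and the
indicator of success is below every price that `Final` allows. -/
theorem Low.exists_mem_results (hfin : ∀ s Δ, T.red s Δ → Δ.support.Finite)
    (h : T.Low T.Final s u) : ∃ p ∈ T.results (SubDist.point s), p ≤ u := by
  classical
  obtain ⟨Δ', hhyp, hQ, hr⟩ := h.exists_hyper hfin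
  refine ⟨T.value Δ', ⟨Δ', ⟨hhyp, ?_⟩, rfl⟩, ?_⟩
  · rintro t ht ⟨Ξ, hΞ⟩
    obtain ⟨w, ⟨h, -⟩ | ⟨-, h⟩⟩ := hQ t ht
    · exact h
    · exact absurd hΞ (h Ξ)
  · refine le_trans (le_of_eq ?_) (hr (fun t => if T.succ t then 1 else 0) ?_)
    · refine tsum_congr fun t => ?_
      by_cases ht : T.succ t <;> simp [ht]
    · rintro t w (⟨h, hw⟩ | ⟨h, -⟩)
      · simpa [h] using hw
      · simp [h]

end TestingStructure

/-! ### Equality cases of averages, traps and a maximum principle -/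

/-- The mean excess over a lower bound that the mean attains is 0, hence so is each excess on the
support. Finiteness of `d` is needed for the cancellation. -/
theorem eq_of_expect_le {α : Type*} {p : PMF α} {g : α → ℝ≥0∞} {d : ℝ≥0∞} (hd : d ≠ ∞)
    (hg : ∀ a ∈ p.support, d ≤ g a) (h : expect p g ≤ d) : ∀ a ∈ p.support, g a = d := by
  have h1 : d + expect p (fun a => g a - d) ≤ d := by
    refine le_trans ?_ h
    nth_rewrite 1 [← expect_pmf_const p d]
    rw [← expect_add_right]
    exact expect_le_of_support fun a ha => (add_tsub_cancel_of_le (hg a ha)).le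
  have h2 : expect p (fun a => g a - d) = 0 := by
    rw [← nonpos_iff_eq_zero]
    exact ENNReal.le_of_add_le_add_left hd (by simpa using h1)
  intro a ha
  have h3 := ENNReal.tsum_eq_zero.1 h2 a
  refine le_antisymm ?_ (hg a ha)
  exact tsub_eq_zero_iff_le.1 ((mul_eq_zero.1 h3).resolve_left ((PMF.mem_support_iff _ _).1 ha))

theorem eq_of_le_expect {α : Type*} {p : PMF α} {g : α → ℝ≥0∞} {d : ℝ≥0∞} (hd : d ≠ ∞)
    (hg : ∀ a ∈ p.support, g a ≤ d) (h : d ≤ expect p g) : ∀ a ∈ p.support, g a = d := by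
  have h1 : expect p g + expect p (fun a => d - g a) ≤ d := by
    rw [← expect_add_right]
    exact (expect_le_of_support fun a ha => (add_tsub_cancel_of_le (hg a ha)).le).trans
      (expect_pmf_const p d).le
  have h2 : expect p (fun a => d - g a) = 0 := by
    rw [← nonpos_iff_eq_zero]
    refine ENNReal.le_of_add_le_add_left hd ?_
    rw [add_zero]
    refine le_trans ?_ h1
    gcongr
  intro a ha
  have h3 := ENNReal.tsum_eq_zero.1 h2 a
  refine le_antisymm (hg a ha) ?_
  exact tsub_eq_zero_iff_le.1 ((mul_eq_zero.1 h3).resolve_left ((PMF.mem_support_iff _ _).1 ha))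

namespace TestingStructure

variable {S : Type u} {T : TestingStructure S}

/-- A set of unsuccessful states in which one can stay forever diverges. -/
theorem hyper_empty_of_trap (hfin : ∀ s Δ, T.red s Δ → Δ.support.Finite) {C : Set S} {s : S}
    (hs : s ∈ C) (hC : ∀ t ∈ C, ¬ T.succ t ∧ ∃ Δ, T.red t Δ ∧ Δ.support ⊆ C) :
    T.Hyper (SubDist.point s) SubDist.empty := by
  -- The strategy of staying in `C` is never permitted to stop, so the derivative that realises it
  -- has empty support.
  have h : T.Low (fun _ _ => False) s 0 := by
    refine ⟨fun t _ => t ∈ C, fun t w ht => .inr ?_, hs⟩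
    obtain ⟨h1, Δ, hΔ, h2⟩ := hC t ht
    exact ⟨h1, Δ, hΔ, fun _ => 0, fun y hy => h2 hy, by simp [expect]⟩
  obtain ⟨Δ', hhyp, hQ, -⟩ := h.exists_hyper hfin
  have : Δ' = SubDist.empty := by
    refine Subtype.ext (funext fun t => ?_)
    by_contra ht
    exact (hQ t ht).choose_spec
  exact this ▸ hhyp

end TestingStructure

/-- A maximum principle: on a finite set in which one cannot stay forever, a bounded function that
is everywhere below one of its averages vanishes. -/
theorem eq_zero_of_le_expect {S : Type*} {rel : S → PMF S → Prop} {A : Set S} (hA : A.Finite)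
    (htrap : ∀ C ⊆ A, C.Nonempty → ¬ ∀ t ∈ C, ∃ Δ, rel t Δ ∧ Δ.support ⊆ C) {g : S → ℝ≥0∞}
    (hfin : ∀ t, g t ≠ ∞)
    (hg : ∀ t ∈ A, g t ≠ 0 → ∃ Δ, rel t Δ ∧ Δ.support ⊆ A ∧ g t ≤ expect Δ g) :
    ∀ t ∈ A, g t = 0 := by
  intro t ht
  obtain ⟨m, hm, hmax⟩ := hA.exists_maximalFor g A ⟨t, ht⟩
  have hmax' : ∀ y ∈ A, g y ≤ g m := fun y hy =>
    (le_total (g y) (g m)).elim id (hmax hy)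
  by_contra h0
  have hm0 : g m ≠ 0 := fun h => h0 (le_antisymm (h ▸ hmax' t ht) zero_le)
  -- An average that reaches the maximum is concentrated on maximum points, so the maximum points
  -- form a trap.
  refine htrap {y ∈ A | g y = g m} (fun y hy => hy.1) ⟨m, hm, rfl⟩ ?_
  rintro y ⟨hy, hym⟩
  obtain ⟨Δ, hΔ, hsub, hle⟩ := hg y hy (hym ▸ hm0)
  refine ⟨Δ, hΔ, fun z hz => ⟨hsub hz, ?_⟩⟩
  exact eq_of_le_expect (hfin m) (fun a ha => hmax' a (hsub ha)) (hym ▸ hle) z hz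

/-! ## Facts about the semantics -/

variable {L : Sig.{u}} {D : Defs L}

theorem finite_support_interp : ∀ q : Proc L 0, (interp q).support.Finite
  | .ret s => by simp [interp]
  | .choice p hp q r => by
    simp only [interp, PMF.support_bind]
    refine (Set.toFinite _).biUnion fun b _ => ?_
    cases b
    · exact finite_support_interp r
    · exact finite_support_interp q

theorem STrans.finite_support {s : State L 0} {a : SAct L} {Δ : PMF (State L 0)}
    (h : STrans D s a Δ) : Δ.support.Finite := by
  induction h <;> first | exact finite_support_interp _ | assumption

theorem mem_support_nodeDist {Δ : PMF (State L 0)} {n : L.Node} {A : Sys L} :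
    A ∈ (nodeDist Δ n).support ↔ ∃ s ∈ Δ.support, A = .node s n := by
  simp only [nodeDist, PMF.support_map, Set.mem_image, eq_comm]

theorem mem_support_parDist {Δ Θ : PMF (Sys L)} {A : Sys L} :
    A ∈ (parDist Δ Θ).support ↔ ∃ B ∈ Δ.support, ∃ C ∈ Θ.support, A = .par B C := by
  simp only [parDist, PMF.support_bind, PMF.support_map, Set.mem_iUnion, Set.mem_image,
    exists_prop, eq_comm]

theorem parDist_pure (A B : Sys L) : parDist (PMF.pure A) (PMF.pure B) = PMF.pure (.par A B) := by
  simp [parDist, PMF.pure_map]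

theorem finite_support_nodeDist {Δ : PMF (State L 0)} (h : Δ.support.Finite) (n : L.Node) :
    (nodeDist Δ n).support.Finite := by
  rw [nodeDist, PMF.support_map]
  exact h.image _

theorem finite_support_parDist {Δ Θ : PMF (Sys L)} (h : Δ.support.Finite)
    (h' : Θ.support.Finite) : (parDist Δ Θ).support.Finite := by
  simp only [parDist, PMF.support_bind, PMF.support_map]
  exact h.biUnion fun A _ => h'.image _

theorem ITrans.finite_support {Γ : Graph L} {A : Sys L} {μ : IAct L} {Δ : PMF (Sys L)}
    (h : ITrans D Γ A μ Δ) : Δ.support.Finite := by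
  induction h with
  | broad h | tau h => exact finite_support_nodeDist h.finite_support _
  | hear h _ => exact finite_support_nodeDist h.finite_support _
  | deaf | disc | nil => simp
  | tauPropL _ ih => exact finite_support_parDist ih (by simp)
  | tauPropR _ ih => exact finite_support_parDist (by simp) ih
  | prop _ _ ih₁ ih₂ | syncL _ _ ih₁ ih₂ | syncR _ _ ih₁ ih₂ => exact finite_support_parDist ih₁ ih₂

theorem ITrans.nodeList_eq {Γ : Graph L} {A : Sys L} {μ : IAct L} {Δ : PMF (Sys L)}
    (h : ITrans D Γ A μ Δ) : ∀ B ∈ Δ.support, B.nodeList = A.nodeList := by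
  induction h with
  | broad h | tau h =>
    intro B hB
    obtain ⟨s, -, rfl⟩ := mem_support_nodeDist.1 hB
    rfl
  | hear h _ =>
    intro B hB
    obtain ⟨s, -, rfl⟩ := mem_support_nodeDist.1 hB
    rfl
  | deaf | disc | nil => simp
  | tauPropL _ ih =>
    intro B hB
    obtain ⟨B₁, hB₁, C₁, hC₁, rfl⟩ := mem_support_parDist.1 hB
    simp only [PMF.support_pure, Set.mem_singleton_iff] at hC₁
    simp [Sys.nodeList, ih B₁ hB₁, hC₁]
  | tauPropR _ ih =>
    intro B hB
    obtain ⟨B₁, hB₁, C₁, hC₁, rfl⟩ := mem_support_parDist.1 hB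
    simp only [PMF.support_pure, Set.mem_singleton_iff] at hB₁
    simp [Sys.nodeList, ih C₁ hC₁, hB₁]
  | prop _ _ ih₁ ih₂ | syncL _ _ ih₁ ih₂ | syncR _ _ ih₁ ih₂ =>
    intro B hB
    obtain ⟨B₁, hB₁, C₁, hC₁, rfl⟩ := mem_support_parDist.1 hB
    simp [Sys.nodeList, ih₁ B₁ hB₁, ih₂ C₁ hC₁]

/-- The node that acts. -/
def IAct.actor : IAct L → L.Node
  | .send n _ _ => n
  | .recv n _ _ => n
  | .tau n => n

/-- The rules consult the graph only for edges from the acting node to nodes of the term. This is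
what separates the two graphs in a composition. -/
theorem ITrans.congr_graph {Γ Γ' : Graph L} {A : Sys L} {μ : IAct L} {Δ : PMF (Sys L)}
    (h : ITrans D Γ A μ Δ) (hΓ : ∀ n ∈ A.nodes, Γ.E μ.actor n ↔ Γ'.E μ.actor n) :
    ITrans D Γ' A μ Δ := by
  have hL : ∀ {A B : Sys L} {m : L.Node}, (∀ n ∈ (Sys.par A B).nodes, Γ.E m n ↔ Γ'.E m n) →
      ∀ n ∈ A.nodes, Γ.E m n ↔ Γ'.E m n := fun h n hn => h n (List.mem_append_left _ hn)
  have hR : ∀ {A B : Sys L} {m : L.Node}, (∀ n ∈ (Sys.par A B).nodes, Γ.E m n ↔ Γ'.E m n) →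
      ∀ n ∈ B.nodes, Γ.E m n ↔ Γ'.E m n := fun h n hn => h n (List.mem_append_right _ hn)
  induction h with
  | broad h => exact .broad h
  | hear h he => exact .hear h ((hΓ _ (by simp [Sys.nodes, Sys.nodeList])).1 he)
  | deaf h => exact .deaf h
  | disc h => exact .disc fun he => h ((hΓ _ (by simp [Sys.nodes, Sys.nodeList])).2 he)
  | nil => exact .nil
  | tau h => exact .tau h
  | tauPropL _ ih => exact .tauPropL (ih (hL hΓ))
  | tauPropR _ ih => exact .tauPropR (ih (hR hΓ))
  | prop _ _ ih₁ ih₂ => exact .prop (ih₁ (hL hΓ)) (ih₂ (hR hΓ))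
  | syncL _ _ ih₁ ih₂ => exact .syncL (ih₁ (hL hΓ)) (ih₂ (hR hΓ))
  | syncR _ _ ih₁ ih₂ => exact .syncR (ih₁ (hL hΓ)) (ih₂ (hR hΓ))

theorem ITrans.actor_mem {Γ : Graph L} {A : Sys L} {μ : IAct L} {Δ : PMF (Sys L)}
    (h : ITrans D Γ A μ Δ) (hμ : ∀ n c v, μ ≠ .recv n c v) : μ.actor ∈ A.nodes := by
  induction h with
  | broad h | tau h => simp [Sys.nodes, Sys.nodeList, IAct.actor]
  | hear | deaf | disc | nil | prop => exact absurd rfl (hμ _ _ _)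
  | tauPropL _ ih | syncL _ _ ih _ => exact List.mem_append_left _ (ih (by simp))
  | tauPropR _ ih | syncR _ _ _ ih => exact List.mem_append_right _ (ih (by simp))

/-! ### Reception by a prescribed set of nodes -/

/-- `Receives D A H c v Φ`: the nodes of `A` in `H` that are able to receive `v` on `c` do so. -/
def Receives (D : Defs L) : Sys L → Set L.Node → L.Chan → L.Val → PMF (Sys L) → Prop
  | .nil, _, _, _, Φ => Φ = PMF.pure .nil
  | .node s n, H, c, v, Φ => (n ∈ H ∧ ∃ Δ, STrans D s (.recv c v) Δ ∧ Φ = nodeDist Δ n) ∨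
      ((n ∈ H → ∀ Δ, ¬ STrans D s (.recv c v) Δ) ∧ Φ = PMF.pure (.node s n))
  | .par A B, H, c, v, Φ => ∃ Φ₁ Φ₂, Receives D A H c v Φ₁ ∧ Receives D B H c v Φ₂ ∧
      Φ = parDist Φ₁ Φ₂

/-- The set of hearers is all that reception needs of the graph. Arbitrary sets of hearers are
allowed so that one message can be divided between several broadcasts. -/
theorem ITrans.receives {Γ : Graph L} {A : Sys L} {m : L.Node} {c : L.Chan} {v : L.Val}
    {Φ : PMF (Sys L)} (h : ITrans D Γ A (.recv m c v) Φ) : Receives D A {n | Γ.E m n} c v Φ := by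
  generalize hμ : IAct.recv m c v = μ at h
  induction h with
  | broad | tau | tauPropL | tauPropR | syncL | syncR => cases hμ
  | hear h he => cases hμ; exact .inl ⟨he, _, h, rfl⟩
  | deaf h => cases hμ; exact .inr ⟨fun _ => h, rfl⟩
  | disc h => cases hμ; exact .inr ⟨fun he => absurd he h, rfl⟩
  | nil => rfl
  | prop _ _ ih₁ ih₂ => exact ⟨_, _, ih₁ hμ, ih₂ hμ, rfl⟩

theorem Receives.iTrans {Γ : Graph L} {m : L.Node} {c : L.Chan} {v : L.Val} :
    ∀ {A : Sys L} {H : Set L.Node} {Φ : PMF (Sys L)}, Receives D A H c v Φ →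
      (∀ n ∈ A.nodes, n ∈ H ↔ Γ.E m n) → ITrans D Γ A (.recv m c v) Φ
  | .nil, H, Φ, h, _ => by cases h; exact .nil
  | .node s n, H, Φ, h, hH => by
    have hn := hH n (by simp [Sys.nodes, Sys.nodeList])
    rcases h with ⟨h1, Δ, h2, rfl⟩ | ⟨h1, rfl⟩
    · exact .hear h2 (hn.1 h1)
    · by_cases hnH : n ∈ H
      · exact .deaf (h1 hnH)
      · exact .disc fun h => hnH (hn.2 h)
  | .par A B, H, Φ, h, hH => by
    obtain ⟨Φ₁, Φ₂, h1, h2, rfl⟩ := h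
    exact .prop (h1.iTrans fun n hn => hH n (List.mem_append_left _ hn))
      (h2.iTrans fun n hn => hH n (List.mem_append_right _ hn))

theorem Receives.congr_set {c : L.Chan} {v : L.Val} :
    ∀ {A : Sys L} {H H' : Set L.Node} {Φ : PMF (Sys L)}, Receives D A H c v Φ →
      (∀ n ∈ A.nodes, n ∈ H ↔ n ∈ H') → Receives D A H' c v Φ
  | .nil, _, _, _, h, _ => h
  | .node s n, H, H', Φ, h, hH => by
    have hn := hH n (by simp [Sys.nodes, Sys.nodeList])
    rcases h with ⟨h1, h2⟩ | ⟨h1, h2⟩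
    · exact .inl ⟨hn.1 h1, h2⟩
    · exact .inr ⟨fun h => h1 (hn.2 h), h2⟩
  | .par A B, H, H', Φ, h, hH => by
    obtain ⟨Φ₁, Φ₂, h1, h2, rfl⟩ := h
    exact ⟨Φ₁, Φ₂, h1.congr_set fun n hn => hH n (List.mem_append_left _ hn),
      h2.congr_set fun n hn => hH n (List.mem_append_right _ hn), rfl⟩

theorem exists_receives (H : Set L.Node) (c : L.Chan) (v : L.Val) :
    ∀ A : Sys L, ∃ Φ, Receives D A H c v Φ
  | .nil => ⟨_, rfl⟩
  | .node s n => by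
    by_cases h : n ∈ H ∧ ∃ Δ, STrans D s (.recv c v) Δ
    · obtain ⟨h1, Δ, h2⟩ := h
      exact ⟨_, .inl ⟨h1, Δ, h2, rfl⟩⟩
    · exact ⟨_, .inr ⟨fun hn Δ hΔ => h ⟨hn, Δ, hΔ⟩, rfl⟩⟩
  | .par A B => by
    obtain ⟨Φ₁, h1⟩ := exists_receives H c v A
    obtain ⟨Φ₂, h2⟩ := exists_receives H c v B
    exact ⟨_, Φ₁, Φ₂, h1, h2, rfl⟩

theorem receives_of_disjoint {H : Set L.Node} {c : L.Chan} {v : L.Val} :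
    ∀ {A : Sys L} {Φ : PMF (Sys L)}, (∀ n ∈ A.nodes, n ∉ H) →
      (Receives D A H c v Φ ↔ Φ = PMF.pure A)
  | .nil, Φ, _ => Iff.rfl
  | .node s n, Φ, hH => by
    have hn := hH n (by simp [Sys.nodes, Sys.nodeList])
    simp [Receives, hn]
  | .par A B, Φ, hH => by
    have h1 := fun Φ => receives_of_disjoint (c := c) (v := v) (A := A) (Φ := Φ)
      fun n hn => hH n (List.mem_append_left _ hn)
    have h2 := fun Φ => receives_of_disjoint (c := c) (v := v) (A := B) (Φ := Φ)
      fun n hn => hH n (List.mem_append_right _ hn)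
    simp [Receives, h1, h2, parDist_pure]

/-! ### Success -/

/-- The success clause is enabled in a state. -/
inductive Enabled (D : Defs L) : State L 0 → Prop
  | test : Enabled D .test
  | sumL {s t : State L 0} : Enabled D s → Enabled D (.sum s t)
  | sumR {s t : State L 0} : Enabled D t → Enabled D (.sum s t)
  | thn {b : BExp L 0} {s t : State L 0} : b.eval = true → Enabled D s → Enabled D (.branch b s t)
  | els {b : BExp L 0} {s t : State L 0} : b.eval = false → Enabled D t → Enabled D (.branch b s t)
  | call {A : L.Def} {e : Fin (L.defArity A) → Exp L 0} :
      Enabled D ((D A).subst e) → Enabled D (.call A e)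

theorem enabled_sum {s t : State L 0} : Enabled D (.sum s t) ↔ Enabled D s ∨ Enabled D t :=
  ⟨fun h => by cases h with | sumL h => exact .inl h | sumR h => exact .inr h,
    fun h => h.elim .sumL .sumR⟩

theorem not_enabled_nil : ¬ Enabled D (.nil : State L 0) := fun h => by cases h

/-- Structural congruence is closed under symmetry and transitivity and cannot be inverted directly;
enabledness is an invariant that is computed from the syntax. -/
theorem SCong.enabled_iff {s t : State L 0} (h : SCong D s t) : Enabled D s ↔ Enabled D t := by
  induction h with
  | refl => rfl
  | symm _ ih => exact ih.symm
  | trans _ _ ih₁ ih₂ => exact ih₁.trans ih₂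
  | sumCongr _ _ ih₁ ih₂ => simp only [enabled_sum, ih₁, ih₂]
  | comm => simp only [enabled_sum, or_comm]
  | assoc => simp only [enabled_sum, or_assoc]
  | zero => simp only [enabled_sum, not_enabled_nil, or_false]
  | thn s t hb =>
    refine ⟨fun h => ?_, .thn hb⟩
    cases h with
    | thn _ h => exact h
    | els hb' _ => simp [hb] at hb'
  | els s t hb =>
    refine ⟨fun h => ?_, .els hb⟩
    cases h with
    | els _ h => exact h
    | thn hb' _ => simp [hb] at hb'
  | call A e => exact ⟨fun h => by cases h with | call h => exact h, .call⟩

theorem Enabled.exists_sCong {s : State L 0} (h : Enabled D s) :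
    ∃ t, SCong D s (.sum .test t) := by
  induction h with
  | test => exact ⟨.nil, .symm (.zero _)⟩
  | sumL _ ih =>
    obtain ⟨t, ht⟩ := ih
    exact ⟨_, .trans (.sumCongr ht (.refl _)) (.assoc _ _ _)⟩
  | sumR _ ih =>
    obtain ⟨t, ht⟩ := ih
    exact ⟨_, .trans (.comm _ _) (.trans (.sumCongr ht (.refl _)) (.assoc _ _ _))⟩
  | thn hb _ ih =>
    obtain ⟨t, ht⟩ := ih
    exact ⟨t, .trans (.thn _ _ hb) ht⟩
  | els hb _ ih =>
    obtain ⟨t, ht⟩ := ih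
    exact ⟨t, .trans (.els _ _ hb) ht⟩
  | call _ ih =>
    obtain ⟨t, ht⟩ := ih
    exact ⟨t, .trans (.call _ _) ht⟩

/-- The success clause is enabled at some node. -/
def Sys.Enabled (D : Defs L) : Sys L → Prop
  | .nil => False
  | .node s _ => WNet.Enabled D s
  | .par A B => A.Enabled D ∨ B.Enabled D

theorem Cong.enabled_iff {A B : Sys L} (h : Cong D A B) : A.Enabled D ↔ B.Enabled D := by
  induction h with
  | refl => rfl
  | symm _ ih => exact ih.symm
  | trans _ _ ih₁ ih₂ => exact ih₁.trans ih₂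
  | parCongr _ _ ih₁ ih₂ => simp only [Sys.Enabled, ih₁, ih₂]
  | comm => simp only [Sys.Enabled, or_comm]
  | assoc => simp only [Sys.Enabled, or_assoc]
  | zero => simp only [Sys.Enabled, or_false]
  | node n h => exact h.enabled_iff

theorem Sys.Enabled.exists_cong : ∀ {A : Sys L}, A.Enabled D →
    ∃ A' s n, Cong D A (.par A' (.node (.sum .test s) n))
  | .nil, h => h.elim
  | .node s n, h => by
    obtain ⟨t, ht⟩ := WNet.Enabled.exists_sCong h
    exact ⟨.nil, t, n, .trans (.node n ht) (.trans (.symm (.zero _)) (.comm _ _))⟩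
  | .par A B, .inl h => by
    obtain ⟨A', s, n, h⟩ := Sys.Enabled.exists_cong h
    exact ⟨.par B A', s, n, .trans (.comm _ _) (.trans (.parCongr (.refl _) h)
      (.symm (.assoc _ _ _)))⟩
  | .par A B, .inr h => by
    obtain ⟨A', s, n, h⟩ := Sys.Enabled.exists_cong h
    exact ⟨.par A A', s, n, .trans (.parCongr (.refl _) h) (.symm (.assoc _ _ _))⟩

theorem Sys.successful_iff {A : Sys L} : A.Successful D ↔ A.Enabled D :=
  ⟨fun ⟨_, _, _, h⟩ => h.enabled_iff.2 (.inr (.sumL .test)), fun h => h.exists_cong⟩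

theorem Sys.successful_par {A B : Sys L} :
    (Sys.par A B).Successful D ↔ A.Successful D ∨ B.Successful D := by
  simp only [Sys.successful_iff, Sys.Enabled]

/-! ### Proper terms -/

/-- Substitution changes data only, and for a call the success clause is sought in the body of the
definition, whatever the arguments are. -/
theorem UsesTest.of_subst {κ : Kind} {n m : ℕ} {σ : Fin n → Exp L m} {q : Code L κ n}
    (h : UsesTest D (q.subst σ)) : UsesTest D q := by
  induction q generalizing m with
  | ret s ih => cases h with | ret h => exact .ret (ih h)
  | choice p hp q r ih₁ ih₂ =>
    cases h with
    | choiceL h => exact .choiceL (ih₁ h)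
    | choiceR h => exact .choiceR (ih₂ h)
  | send c e q ih => cases h with | send h => exact .send (ih h)
  | recv c q ih => cases h with | recv h => exact .recv (ih h)
  | test => exact .test
  | sum s t ih₁ ih₂ =>
    cases h with
    | sumL h => exact .sumL (ih₁ h)
    | sumR h => exact .sumR (ih₂ h)
  | branch b s t ih₁ ih₂ =>
    cases h with
    | thn h => exact .thn (ih₁ h)
    | els h => exact .els (ih₂ h)
  | tau q ih => cases h with | tau h => exact .tau (ih h)
  | call A e => cases h with | call h => exact .call h
  | nil => cases h

theorem Enabled.usesTest {s : State L 0} (h : Enabled D s) : UsesTest D s := by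
  induction h with
  | test => exact .test
  | sumL _ ih => exact .sumL ih
  | sumR _ ih => exact .sumR ih
  | thn _ _ ih => exact .thn ih
  | els _ _ ih => exact .els ih
  | call _ ih => exact .call ih.of_subst

theorem usesTest_of_mem_interp : ∀ {q : Proc L 0} {s : State L 0}, s ∈ (interp q).support →
    UsesTest D s → UsesTest D q
  | .ret s, t, h, ht => by
    simp only [interp, PMF.support_pure, Set.mem_singleton_iff] at h
    exact .ret (h ▸ ht)
  | .choice p hp q r, t, h, ht => by
    simp only [interp, PMF.mem_support_bind_iff] at h
    obtain ⟨b, -, h⟩ := h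
    cases b
    · exact .choiceR (usesTest_of_mem_interp (by simpa using h) ht)
    · exact .choiceL (usesTest_of_mem_interp (by simpa using h) ht)

theorem STrans.usesTest {s : State L 0} {a : SAct L} {Δ : PMF (State L 0)} (h : STrans D s a Δ) :
    ∀ t ∈ Δ.support, UsesTest D t → UsesTest D s := by
  induction h with
  | snd => exact fun t ht h => .send (usesTest_of_mem_interp ht h)
  | rcv => exact fun t ht h => .recv (usesTest_of_mem_interp ht h).of_subst
  | tau => exact fun t ht h => .tau (usesTest_of_mem_interp ht h)
  | sumL _ ih => exact fun t ht h => .sumL (ih t ht h)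
  | sumR _ ih => exact fun t ht h => .sumR (ih t ht h)
  | thn _ _ ih => exact fun t ht h => .thn (ih t ht h)
  | els _ _ ih => exact fun t ht h => .els (ih t ht h)
  | call _ ih => exact fun t ht h => .call (ih t ht h).of_subst

theorem ITrans.proper {Γ : Graph L} {A : Sys L} {μ : IAct L} {Δ : PMF (Sys L)}
    (h : ITrans D Γ A μ Δ) (hA : A.Proper D) : ∀ B ∈ Δ.support, B.Proper D := by
  induction h with
  | broad h | tau h =>
    intro B hB
    obtain ⟨s, hs, rfl⟩ := mem_support_nodeDist.1 hB
    exact fun hu => hA (h.usesTest s hs hu)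
  | hear h _ =>
    intro B hB
    obtain ⟨s, hs, rfl⟩ := mem_support_nodeDist.1 hB
    exact fun hu => hA (h.usesTest s hs hu)
  | deaf | disc | nil => simpa using hA
  | tauPropL _ ih =>
    intro B hB
    obtain ⟨B₁, hB₁, C₁, hC₁, rfl⟩ := mem_support_parDist.1 hB
    simp only [PMF.support_pure, Set.mem_singleton_iff] at hC₁
    exact ⟨ih hA.1 B₁ hB₁, hC₁ ▸ hA.2⟩
  | tauPropR _ ih =>
    intro B hB
    obtain ⟨B₁, hB₁, C₁, hC₁, rfl⟩ := mem_support_parDist.1 hB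
    simp only [PMF.support_pure, Set.mem_singleton_iff] at hB₁
    exact ⟨hB₁ ▸ hA.1, ih hA.2 C₁ hC₁⟩
  | prop _ _ ih₁ ih₂ | syncL _ _ ih₁ ih₂ | syncR _ _ ih₁ ih₂ =>
    intro B hB
    obtain ⟨B₁, hB₁, C₁, hC₁, rfl⟩ := mem_support_parDist.1 hB
    exact ⟨ih₁ hA.1 B₁ hB₁, ih₂ hA.2 C₁ hC₁⟩

theorem Sys.Proper.not_successful : ∀ {A : Sys L}, A.Proper D → ¬ A.Successful D
  | .nil, _ => by simp [Sys.successful_iff, Sys.Enabled]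
  | .node s n, h => fun hs => h (WNet.Enabled.usesTest (Sys.successful_iff.1 hs))
  | .par A B, h => by
    rw [Sys.successful_par, not_or]
    exact ⟨h.1.not_successful, h.2.not_successful⟩

/-! ## More on lifted relations -/

theorem tsum_sum_mul {ι α : Type*} [Fintype ι] (p : ι → ℝ≥0∞) (f : ι → α → ℝ≥0∞) :
    ∑' a, ∑ i, p i * f i a = ∑ i, p i * ∑' a, f i a := by
  rw [Summable.tsum_finsetSum fun _ _ => ENNReal.summable]
  simp only [ENNReal.tsum_mul_left]

/-- Ensures that the intermediate sub-distribution of a weak output with a full target is itself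
full. -/
theorem Lift.mass_le {S T : Type u} {R : S → SubDist T → Prop} {Δ : SubDist S} {Θ : SubDist T}
    (h : Lift R Δ Θ) : ∑' t, Θ t ≤ ∑' s, Δ s := by
  obtain ⟨ι, _, p, x, Ξ, -, -, -, hΔ, hΘ⟩ := h.normalForm
  simp only [hΔ, hΘ, tsum_sum_mul]
  refine Finset.sum_le_sum fun i _ => ?_
  gcongr
  exact (Ξ i).2.trans (PMF.tsum_coe (PMF.pure (x i))).ge

/-- The instances that make up a lifted relation stay in the support of the second component, and
they are full if the second component is full. -/
theorem Lift.restrict {S T : Type u} {R : S → SubDist T → Prop} {Δ : SubDist S} {Θ : SubDist T}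
    (h : Lift R Δ Θ) :
    Lift (fun s Ξ => R s Ξ ∧ Ξ.support ⊆ Θ.support ∧ (1 ≤ ∑' t, Θ t → 1 ≤ ∑' t, Ξ t)) Δ Θ := by
  obtain ⟨ι, _, p, x, Ξ, hp, hp1, hR, hΔ, hΘ⟩ := h.normalForm
  refine Lift.of_finset Finset.univ p x Ξ hp1 (fun i _ => ⟨hR i, ?_, fun hfull => ?_⟩) hΔ hΘ
  · intro t ht
    rw [SubDist.support, Set.mem_ofPred_eq, hΘ]
    intro h0
    exact mul_ne_zero (hp i) ht ((Finset.sum_eq_zero_iff.1 h0) i (Finset.mem_univ i))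
  · simp only [hΘ, tsum_sum_mul] at hfull
    -- The weights sum to at most 1, so a full total leaves no room for a deficit in any instance of
    -- positive weight.
    have h1 : ∑ i, p i * ∑' t, Ξ i t + ∑ i, p i * (1 - ∑' t, Ξ i t) ≤
        ∑ i, p i * ∑' t, Ξ i t := by
      refine le_trans ?_ hfull
      rw [← Finset.sum_add_distrib]
      refine le_trans (Finset.sum_le_sum fun i _ => ?_) hp1
      rw [← mul_add, add_tsub_cancel_of_le (Ξ i).2, mul_one]
    have hfin : ∑ i, p i * ∑' t, Ξ i t ≠ ∞ := by
      refine ne_top_of_le_ne_top ENNReal.one_ne_top (le_trans (Finset.sum_le_sum fun i _ => ?_) hp1)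
      exact mul_le_of_le_one_right' (Ξ i).2
    have h2 : ∑ i, p i * (1 - ∑' t, Ξ i t) = 0 := by
      rw [← nonpos_iff_eq_zero]
      exact ENNReal.le_of_add_le_add_left hfin (by simpa using h1)
    have h3 := (Finset.sum_eq_zero_iff.1 h2) i (Finset.mem_univ i)
    exact tsub_eq_zero_iff_le.1 ((mul_eq_zero.1 h3).resolve_left (hp i))

/-- Rewards before a lifted relation between states can be pushed forward: the new reward of `y` is
the mean of the rewards of the states that are coupled with `y`. -/
theorem Lift.pushforward {S : Type u} {R : S → S → Prop} {Δ Θ : PMF S}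
    (h : Lift (ptRel R) (SubDist.ofPMF Δ) (SubDist.ofPMF Θ)) (g : S → ℝ≥0∞) :
    (∀ x ∈ Δ.support, ∃ y ∈ Θ.support, R x y) ∧
    ∃ r : S → ℝ≥0∞, (∀ y ∈ Θ.support, ∃ x ∈ Δ.support, R x y ∧ g x ≤ r y) ∧
      expect Θ r ≤ expect Δ g ∧
      ∀ y d, Θ y * d ≤ Θ y * r y + expect Δ (fun x => Set.indicator {x | R x y} (d - g ·) x) := by
  classical
  obtain ⟨ι, _, p, x, Ξ, hp, hp1, hR, hΔ, hΘ⟩ := h.normalForm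
  choose y hΞ hR using hR
  have hΔ' : ∀ s, Δ s = ∑ i, if x i = s then p i else 0 := fun s => by
    refine (hΔ s).trans (Finset.sum_congr rfl fun i _ => ?_)
    split_ifs with hi
    · rw [hi, SubDist.point_apply_self, mul_one]
    · rw [SubDist.point_apply_of_ne (Ne.symm hi), mul_zero]
  have hΘ' : ∀ s, Θ s = ∑ i, if y i = s then p i else 0 := fun s => by
    refine (hΘ s).trans (Finset.sum_congr rfl fun i _ => ?_)
    rw [hΞ]
    split_ifs with hi
    · rw [hi, SubDist.point_apply_self, mul_one]
    · rw [SubDist.point_apply_of_ne (Ne.symm hi), mul_zero]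
  have hΔexp : ∀ f : S → ℝ≥0∞, expect Δ f = ∑ i, p i * f (x i) := fun f => by
    rw [show (Δ : S → ℝ≥0∞) = _ from funext hΔ, expect_sum_left]
    simp only [expect_point]
  have hmemΔ : ∀ i, x i ∈ Δ.support := fun i => by
    rw [PMF.mem_support_iff, hΔ']
    intro h0
    exact hp i (by simpa using (Finset.sum_eq_zero_iff.1 h0) i (Finset.mem_univ i))
  have hmemΘ : ∀ i, y i ∈ Θ.support := fun i => by
    rw [PMF.mem_support_iff, hΘ']
    intro h0
    exact hp i (by simpa using (Finset.sum_eq_zero_iff.1 h0) i (Finset.mem_univ i))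
  set r : S → ℝ≥0∞ := fun z => (∑ i, if y i = z then p i * g (x i) else 0) / Θ z with hr
  have hmul : ∀ z, Θ z * r z = ∑ i, if y i = z then p i * g (x i) else 0 := fun z => by
    by_cases hz : Θ z = 0
    · rw [hz, zero_mul, eq_comm]
      refine Finset.sum_eq_zero fun i _ => if_neg ?_
      rintro rfl
      exact (PMF.mem_support_iff _ _).1 (hmemΘ i) hz
    · exact ENNReal.mul_div_cancel hz (Θ.apply_ne_top z)
  refine ⟨fun s hs => ?_, r, fun z hz => ?_, ?_, fun z d => ?_⟩
  · rw [PMF.mem_support_iff, hΔ'] at hs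
    obtain ⟨i, -, hi⟩ := Finset.exists_ne_zero_of_sum_ne_zero hs
    have hi : x i = s := by by_contra h; simp [h] at hi
    exact ⟨y i, hmemΘ i, hi ▸ hR i⟩
  · have hz0 := (PMF.mem_support_iff _ _).1 hz
    obtain ⟨i, hi, -, hle⟩ := exists_le_of_sum_mul_le (F := Finset.univ.filter (fun i => y i = z))
      (a := p) (v := fun i => g (x i)) (w := r z)
      (by rwa [Finset.sum_filter, ← hΘ']) (by rw [Finset.sum_filter, ← hΘ']; exact Θ.apply_ne_top z)
      (by rw [Finset.sum_filter, Finset.sum_filter, ← hΘ', hmul])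
    have hi : y i = z := by simpa using hi
    exact ⟨x i, hmemΔ i, hi ▸ hR i, hle⟩
  · rw [hΔexp, expect]
    simp only [hmul]
    rw [Summable.tsum_finsetSum fun _ _ => ENNReal.summable]
    refine Finset.sum_le_sum fun i _ => ?_
    exact ((tsum_eq_single (y i) fun t ht => if_neg (Ne.symm ht)).trans (if_pos rfl)).le
  -- Each instance coupled with `z` has `d ≤ g (x i) + (d - g (x i))` with truncated subtraction,
  -- and `x i` is then related to `z`.
  · rw [hmul, hΔexp, hΘ', Finset.sum_mul, ← Finset.sum_add_distrib]
    refine Finset.sum_le_sum fun i _ => ?_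
    split_ifs with hi
    · rw [Set.indicator_of_mem (show x i ∈ {x | R x z} from hi ▸ hR i), ← mul_add]
      gcongr
      exact le_add_tsub
    · simp

/-! ## Receiving in two rounds -/

theorem parDist_bind (Φ₁ Φ₂ : PMF (Sys L)) (K₁ K₂ K : Sys L → PMF (Sys L))
    (hK : ∀ A B, K (.par A B) = parDist (K₁ A) (K₂ B)) :
    parDist (Φ₁.bind K₁) (Φ₂.bind K₂) = (parDist Φ₁ Φ₂).bind K := by
  simp only [parDist, PMF.bind_bind, ← PMF.bind_pure_comp, Function.comp_def, hK,
    PMF.pure_bind]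
  refine congrArg _ (funext fun A => ?_)
  rw [PMF.bind_comm]

/-- A message to a union of disjoint sets of nodes can be received in two rounds. A success in the
first round persists in the second round. -/
theorem Receives.split {H₁ H₂ : Set L.Node} (hd : Disjoint H₁ H₂) {c : L.Chan} {v : L.Val} :
    ∀ {A : Sys L} {Φ : PMF (Sys L)}, Receives D A (H₁ ∪ H₂) c v Φ →
      ∃ Φ₁ K, Receives D A H₁ c v Φ₁ ∧ (∀ B ∈ Φ₁.support, Receives D B H₂ c v (K B)) ∧
        Φ = Φ₁.bind K ∧ (¬ A.Successful D → ∀ B ∈ Φ₁.support, B.Successful D →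
          ∀ C ∈ (K B).support, C.Successful D)
  | .nil, Φ, h => by
    cases h
    exact ⟨PMF.pure .nil, PMF.pure, rfl, by simp [Receives], by simp, by simp⟩
  | .node s n, Φ, h => by
    rcases h with ⟨hn | hn, Δ, hs, rfl⟩ | ⟨hn, rfl⟩
    · refine ⟨nodeDist Δ n, PMF.pure, .inl ⟨hn, Δ, hs, rfl⟩, ?_, by simp, by simp⟩
      intro B hB
      obtain ⟨t, -, rfl⟩ := mem_support_nodeDist.1 hB
      exact .inr ⟨fun h => absurd h (Set.disjoint_left.1 hd hn), rfl⟩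
    -- A node of `H₂` waits unchanged in the first round, so it cannot have become successful there.
    · refine ⟨PMF.pure (.node s n), fun _ => nodeDist Δ n,
        .inr ⟨fun h => absurd hn (Set.disjoint_left.1 hd h), rfl⟩, ?_, by simp, ?_⟩
      · simp only [PMF.support_pure, Set.mem_singleton_iff, forall_eq]
        exact .inl ⟨hn, Δ, hs, rfl⟩
      · intro hA B hB hB'
        simp only [PMF.support_pure, Set.mem_singleton_iff] at hB
        exact absurd (hB ▸ hB') hA
    · refine ⟨PMF.pure (.node s n), PMF.pure, .inr ⟨fun h => hn (.inl h), rfl⟩, ?_, by simp,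
        by simp⟩
      simp only [PMF.support_pure, Set.mem_singleton_iff, forall_eq]
      exact .inr ⟨fun h => hn (.inr h), rfl⟩
  | .par A B, Φ, h => by
    obtain ⟨Φa, Φb, ha, hb, rfl⟩ := h
    obtain ⟨Φ₁, K₁, h₁, hK₁, rfl, hs₁⟩ := ha.split hd
    obtain ⟨Φ₂, K₂, h₂, hK₂, rfl, hs₂⟩ := hb.split hd
    -- The second round depends on the random outcome of the first, componentwise; the default
    -- branch is never reached.
    refine ⟨parDist Φ₁ Φ₂, fun C => match C with
      | .par A B => parDist (K₁ A) (K₂ B)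
      | C => PMF.pure C, ⟨Φ₁, Φ₂, h₁, h₂, rfl⟩, ?_, parDist_bind _ _ _ _ _ fun _ _ => rfl, ?_⟩
    · intro C hC
      obtain ⟨A', hA', B', hB', rfl⟩ := mem_support_parDist.1 hC
      exact ⟨_, _, hK₁ A' hA', hK₂ B' hB', rfl⟩
    · intro hAB C hC hCs E hE
      obtain ⟨A', hA', B', hB', rfl⟩ := mem_support_parDist.1 hC
      obtain ⟨A'', hA'', B'', hB'', rfl⟩ := mem_support_parDist.1 hE
      rw [Sys.successful_par, not_or] at hAB
      rw [Sys.successful_par] at hCs ⊢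
      exact hCs.imp (fun h => hs₁ hAB.1 A' hA' h A'' hA'') (fun h => hs₂ hAB.2 B' hB' h B'' hB'')

theorem Receives.nodeList_eq {H : Set L.Node} {c : L.Chan} {v : L.Val} :
    ∀ {A : Sys L} {Φ : PMF (Sys L)}, Receives D A H c v Φ →
      ∀ B ∈ Φ.support, B.nodeList = A.nodeList
  | .nil, Φ, h => by cases h; simp
  | .node s n, Φ, h => by
    rcases h with ⟨-, Δ, -, rfl⟩ | ⟨-, rfl⟩
    · intro B hB
      obtain ⟨t, -, rfl⟩ := mem_support_nodeDist.1 hB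
      rfl
    · simp
  | .par A B, Φ, h => by
    obtain ⟨Φ₁, Φ₂, h₁, h₂, rfl⟩ := h
    intro C hC
    obtain ⟨A', hA', B', hB', rfl⟩ := mem_support_parDist.1 hC
    simp [Sys.nodeList, h₁.nodeList_eq A' hA', h₂.nodeList_eq B' hB']

/-! ## Composed networks -/

/-- The product of a distribution of networks and a distribution of system terms that run on the
nodes of `Γ'`. -/
def compDist (Γ' : Graph L) (Δ : PMF (Network L)) (Φ : PMF (Sys L)) : PMF (Network L) :=
  Δ.bind fun K => Φ.map fun B => K.comp ⟨Γ', B⟩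

theorem expect_compDist (Γ' : Graph L) (Δ : PMF (Network L)) (Φ : PMF (Sys L))
    (g : Network L → ℝ≥0∞) :
    expect (compDist Γ' Δ Φ) g = expect Δ (fun K => expect Φ (fun B => g (K.comp ⟨Γ', B⟩))) := by
  simp only [compDist, expect_bind, expect_map]

theorem mem_support_compDist {Γ' : Graph L} {Δ : PMF (Network L)} {Φ : PMF (Sys L)}
    {K : Network L} :
    K ∈ (compDist Γ' Δ Φ).support ↔ ∃ K' ∈ Δ.support, ∃ B ∈ Φ.support, K = K'.comp ⟨Γ', B⟩ := by
  simp only [compDist, PMF.support_bind, PMF.support_map, Set.mem_iUnion, Set.mem_image,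
    exists_prop, eq_comm]

theorem netDist_parDist (Γ Γ' : Graph L) (Δ Φ : PMF (Sys L)) :
    netDist (Γ.union Γ') (parDist Δ Φ) = compDist Γ' (netDist Γ Δ) Φ := by
  simp only [netDist, parDist, compDist, PMF.map_bind, PMF.bind_map, PMF.map_comp,
    Function.comp_def]
  rfl

theorem netDist_pure (Γ : Graph L) (A : Sys L) : netDist Γ (PMF.pure A) = PMF.pure ⟨Γ, A⟩ :=
  PMF.pure_map _ _

theorem mem_support_netDist {Γ : Graph L} {Δ : PMF (Sys L)} {K : Network L} :
    K ∈ (netDist Γ Δ).support ↔ ∃ A ∈ Δ.support, K = ⟨Γ, A⟩ := by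
  simp only [netDist, PMF.support_map, Set.mem_image, eq_comm]

theorem finite_support_netDist {Γ : Graph L} {Δ : PMF (Sys L)} (h : Δ.support.Finite) :
    (netDist Γ Δ).support.Finite := by
  rw [netDist, PMF.support_map]
  exact h.image _

theorem Red.finite_support {K : Network L} {Δ : PMF (Network L)} (h : Red D K Δ) :
    Δ.support.Finite := by
  cases h with
  | tau h | send h => exact finite_support_netDist h.finite_support

theorem ETrans.finite_support {K : Network L} {a : EAct L} {Δ : PMF (Network L)}
    (h : ETrans D K a Δ) : Δ.support.Finite := by
  cases h with
  | tau _ h => exact finite_support_netDist h.finite_support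
  | broad _ h => exact finite_support_netDist h.finite_support
  | input _ h => exact finite_support_netDist h.finite_support
  | output _ h => exact finite_support_netDist h.finite_support

/-! ### Invariants of reachable networks and compatibility with a test -/

/-- The network `K` runs on the graph `Γ`, with the internal nodes `X`. -/
structure On (Γ : Graph L) (X : Set L.Node) (K : Network L) : Prop where
  graph : K.graph = Γ
  nodes : K.sys.nodes = X

theorem Sys.nodes_eq_of_nodeList_eq {A B : Sys L} (h : A.nodeList = B.nodeList) :
    A.nodes = B.nodes := by
  simp [Sys.nodes, h]

theorem ETrans.on {Γ : Graph L} {X : Set L.Node} {K : Network L} {a : EAct L}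
    {Δ : PMF (Network L)} (h : ETrans D K a Δ) (hK : On Γ X K) : ∀ K' ∈ Δ.support, On Γ X K' := by
  have key : ∀ {μ : IAct L} {Δ : PMF (Sys L)}, ITrans D K.graph K.sys μ Δ →
      ∀ K' ∈ (netDist K.graph Δ).support, On Γ X K' := by
    intro μ Δ h K' hK'
    obtain ⟨A, hA, rfl⟩ := mem_support_netDist.1 hK'
    exact ⟨hK.graph, (Sys.nodes_eq_of_nodeList_eq (h.nodeList_eq A hA)).trans hK.nodes⟩
  cases h with
  | tau _ h => exact key h
  | broad _ h => exact key h
  | input _ h => exact key h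
  | output _ h => exact key h

theorem ETrans.proper {K : Network L} {a : EAct L} {Δ : PMF (Network L)} (h : ETrans D K a Δ)
    (hK : K.Proper D) : ∀ K' ∈ Δ.support, K'.Proper D := by
  have key : ∀ {μ : IAct L} {Δ : PMF (Sys L)}, ITrans D K.graph K.sys μ Δ →
      ∀ K' ∈ (netDist K.graph Δ).support, K'.Proper D := by
    intro μ Δ h K' hK'
    obtain ⟨A, hA, rfl⟩ := mem_support_netDist.1 hK'
    exact h.proper hK A hA
  cases h with
  | tau _ h => exact key h
  | broad _ h => exact key h
  | input _ h => exact key h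
  | output _ h => exact key h

theorem ETrans.not_successful {K : Network L} {a : EAct L} {Δ : PMF (Network L)}
    (h : ETrans D K a Δ) : ¬ K.Successful D := by
  cases h <;> assumption

/-- Networks on `Γ` with the internal nodes `X` can be composed with system terms that run on the
nodes `Y` of `Γ'`. -/
structure Compat (Γ Γ' : Graph L) (X Y : Set L.Node) : Prop where
  conn : ∀ m n, Γ.E m n → m ∈ X ∨ n ∈ X
  disj : ∀ n ∈ X, n ∉ Γ'.V
  sub : Y ⊆ Γ'.V

namespace Compat

variable {Γ Γ' : Graph L} {X Y : Set L.Node}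

/-- Nodes of `X` are no vertices of `Γ'`, so the test contributes no edge at them. -/
theorem edge_to (h : Compat Γ Γ' X Y) {m n : L.Node} (hn : n ∈ X) : (Γ.union Γ').E m n ↔ Γ.E m n :=
  ⟨fun he => he.resolve_right fun he => h.disj n hn (Γ'.mem _ _ he).2, .inl⟩

theorem edge_from (h : Compat Γ Γ' X Y) {m n : L.Node} (hm : m ∈ X) : (Γ.union Γ').E m n ↔ Γ.E m n :=
  ⟨fun he => he.resolve_right fun he => h.disj m hm (Γ'.mem _ _ he).1, .inl⟩

/-- An edge of `Γ` has an endpoint in `X`, while test nodes lie outside `X`. -/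
theorem edge_test (h : Compat Γ Γ' X Y) {m n : L.Node} (hm : m ∈ Y) (hn : n ∈ Y) :
    (Γ.union Γ').E m n ↔ Γ'.E m n :=
  ⟨fun he => he.resolve_left fun he => (h.conn _ _ he).elim (fun hX => h.disj m hX (h.sub hm))
    fun hX => h.disj n hX (h.sub hn), .inr⟩

theorem notMem (h : Compat Γ Γ' X Y) {n : L.Node} (hn : n ∈ Y) : n ∉ X := fun hX => h.disj n hX (h.sub hn)

end Compat

/-! ### Reductions of a composition and extensional actions of its component -/

section Reductions

variable {Γ Γ' : Graph L} {X Y : Set L.Node} {K : Network L} {B : Sys L}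

/-- The reductions of a composed network. -/
theorem Red.comp_cases (hc : Compat Γ Γ' X Y) (hK : On Γ X K) (hB : B.nodes = Y)
    {Ξ : PMF (Network L)} (h : Red D (K.comp ⟨Γ', B⟩) Ξ) :
    (∃ n Δ, ITrans D Γ K.sys (.tau n) Δ ∧ Ξ = compDist Γ' (netDist Γ Δ) (PMF.pure B)) ∨
    (∃ m c v Δ Φ, ITrans D Γ K.sys (.send m c v) Δ ∧ Receives D B {n | Γ.E m n} c v Φ ∧
      Ξ = compDist Γ' (netDist Γ Δ) Φ) ∨
    (∃ n Φ, ITrans D Γ' B (.tau n) Φ ∧ Ξ = compDist Γ' (PMF.pure K) Φ) ∨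
    (∃ m c v Δ Φ, ITrans D Γ K.sys (.recv m c v) Δ ∧ ITrans D Γ' B (.send m c v) Φ ∧
      Ξ = compDist Γ' (netDist Γ Δ) Φ) := by
  obtain ⟨Γ₀, A⟩ := K
  obtain ⟨rfl, rfl⟩ := hK
  subst hB
  simp only [Network.comp] at h
  have hA : ∀ {μ Δ}, ITrans D (Γ₀.union Γ') A μ Δ → ITrans D Γ₀ A μ Δ := fun h =>
    h.congr_graph fun n hn => hc.edge_to hn
  cases h with
  | tau h =>
    cases h with
    | tauPropL h => exact .inl ⟨_, _, hA h, netDist_parDist _ _ _ _⟩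
    | tauPropR h =>
      refine .inr (.inr (.inl ⟨_, _, h.congr_graph fun n hn => hc.edge_test ?_ hn, ?_⟩))
      · exact h.actor_mem (by simp)
      · rw [← netDist_pure]
        exact netDist_parDist _ _ _ _
  | send h =>
    cases h with
    | syncL h1 h2 =>
      refine .inr (.inl ⟨_, _, _, _, _, hA h1, h2.receives.congr_set fun n hn => ?_,
        netDist_parDist _ _ _ _⟩)
      exact hc.edge_from (h1.actor_mem (by simp))
    | syncR h1 h2 =>
      refine .inr (.inr (.inr ⟨_, _, _, _, _, hA h1, h2.congr_graph fun n hn =>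
        hc.edge_test ?_ hn, netDist_parDist _ _ _ _⟩))
      exact h2.actor_mem (by simp)

theorem ITrans.red_comp_tau (hc : Compat Γ Γ' X Y) (hK : On Γ X K) {n : L.Node}
    {Δ : PMF (Sys L)} (h : ITrans D Γ K.sys (.tau n) Δ) :
    Red D (K.comp ⟨Γ', B⟩) (compDist Γ' (netDist Γ Δ) (PMF.pure B)) := by
  obtain ⟨Γ₀, A⟩ := K
  obtain ⟨rfl, rfl⟩ := hK
  rw [← netDist_parDist]
  exact .tau (.tauPropL (h.congr_graph fun n hn => (hc.edge_to hn).symm))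

theorem ITrans.red_comp_send (hc : Compat Γ Γ' X Y) (hK : On Γ X K)
    {m : L.Node} {c : L.Chan} {v : L.Val} {Δ Φ : PMF (Sys L)}
    (h : ITrans D Γ K.sys (.send m c v) Δ) (hΦ : Receives D B {n | Γ.E m n} c v Φ) :
    Red D (K.comp ⟨Γ', B⟩) (compDist Γ' (netDist Γ Δ) Φ) := by
  obtain ⟨Γ₀, A⟩ := K
  obtain ⟨rfl, rfl⟩ := hK
  rw [← netDist_parDist]
  exact .send (.syncL (h.congr_graph fun n hn => (hc.edge_to hn).symm)
    (hΦ.iTrans fun n _ => (hc.edge_from (h.actor_mem (by simp))).symm))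

theorem ITrans.red_comp_test_tau (hc : Compat Γ Γ' X Y) (hK : On Γ X K) (hB : B.nodes = Y)
    {n : L.Node} {Φ : PMF (Sys L)} (h : ITrans D Γ' B (.tau n) Φ) :
    Red D (K.comp ⟨Γ', B⟩) (compDist Γ' (PMF.pure K) Φ) := by
  obtain ⟨Γ₀, A⟩ := K
  obtain ⟨rfl, rfl⟩ := hK
  subst hB
  rw [← netDist_pure, ← netDist_parDist]
  exact .tau (.tauPropR (h.congr_graph fun n hn => (hc.edge_test (h.actor_mem (by simp)) hn).symm))

theorem ITrans.red_comp_test_send (hc : Compat Γ Γ' X Y) (hK : On Γ X K) (hB : B.nodes = Y)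
    {m : L.Node} {c : L.Chan} {v : L.Val} {Δ Φ : PMF (Sys L)}
    (hΔ : ITrans D Γ K.sys (.recv m c v) Δ) (h : ITrans D Γ' B (.send m c v) Φ) :
    Red D (K.comp ⟨Γ', B⟩) (compDist Γ' (netDist Γ Δ) Φ) := by
  obtain ⟨Γ₀, A⟩ := K
  obtain ⟨rfl, rfl⟩ := hK
  subst hB
  rw [← netDist_parDist]
  exact .send (.syncR (hΔ.congr_graph fun n hn => (hc.edge_to hn).symm)
    (h.congr_graph fun n hn => (hc.edge_test (h.actor_mem (by simp)) hn).symm))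

/-- What a system term on the nodes of a test observes of a broadcast: nothing if the broadcast is
an extensional `τ`, and otherwise the set of targets. -/
theorem ITrans.eTrans_of_send (hc : Compat Γ Γ' X Y) (hK : On Γ X K) (hB : B.nodes = Y)
    (hs : ¬ K.Successful D) {m : L.Node} {c : L.Chan} {v : L.Val} {Δ Φ : PMF (Sys L)}
    (h : ITrans D Γ K.sys (.send m c v) Δ) (hΦ : Receives D B {n | Γ.E m n} c v Φ) :
    (ETrans D K .tau (netDist Γ Δ) ∧ Φ = PMF.pure B) ∨
      ∃ η, ETrans D K (.output c v η) (netDist Γ Δ) ∧ Receives D B η c v Φ := by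
  obtain ⟨Γ₀, A⟩ := K
  obtain ⟨rfl, rfl⟩ := hK
  subst hB
  by_cases hm : ∀ n, Γ₀.E m n → n ∈ A.nodes
  · refine .inl ⟨ETrans.broad hs h hm, ?_⟩
    exact (receives_of_disjoint fun n hn he => hc.notMem hn (hm n he)).1 hΦ
  · push Not at hm
    obtain ⟨n, he, hn⟩ := hm
    have key : ∀ n, Γ₀.E m n → n ∉ A.nodes → n ∈ (⟨Γ₀, A⟩ : Network L).outp := fun n he hn =>
      ⟨⟨(Γ₀.mem _ _ he).2, hn⟩, m, he⟩
    refine .inr ⟨_, ETrans.output hs h rfl ⟨n, key n he hn, he⟩, hΦ.congr_set fun n hn =>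
      ⟨fun he => ⟨key n he (hc.notMem hn), he⟩, fun h => h.2⟩⟩

theorem ETrans.red_comp_tau (hc : Compat Γ Γ' X Y) (hK : On Γ X K) (hB : B.nodes = Y)
    {Δ : PMF (Network L)} (h : ETrans D K .tau Δ) :
    Red D (K.comp ⟨Γ', B⟩) (compDist Γ' Δ (PMF.pure B)) := by
  obtain ⟨Γ₀, A⟩ := K
  obtain ⟨rfl, rfl⟩ := hK
  subst hB
  cases h with
  | tau _ h => exact h.red_comp_tau hc ⟨rfl, rfl⟩
  | broad _ h hm =>
    exact h.red_comp_send hc ⟨rfl, rfl⟩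
      ((receives_of_disjoint fun n hn he => hc.notMem hn (hm n he)).2 rfl)

/-- Test nodes are external to `K`, so those that hear the broadcast are exactly those in `η`. -/
theorem ETrans.red_comp_output (hc : Compat Γ Γ' X Y) (hK : On Γ X K) (hB : B.nodes = Y)
    {c : L.Chan} {v : L.Val} {η : Set L.Node} {Δ : PMF (Network L)} {Φ : PMF (Sys L)}
    (h : ETrans D K (.output c v η) Δ) (hΦ : Receives D B η c v Φ) :
    Red D (K.comp ⟨Γ', B⟩) (compDist Γ' Δ Φ) := by
  obtain ⟨Γ₀, A⟩ := K
  obtain ⟨rfl, rfl⟩ := hK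
  subst hB
  cases h with
  | output _ h hη _ =>
    refine h.red_comp_send hc ⟨rfl, rfl⟩ (hΦ.congr_set fun n hn => ?_)
    rw [hη]
    exact ⟨fun h => h.2, fun he => ⟨⟨⟨(Γ₀.mem _ _ he).2, hc.notMem hn⟩, _, he⟩, he⟩⟩

theorem ETrans.red_comp_input (hc : Compat Γ Γ' X Y) (hK : On Γ X K) (hB : B.nodes = Y)
    {m : L.Node} {c : L.Chan} {v : L.Val} {Δ : PMF (Network L)} {Φ : PMF (Sys L)}
    (h : ETrans D K (.input m c v) Δ) (hΦ : ITrans D Γ' B (.send m c v) Φ) :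
    Red D (K.comp ⟨Γ', B⟩) (compDist Γ' Δ Φ) := by
  cases h with
  | input _ h _ =>
    have hΓ := hK.graph
    rw [hΓ] at h ⊢
    exact h.red_comp_test_send hc hK hB hΦ

end Reductions

open TestingStructure

section Composition

variable {Γ Γ' : Graph L} {X Y : Set L.Node} {K : Network L} {B : Sys L}

/-! ## Hyper-derivations in composed networks -/

theorem Network.successful_comp {T : Network L} :
    (K.comp T).Successful D ↔ K.Successful D ∨ T.Successful D := Sys.successful_par

/-- A function on networks that run on `Γ` and system terms, seen as a function on composed
networks. -/
def decode (Γ : Graph L) (g : Network L → Sys L → ℝ≥0∞) (K : Network L) : ℝ≥0∞ :=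
  match K.sys with
  | .par A B => g ⟨Γ, A⟩ B
  | _ => 0

theorem decode_comp (g : Network L → Sys L → ℝ≥0∞) (hK : On Γ X K) :
    decode Γ g (K.comp ⟨Γ', B⟩) = g K B := by
  obtain ⟨Γ₀, A⟩ := K
  obtain ⟨rfl, -⟩ := hK
  rfl

/-- Prices are naturally given on pairs of a network and a test term. On a fixed graph the
composition determines the pair, and `decode` reads it off. -/
theorem step_of_red_comp {P : Network L → ℝ≥0∞ → Prop} {u : ℝ≥0∞} {M : Network L}
    {Δ : PMF (Network L)} {Φ : PMF (Sys L)} (hs : ¬ M.Successful D)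
    (h : Red D M (compDist Γ' Δ Φ)) (hΔ : ∀ K ∈ Δ.support, On Γ X K)
    (g : Network L → Sys L → ℝ≥0∞)
    (hg : ∀ K ∈ Δ.support, ∀ B ∈ Φ.support, P (K.comp ⟨Γ', B⟩) (g K B))
    (hle : expect Δ (fun K => expect Φ (g K)) ≤ u) : (netTS D).Step P M u := by
  refine ⟨hs, _, h, decode Γ g, ?_, ?_⟩
  · intro t ht
    obtain ⟨K, hK, B, hB, rfl⟩ := mem_support_compDist.1 ht
    rw [decode_comp g (hΔ K hK)]
    exact hg K hK B hB
  · rw [expect_compDist]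
    refine le_trans (expect_le_of_support fun K hK => ?_) hle
    refine expect_le_of_support fun B hB => ?_
    rw [decode_comp g (hΔ K ((PMF.mem_support_iff _ _).2 hK))]

theorem step_comp (hc : Compat Γ Γ' X Y) (hB : B.nodes = Y) (hs : ¬ B.Successful D)
    {Q : Network L → ℝ≥0∞ → Prop} {u : ℝ≥0∞} (hK : On Γ X K) (hp : K.Proper D)
    (h : (extTS D).Step Q K u) :
    (netTS D).Step (fun s w => ∃ K', On Γ X K' ∧ K'.Proper D ∧ s = K'.comp ⟨Γ', B⟩ ∧ Q K' w)
      (K.comp ⟨Γ', B⟩) u := by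
  obtain ⟨hns, Δ, hΔ, g, hg, hle⟩ := h
  refine step_of_red_comp (fun h => (Network.successful_comp.1 h).elim hns hs)
    (ETrans.red_comp_tau hc hK hB hΔ) (ETrans.on hΔ hK) (fun K _ => g K) ?_ ?_
  · intro K' hK' B' hB'
    simp only [PMF.support_pure, Set.mem_singleton_iff] at hB'
    subst hB'
    exact ⟨K', ETrans.on hΔ hK K' hK', ETrans.proper hΔ hp K' hK', rfl, hg K' hK'⟩
  · simpa only [expect_pmf_const] using hle

/-- An extensional τ does not reach the test, so a strategy of `K` alone is one of the composition
with `B` unchanged. Success of `B` is excluded because it would forbid any move. -/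
theorem low_comp (hc : Compat Γ Γ' X Y) (hB : B.nodes = Y) (hs : ¬ B.Successful D)
    {Q : Network L → ℝ≥0∞ → Prop} {u : ℝ≥0∞} (hK : On Γ X K) (hp : K.Proper D)
    (h : (extTS D).Low Q K u) :
    (netTS D).Low (fun s w => ∃ K', On Γ X K' ∧ K'.Proper D ∧ s = K'.comp ⟨Γ', B⟩ ∧ Q K' w)
      (K.comp ⟨Γ', B⟩) u := by
  refine ⟨fun s w => ∃ K', On Γ X K' ∧ K'.Proper D ∧ s = K'.comp ⟨Γ', B⟩ ∧ (extTS D).Low Q K' w,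
    ?_, K, hK, hp, rfl, h⟩
  rintro s w ⟨K', hK', hp', rfl, h⟩
  rcases h.unfold with ⟨w', hw', h⟩ | h
  · exact .inl ⟨w', hw', K', hK', hp', rfl, h⟩
  · exact .inr (step_comp hc hB hs hK' hp' h)

/-- A strong action between hyper-derivations is followed by a composed network in which the
environment changes according to `Φ`. -/
theorem AroundWeak.step_comp (hc : Compat Γ Γ' X Y) (hB : B.nodes = Y) (hs : ¬ B.Successful D)
    (hK : On Γ X K) (hp : K.Proper D) {a : EAct L} {Θ : SubDist (Network L)}
    (h : AroundWeak D a K Θ) (hΘ : 1 ≤ ∑' s, Θ s) {Φ : PMF (Sys L)}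
    (hred : ∀ K' Δ, On Γ X K' → ETrans D K' a Δ → Red D (K'.comp ⟨Γ', B⟩) (compDist Γ' Δ Φ))
    (hΦ : ∀ B' ∈ Φ.support, B'.nodes = Y) {P : Network L → ℝ≥0∞ → Prop}
    (hP : ∀ s w, 1 ≤ w → P s w) {r : Network L → Sys L → ℝ≥0∞}
    (hr : ∀ K' ∈ Θ.support, On Γ X K' → K'.Proper D →
      ∀ B' ∈ Φ.support, P (K'.comp ⟨Γ', B'⟩) (r K' B'))
    (hsucc : ∀ K' ∈ Θ.support, ∀ B' ∈ Φ.support, B'.Successful D → 1 ≤ r K' B') :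
    (netTS D).Step ((netTS D).Low P) (K.comp ⟨Γ', B⟩)
      (expect Θ fun K' => expect Φ (r K')) := by
  obtain ⟨Δ₁, Δ₂, hyp₁, hlift, hyp₂⟩ := h
  -- The second hyper-derivation may follow a different strategy for each outcome `B'` of the test,
  -- so rewards are pulled back separately. For a successful `B'` the run has to stop, at price 1.
  have hU : ∀ B' : Sys L, ∃ U : Network L → ℝ≥0∞, B' ∈ Φ.support →
      (∀ K' ∈ Δ₂.support, On Γ X K' → K'.Proper D →
        (netTS D).Low P (K'.comp ⟨Γ', B'⟩) (U K')) ∧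
      expect Δ₂ U ≤ expect Θ (fun K' => r K' B') := by
    intro B'
    by_cases hB's : B'.Successful D
    · refine ⟨fun _ => 1, fun hB' => ⟨fun K' _ _ _ => .halt (hP _ _ le_rfl), ?_⟩⟩
      refine le_trans ?_ (expect_le_of_support (f := fun _ => 1) fun K' hK' =>
        hsucc K' hK' B' hB' hB's)
      rw [expect_const, expect_const, mul_one, mul_one]
      exact Δ₂.2.trans hΘ
    · obtain ⟨U, hU, hle⟩ := hyp₂.pullback (r := fun K' => r K' B')
        (Q := fun K' w => K' ∈ Θ.support ∧ w = r K' B') fun t ht => ⟨ht, rfl⟩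
      refine ⟨U, fun hB' => ⟨fun K' hK' hon hpr => ?_, hle⟩⟩
      refine (low_comp hc (hΦ B' hB') hB's hon hpr (hU K' hK')).mono ?_
      rintro s w ⟨K'', hon', hpr', rfl, hmem, rfl⟩
      exact hr K'' hmem hon' hpr' B' hB'
  choose U hU using hU
  -- The strong action and the change of the test are simultaneous, so the price to carry back is
  -- averaged over `Φ`.
  obtain ⟨V, hV, hVle⟩ := hlift.restrict.pullback (fun K' => expect Φ (fun B' => U B' K'))
  obtain ⟨U₁, hU₁, hle₁⟩ := hyp₁.pullback (r := V)
    (Q := fun K' w => K' ∈ Δ₁.support ∧ w = V K') fun t ht => ⟨ht, rfl⟩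
  rw [expect_point] at hle₁
  have hlow := hU₁ K (by simp [SubDist.support, SubDist.point_apply_self])
  have htotal : U₁ K ≤ expect Θ fun K' => expect Φ (r K') := by
    refine hle₁.trans (hVle.trans ?_)
    rw [expect_comm, expect_comm (Θ : Network L → ℝ≥0∞)]
    exact expect_le_of_support fun B' hB' => (hU B' ((PMF.mem_support_iff _ _).2 hB')).2
  -- The first hyper-derivation may be trivial; the strong action that ends it guarantees a
  -- reduction.
  refine Low.step_of_step (((low_comp hc hB hs hK hp hlow).mono_right htotal).mono ?_)
  rintro s w ⟨K', hon, hpr, rfl, hmem, rfl⟩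
  obtain ⟨Ξ, ⟨⟨Δ, rfl, hΔ⟩, hsub, -⟩, hle⟩ := hV K' hmem
  refine step_of_red_comp (fun h => (Network.successful_comp.1 h).elim
    (ETrans.not_successful hΔ) hs) (hred K' Δ hon hΔ) (ETrans.on hΔ hon)
    (fun K'' B'' => U B'' K'') ?_ hle
  intro K'' hK'' B'' hB''
  exact (hU B'' hB'').1 K'' (hsub hK'') (ETrans.on hΔ hon K'' hK'')
    (ETrans.proper hΔ hpr K'' hK'')

/-- During a weak output of the composed network, the environment receives the message, in as many
rounds as there are broadcasts. -/
theorem EWeak.step_comp_output (hc : Compat Γ Γ' X Y) {c : L.Chan} {v : L.Val} {η : Set L.Node}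
    {Θ : SubDist (Network L)} (h : EWeak D (.output c v η) K Θ) (hΘ : 1 ≤ ∑' s, Θ s)
    (hB : B.nodes = Y) (hs : ¬ B.Successful D) (hK : On Γ X K) (hp : K.Proper D)
    {Φ : PMF (Sys L)} (hΦ : Receives D B η c v Φ) {P : Network L → ℝ≥0∞ → Prop}
    (hP : ∀ s w, 1 ≤ w → P s w) {r : Network L → Sys L → ℝ≥0∞}
    (hr : ∀ K' ∈ Θ.support, On Γ X K' → K'.Proper D →
      ∀ B' ∈ Φ.support, P (K'.comp ⟨Γ', B'⟩) (r K' B'))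
    (hsucc : ∀ K' ∈ Θ.support, ∀ B' ∈ Φ.support, B'.Successful D → 1 ≤ r K' B') :
    (netTS D).Step ((netTS D).Low P) (K.comp ⟨Γ', B⟩)
      (expect Θ fun K' => expect Φ (r K')) := by
  -- Induction on the least relation. The test term, the reception, the target predicate and the
  -- rewards stay universally quantified, because sequencing changes all of them.
  suffices H : WeakOutClosed D c v (fun K η Θ => 1 ≤ ∑' s, Θ s → ∀ B : Sys L, B.nodes = Y →
      ¬ B.Successful D → On Γ X K → K.Proper D → ∀ Φ, Receives D B η c v Φ →
      ∀ P : Network L → ℝ≥0∞ → Prop, (∀ s w, 1 ≤ w → P s w) → ∀ r : Network L → Sys L → ℝ≥0∞,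
      (∀ K' ∈ Θ.support, On Γ X K' → K'.Proper D →
        ∀ B' ∈ Φ.support, P (K'.comp ⟨Γ', B'⟩) (r K' B')) →
      (∀ K' ∈ Θ.support, ∀ B' ∈ Φ.support, B'.Successful D → 1 ≤ r K' B') →
      (netTS D).Step ((netTS D).Low P) (K.comp ⟨Γ', B⟩)
        (expect Θ fun K' => expect Φ (r K'))) from
    h _ H hΘ B hB hs hK hp Φ hΦ P hP r hr hsucc
  clear h hΘ hB hs hK hp hΦ hP hr hsucc
  constructor
  · intro K η Θ h hΘ B hB hs hK hp Φ hΦ P hP r hr hsucc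
    exact h.step_comp hc hB hs hK hp hΘ
      (fun K' Δ hK' hΔ => ETrans.red_comp_output hc hK' hB hΔ hΦ)
      (fun B' hB' => (Sys.nodes_eq_of_nodeList_eq (hΦ.nodeList_eq B' hB')).trans hB) hP hr hsucc
  · intro K η₁ η₂ Δ Θ h₁ h₂ hd hΘ B hB hs hK hp Φ hΦ P hP r hr hsucc
    obtain ⟨Φ₁, κ, hΦ₁, hκ, rfl, hpers⟩ := hΦ.split hd
    have hκmem : ∀ B₁ ∈ Φ₁.support, ∀ B₂ ∈ (κ B₁).support, B₂ ∈ (Φ₁.bind κ).support :=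
      fun B₁ h₁ B₂ h₂ => (PMF.mem_support_bind_iff _ _ _).2 ⟨B₁, h₁, h₂⟩
    have hΦ₁n : ∀ B₁ ∈ Φ₁.support, B₁.nodes = Y := fun B₁ hB₁ =>
      (Sys.nodes_eq_of_nodeList_eq (hΦ₁.nodeList_eq B₁ hB₁)).trans hB
    have hΔ : 1 ≤ ∑' s, Δ s := hΘ.trans h₂.mass_le
    have hV : ∀ B₁ : Sys L, ∃ V : Network L → ℝ≥0∞, B₁ ∈ Φ₁.support →
        (∀ K' ∈ Δ.support, On Γ X K' → K'.Proper D →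
          (netTS D).Low P (K'.comp ⟨Γ', B₁⟩) (V K')) ∧
        (B₁.Successful D → ∀ K', 1 ≤ V K') ∧
        expect Δ V ≤ expect Θ (fun K' => expect (κ B₁) (r K')) := by
      intro B₁
      by_cases hB₁s : B₁.Successful D
      · refine ⟨fun _ => 1, fun hB₁ => ⟨fun K' _ _ _ => .halt (hP _ _ le_rfl),
          fun _ _ => le_rfl, ?_⟩⟩
        refine le_trans ?_ (expect_le_of_support (f := fun _ => 1) fun K' hK' => ?_)
        · rw [expect_const, expect_const, mul_one, mul_one]
          exact Δ.2.trans hΘ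
        · rw [← expect_pmf_const (κ B₁) 1]
          refine expect_le_of_support fun B₂ hB₂ => ?_
          have hB₂ := (PMF.mem_support_iff _ _).2 hB₂
          -- A test node that succeeds in the first round does not hear the second one, so the final
          -- rewards are at least 1 as well.
          exact hsucc K' hK' B₂ (hκmem B₁ hB₁ B₂ hB₂) (hpers hs B₁ hB₁ hB₁s B₂ hB₂)
      · obtain ⟨V, hV, hle⟩ := h₂.restrict.pullback (fun K' => expect (κ B₁) (r K'))
        refine ⟨V, fun hB₁ => ⟨fun K' hK' hon hpr => ?_, fun h => absurd h hB₁s, hle⟩⟩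
        obtain ⟨Ξ, ⟨hΞ, hsub, hfull⟩, hle'⟩ := hV K' hK'
        exact .step ((hΞ (hfull hΘ) B₁ (hΦ₁n B₁ hB₁) hB₁s hon hpr (κ B₁) (hκ B₁ hB₁) P hP r
          (fun K'' hK'' h1 h2 B₂ hB₂ => hr K'' (hsub hK'') h1 h2 B₂ (hκmem B₁ hB₁ B₂ hB₂))
          (fun K'' hK'' B₂ hB₂ => hsucc K'' (hsub hK'') B₂ (hκmem B₁ hB₁ B₂ hB₂))).mono hle'
          fun _ _ => id)
    choose V hV using hV
    -- The first part is used with `Low P` as its target, the second part being the continuation.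
    have := h₁ hΔ B hB hs hK hp Φ₁ hΦ₁ ((netTS D).Low P) (fun s w h => .halt (hP s w h))
      (fun K' B₁ => V B₁ K') (fun K' hK' h1 h2 B₁ hB₁ => (hV B₁ hB₁).1 K' hK' h1 h2)
      (fun K' _ B₁ hB₁ h => (hV B₁ hB₁).2.1 h K')
    refine this.mono ?_ fun s w h => h.bind fun _ _ => id
    rw [expect_comm]
    simp only [expect_bind]
    rw [expect_comm (Θ : Network L → ℝ≥0∞)]
    exact expect_le_of_support fun B₁ hB₁ => (hV B₁ ((PMF.mem_support_iff _ _).2 hB₁)).2.2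

end Composition

/-! ## Weak actions from strong actions -/

theorem Lift.empty {S T : Type u} (R : S → SubDist T → Prop) :
    Lift R SubDist.empty SubDist.empty :=
  .comb (k := 0) Fin.elim0 Fin.elim0 Fin.elim0 (fun i => i.elim0) (by simp)
    (by simp [SubDist.empty]) (by simp [SubDist.empty])

namespace TestingStructure

variable {S : Type u} {T : TestingStructure S}

theorem Hyper.refl (Δ : SubDist S) : T.Hyper Δ Δ := by
  refine ⟨fun _ => SubDist.empty, fun k => if k = 0 then Δ else SubDist.empty, ?_,
    fun k => ⟨SubDist.empty, Lift.empty _, ?_⟩, ?_, fun s => ?_⟩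
  · simp [SubDist.empty]
  · simp [SubDist.empty]
  · simp [SubDist.empty, SubDist.support]
  · rw [tsum_eq_single 0]
    · simp
    · intro k hk
      simp [hk, SubDist.empty]

theorem Hyper.of_red {s : S} {Δ : PMF S} (hs : ¬ T.succ s) (h : T.red s Δ) :
    T.Hyper (SubDist.point s) (SubDist.ofPMF Δ) := by
  refine ⟨fun k => if k = 0 then SubDist.point s else SubDist.empty,
    fun k => if k = 1 then SubDist.ofPMF Δ else SubDist.empty, ?_, ?_, ?_, fun t => ?_⟩
  · simp [SubDist.empty]
  · intro k
    by_cases hk : k = 0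
    · refine ⟨SubDist.ofPMF Δ, ?_, ?_⟩
      · simpa [hk] using Lift.base (R := fullRel T.red) ⟨Δ, rfl, h⟩
      · simp [hk, SubDist.empty]
    · refine ⟨SubDist.empty, ?_, ?_⟩
      · simpa [hk] using Lift.empty _
      · simp [hk, SubDist.empty]
  · intro k t ht
    by_cases hk : k = 0
    · by_cases hts : t = s
      · exact hts ▸ hs
      · simp [hk, SubDist.support, SubDist.point_apply_of_ne hts] at ht
    · simp [hk, SubDist.support, SubDist.empty] at ht
  · rw [tsum_eq_single 1]
    · simp
    · intro k hk
      simp [hk, SubDist.empty]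

end TestingStructure

theorem ETrans.aroundWeak {K : Network L} {a : EAct L} {Δ : PMF (Network L)}
    (h : ETrans D K a Δ) : AroundWeak D a K (SubDist.ofPMF Δ) :=
  ⟨_, _, Hyper.refl _, .base ⟨Δ, rfl, h⟩, Hyper.refl _⟩

theorem ETrans.eWeak {K : Network L} {a : EAct L} {Δ : PMF (Network L)} (h : ETrans D K a Δ) :
    EWeak D a K (SubDist.ofPMF Δ) :=
  match a, h with
  | .tau, h => Hyper.of_red (T := extTS D) h.not_successful h
  | .input .., h => h.aroundWeak
  | .output .., h => fun _ hW => hW.single _ _ _ h.aroundWeak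

/-! ## Convergent networks -/

theorem Reaches.step {N J J' : Network L} {a : EAct L} {Δ : PMF (Network L)}
    (h : Reaches D N J) (hΔ : ETrans D J a Δ) (hJ' : J' ∈ Δ.support) : Reaches D N J' :=
  Relation.ReflTransGen.tail h ⟨a, Δ, hΔ, hJ'⟩

theorem Reaches.on {Γ : Graph L} {X : Set L.Node} {N J : Network L} (h : Reaches D N J)
    (hN : On Γ X N) : On Γ X J := by
  induction h with
  | refl => exact hN
  | tail _ h ih =>
    obtain ⟨a, Δ, hΔ, hmem⟩ := h
    exact hΔ.on ih _ hmem

theorem Convergent.not_trap {N : Network L} (h : Convergent D N) (C : Set (Network L))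
    (hC : C ⊆ {J | Reaches D N J}) (hne : C.Nonempty) :
    ¬ ∀ J ∈ C, ∃ Δ, ETrans D J .tau Δ ∧ Δ.support ⊆ C := by
  intro htrap
  obtain ⟨J, hJ⟩ := hne
  refine h J (hC hJ) (hyper_empty_of_trap (T := extTS D) (fun _ _ h => ETrans.finite_support h) hJ
    fun K hK => ?_)
  obtain ⟨Δ, hΔ, hsub⟩ := htrap K hK
  exact ⟨hΔ.not_successful, Δ, hΔ, hsub⟩

/-! ## The simulation argument -/

section Simulation

variable {R : Network L → Network L → Prop} {N : Network L} {Γ ΓT : Graph L} {X Y : Set L.Node}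

/-- `K.comp ⟨ΓT, B⟩` is a composed network with the bound `u` for its results, or it simulates a
composed network, with a component reachable from `N`, that has results below `u`. -/
def Sim (D : Defs L) (R : Network L → Network L → Prop) (N : Network L) (Γ ΓT : Graph L)
    (X Y : Set L.Node) (s : Network L) (u : ℝ≥0∞) : Prop :=
  1 ≤ u ∨ ∃ J K B, s = Network.comp K ⟨ΓT, B⟩ ∧ R J K ∧ Reaches D N J ∧ On Γ X K ∧
    K.Proper D ∧ B.nodes = Y ∧ (netTS D).Low (netTS D).Final (J.comp ⟨ΓT, B⟩) u

/-- The rewards of the simulated network become rewards of the simulating network. -/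
theorem Sim.exists_reward {Δ Θ : PMF (Network L)} {Φ : PMF (Sys L)}
    (hlift : Lift (ptRel R) (SubDist.ofPMF Δ) (SubDist.ofPMF Θ))
    (hΔ : ∀ J ∈ Δ.support, Reaches D N J) (hΦ : ∀ B ∈ Φ.support, B.nodes = Y)
    {g : Network L → ℝ≥0∞}
    (hg : ∀ J ∈ Δ.support, ∀ B ∈ Φ.support,
      (netTS D).Low (netTS D).Final (J.comp ⟨ΓT, B⟩) (g (J.comp ⟨ΓT, B⟩))) :
    ∃ r : Network L → Sys L → ℝ≥0∞,
      (∀ K ∈ (SubDist.ofPMF Θ).support, On Γ X K → K.Proper D → ∀ B ∈ Φ.support,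
        Sim D R N Γ ΓT X Y (K.comp ⟨ΓT, B⟩) (r K B)) ∧
      (∀ K ∈ (SubDist.ofPMF Θ).support, ∀ B ∈ Φ.support, B.Successful D → 1 ≤ r K B) ∧
      expect (SubDist.ofPMF Θ) (fun K => expect Φ (r K)) ≤ expect (compDist ΓT Δ Φ) g := by
  -- The coupling concerns networks only, so it is used once for each outcome of the test.
  choose r hr hle _ using fun B : Sys L => (hlift.pushforward (fun J => g (J.comp ⟨ΓT, B⟩))).2
  refine ⟨fun K B => r B K, ?_, ?_, ?_⟩
  · intro K hK hon hp B hB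
    obtain ⟨J, hJ, hRJ, hle⟩ := hr B K hK
    exact .inr ⟨J, K, B, rfl, hRJ, hΔ J hJ, hon, hp, hΦ B hB, (hg J hJ B hB).mono_right hle⟩
  · intro K hK B hB hs
    obtain ⟨J, hJ, -, hle⟩ := hr B K hK
    exact ((hg J hJ B hB).one_le_of_succ (Network.successful_comp.2 (.inr hs))).trans hle
  · rw [expect_compDist, expect_ofPMF, expect_comm, expect_comm (Δ : Network L → ℝ≥0∞)]
    exact expect_le_of_support fun B _ => hle B

variable {ΓN : Graph L} {XN : Set L.Node} {J K : Network L} {B : Sys L} {u : ℝ≥0∞}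

theorem one_le_tsum_ofPMF {S : Type u} (Θ : PMF S) : 1 ≤ ∑' s, SubDist.ofPMF Θ s :=
  Θ.tsum_coe.ge

/-- If the simulated network is stuck, then the simulating network can get stuck. -/
theorem Sim.low_of_stuck (hR : IsDFDeadSim D R) (hcN : Compat ΓN ΓT XN Y)
    (hcM : Compat Γ ΓT X Y) (hJK : R J K) (hJ : On ΓN XN J) (hK : On Γ X K) (hp : K.Proper D)
    (hB : B.nodes = Y) (hs : ¬ (J.comp ⟨ΓT, B⟩).Successful D)
    (hstuck : ∀ Δ, ¬ Red D (J.comp ⟨ΓT, B⟩) Δ) :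
    (netTS D).Low (netTS D).Final (K.comp ⟨ΓT, B⟩) u := by
  rw [Network.successful_comp, not_or] at hs
  -- Every network can take part in any reception, perhaps without change; hence a broadcast of the
  -- test would have been a reduction beside `J` too.
  have hrecv : ∀ m c v, ∃ Δ, ITrans D ΓN J.sys (.recv m c v) Δ := fun m c v => by
    obtain ⟨Δ, hΔ⟩ := exists_receives (D := D) {n | ΓN.E m n} c v J.sys
    exact ⟨Δ, hΔ.iTrans fun n _ => Iff.rfl⟩
  have hdead : Deadlocked D J := by
    refine ⟨hs.1, fun Δ hΔ => hstuck _ (hΔ.red_comp_tau hcN hJ hB), fun c v η Δ hΔ => ?_⟩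
    obtain ⟨Φ, hΦ⟩ := exists_receives (D := D) η c v B
    exact hstuck _ (hΔ.red_comp_output hcN hJ hB hΦ)
  obtain ⟨Θ, hΘ, hΘd⟩ := hR.dead J K hJK hdead
  -- Deadlocked networks may be given price 0, which is below any `u`.
  obtain ⟨U, hU, hle⟩ := Hyper.pullback (T := extTS D) hΘ (r := fun _ => 0)
    (Q := fun K' _ => Deadlocked D K') hΘd
  rw [expect_point] at hle
  have h := low_comp hcM hB hs.2 hK hp (hU K (by
    simp [SubDist.support, SubDist.point_apply_self]))
  refine (h.mono_right (v := u) (hle.trans (by simp [expect]))).mono ?_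
  rintro s w ⟨K', hon, hpr, rfl, hd⟩
  refine .inr ⟨fun h => (Network.successful_comp.1 h).elim hd.1 hs.2, fun Ξ hΞ => ?_⟩
  rcases Red.comp_cases hcM hon hB hΞ with ⟨n, Δ, h, -⟩ | ⟨m, c, v, Δ, Φ, h, hΦ, -⟩ |
    ⟨n, Φ, h, -⟩ | ⟨m, c, v, Δ, Φ, -, h, -⟩
  · exact hd.2.1 _ (.tau hd.1 (by rw [hon.graph]; exact h))
  · rcases h.eTrans_of_send hcM hon hB hd.1 hΦ with ⟨h, -⟩ | ⟨η, h, -⟩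
    · exact hd.2.1 _ h
    · exact hd.2.2 _ _ _ _ h
  · exact hstuck _ (h.red_comp_test_tau hcN hJ hB)
  · obtain ⟨Δ', hΔ'⟩ := hrecv m c v
    exact hstuck _ (hΔ'.red_comp_test_send hcN hJ hB h)

/-- The simulating network follows each step of the simulated network, where it may fail to take
a reduction only if the step is an extensional `τ`. -/
theorem Sim.progress_or_tau (hR : IsDFDeadSim D R) (hcN : Compat ΓN ΓT XN Y)
    (hcM : Compat Γ ΓT X Y) (hinp : J.inp = K.inp) (hJK : R J K) (hJr : Reaches D N J)
    (hJ : On ΓN XN J) (hK : On Γ X K) (hp : K.Proper D) (hB : B.nodes = Y)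
    (h : (netTS D).Low (netTS D).Final (J.comp ⟨ΓT, B⟩) u) :
    (netTS D).Low (netTS D).Final (K.comp ⟨ΓT, B⟩) u ∨
    (netTS D).Step ((netTS D).Low (Sim D R N Γ ΓT X Y)) (K.comp ⟨ΓT, B⟩) u ∨
    (¬ B.Successful D ∧ ∃ Δ, ETrans D J .tau Δ ∧ ∃ g : Network L → ℝ≥0∞,
      (∀ J' ∈ Δ.support, (netTS D).Low (netTS D).Final (J'.comp ⟨ΓT, B⟩) (g J')) ∧
      expect Δ g ≤ u) := by
  rcases h.unfold with ⟨w, hw, ⟨-, h⟩ | ⟨hs, h⟩⟩ | ⟨hs, Ξ, hΞ, g, hg, hle⟩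
  · exact .inl (low_final_of_one_le (h.trans hw))
  · exact .inl (Sim.low_of_stuck hR hcN hcM hJK hJ hK hp hB hs h)
  have hs' := hs
  change ¬ (J.comp ⟨ΓT, B⟩).Successful D at hs'
  rw [Network.successful_comp, not_or] at hs'
  have hsK : ¬ (K.comp ⟨ΓT, B⟩).Successful D := fun h =>
    (Network.successful_comp.1 h).elim (Sys.Proper.not_successful hp) hs'.2
  have htau : ∀ Δ, ETrans D J .tau Δ → Ξ = compDist ΓT Δ (PMF.pure B) →
      (¬ B.Successful D ∧ ∃ Δ, ETrans D J .tau Δ ∧ ∃ g : Network L → ℝ≥0∞,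
      (∀ J' ∈ Δ.support, (netTS D).Low (netTS D).Final (J'.comp ⟨ΓT, B⟩) (g J')) ∧
      expect Δ g ≤ u) := by
    rintro Δ hΔ rfl
    refine ⟨hs'.2, Δ, hΔ, fun J' => g (J'.comp ⟨ΓT, B⟩), fun J' hJ' => hg _ ?_, ?_⟩
    · exact mem_support_compDist.2 ⟨J', hJ', B, by simp, rfl⟩
    · simpa only [expect_compDist, expect_pure] using hle
  have hΞmem : ∀ {Δ : PMF (Network L)} {Φ : PMF (Sys L)}, Ξ = compDist ΓT Δ Φ →
      ∀ J' ∈ Δ.support, ∀ B' ∈ Φ.support, (netTS D).Low (netTS D).Final (J'.comp ⟨ΓT, B'⟩)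
        (g (J'.comp ⟨ΓT, B'⟩)) := fun h J' hJ' B' hB' =>
    hg _ (h ▸ mem_support_compDist.2 ⟨J', hJ', B', hB', rfl⟩)
  have htest : ∀ {Φ : PMF (Sys L)}, Ξ = compDist ΓT (PMF.pure J) Φ →
      (∀ B' ∈ Φ.support, B'.nodes = Y) →
      Red D (K.comp ⟨ΓT, B⟩) (compDist ΓT (PMF.pure K) Φ) →
      (netTS D).Step ((netTS D).Low (Sim D R N Γ ΓT X Y)) (K.comp ⟨ΓT, B⟩) u := by
    intro Φ hΞ' hΦ hred
    refine step_of_red_comp hsK hred (X := X) (Γ := Γ) (by simpa using hK)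
      (fun _ B' => g (J.comp ⟨ΓT, B'⟩)) (fun K' hK' B' hB' => ?_) ?_
    · simp only [PMF.support_pure, Set.mem_singleton_iff] at hK'
      subst hK'
      exact .halt (.inr ⟨J, K', B', rfl, hJK, hJr, hK, hp, hΦ B' hB',
        hΞmem hΞ' J (by simp) B' hB'⟩)
    · rw [hΞ', expect_compDist] at hle
      simpa only [expect_pure] using hle
  rcases Red.comp_cases hcN hJ hB hΞ with ⟨n, Δ, h, hΞ'⟩ | ⟨m, c, v, Δ, Φ, h, hΦ, hΞ'⟩ |
    ⟨n, Φ, h, hΞ'⟩ | ⟨m, c, v, Δ, Φ, h, hΦ, hΞ'⟩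
  · refine .inr (.inr (htau _ ?_ hΞ'))
    have := hJ.graph
    subst this
    exact .tau hs'.1 h
  · rcases h.eTrans_of_send hcN hJ hB hs'.1 hΦ with ⟨h, rfl⟩ | ⟨η, h, hΦη⟩
    · exact .inr (.inr (htau _ h hΞ'))
    · have hΦn : ∀ B' ∈ Φ.support, B'.nodes = Y := fun B' hB' =>
        (Sys.nodes_eq_of_nodeList_eq (hΦη.nodeList_eq B' hB')).trans hB
      obtain ⟨Θ, hΘ, hlift⟩ := hR.act J K hJK _ _ h.eWeak
      obtain ⟨r, hr, hrs, hrle⟩ := Sim.exists_reward (X := X) (Γ := Γ) hlift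
        (fun J' hJ' => hJr.step h hJ') hΦn (hΞmem hΞ')
      exact .inr (.inl ((hΘ.step_comp_output hcM (one_le_tsum_ofPMF Θ) hB hs'.2 hK hp hΦη
        (fun s w h => .inl h) hr hrs).mono (hrle.trans (hΞ' ▸ hle)) fun _ _ => id))
  · exact .inr (.inl (htest hΞ' (fun B' hB' =>
      (Sys.nodes_eq_of_nodeList_eq (h.nodeList_eq B' hB')).trans hB)
      (h.red_comp_test_tau hcM hK hB)))
  · have hΦn : ∀ B' ∈ Φ.support, B'.nodes = Y := fun B' hB' =>
      (Sys.nodes_eq_of_nodeList_eq (hΦ.nodeList_eq B' hB')).trans hB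
    have hmY : m ∈ Y := hB ▸ hΦ.actor_mem (by simp)
    have hdisj : ∀ {Γ₀ : Graph L} {X₀ : Set L.Node} {K₀ : Network L}, Compat Γ₀ ΓT X₀ Y →
        On Γ₀ X₀ K₀ → m ∉ K₀.inp → ∀ n ∈ K₀.sys.nodes, n ∉ {n | Γ₀.E m n} := by
      intro Γ₀ X₀ K₀ hc hon hm n _ he
      have he : Γ₀.E m n := he
      refine hm ⟨⟨?_, ?_⟩, n, ?_⟩
      · rw [hon.graph]; exact (Γ₀.mem _ _ he).1
      · rw [hon.nodes]; exact hc.notMem hmY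
      · rw [hon.graph]; exact he
    by_cases hm : m ∈ J.inp
    · have hE : ETrans D J (.input m c v) (netDist ΓN Δ) := by
        have := hJ.graph
        subst this
        exact .input hs'.1 h hm
      obtain ⟨Θ, hΘ, hlift⟩ := hR.act J K hJK _ _ hE.eWeak
      obtain ⟨r, hr, hrs, hrle⟩ := Sim.exists_reward (X := X) (Γ := Γ) hlift
        (fun J' hJ' => hJr.step hE hJ') hΦn (hΞmem hΞ')
      exact .inr (.inl ((AroundWeak.step_comp hcM hB hs'.2 hK hp hΘ (one_le_tsum_ofPMF Θ)
        (fun K' Δ hK' hΔ => hΔ.red_comp_input hcM hK' hB hΦ) hΦn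
        (fun s w h => .inl h) hr hrs).mono (hrle.trans (hΞ' ▸ hle)) fun _ _ => id))
    -- A sender that is not an input node is heard by neither network, since their input nodes
    -- agree; the test moves alone.
    · have hΔ := (receives_of_disjoint (hdisj hcN hJ hm)).1 h.receives
      have hJpure : netDist ΓN Δ = PMF.pure J := by
        have := hJ.graph
        subst this
        rw [hΔ, netDist_pure]
      have hKpure : netDist Γ (PMF.pure K.sys) = PMF.pure K := by
        have := hK.graph
        subst this
        rw [netDist_pure]
      have hKr : ITrans D Γ K.sys (.recv m c v) (PMF.pure K.sys) :=
        ((receives_of_disjoint (hdisj hcM hK (hinp ▸ hm))).2 rfl).iTrans fun n _ => Iff.rfl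
      rw [hJpure] at hΞ'
      refine .inr (.inl (htest hΞ' hΦn ?_))
      rw [← hKpure]
      exact hKr.red_comp_test_send hcM hK hB hΦ

/-- Following an extensional `τ` of the simulated network. The mass `h` stays at `K`, and the mass
`h'` takes a reduction. -/
theorem Sim.tau_match (hR : IsDFDeadSim D R) (hcM : Compat Γ ΓT X Y) (hJK : R J K)
    (hJr : Reaches D N J) (hK : On Γ X K) (hp : K.Proper D) (hB : B.nodes = Y)
    (hs : ¬ B.Successful D) {Δ : PMF (Network L)} (hΔ : ETrans D J .tau Δ)
    {g : Network L → ℝ≥0∞}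
    (hg : ∀ J' ∈ Δ.support, (netTS D).Low (netTS D).Final (J'.comp ⟨ΓT, B⟩) (g J')) :
    ∃ h h' ρ v : ℝ≥0∞, h + h' = 1 ∧ h * ρ + h' * v ≤ expect Δ g ∧
      (h' ≠ 0 → (netTS D).Step ((netTS D).Low (Sim D R N Γ ΓT X Y)) (K.comp ⟨ΓT, B⟩) v) ∧
      (h ≠ 0 → ∃ J' ∈ Δ.support, R J' K ∧ g J' ≤ ρ) ∧
      (∀ d, h * d ≤ h * ρ + expect Δ (fun J' => Set.indicator {J' | R J' K} (d - g ·) J')) ∧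
      (h' = 0 → ∀ J' ∈ Δ.support, R J' K) := by
  obtain ⟨Θ, hΘ, hlift⟩ := hR.act J K hJK _ _ hΔ.eWeak
  obtain ⟨htotal, r, hr, hrle, hd⟩ := hlift.pushforward g
  obtain ⟨go, halt, V, hpt, hhalt, hgo, hle⟩ := Hyper.split (T := extTS D) hΘ (r := r)
    (Q := fun K' w => K' ∈ Θ.support ∧ w = r K') fun t ht => ⟨ht, rfl⟩
  have hone : go K + halt K = 1 := by rw [← hpt, SubDist.point_apply_self]
  -- The derivation starts at the point `K`, so both of its initial parts are concentrated there.
  have hzero : ∀ K', K' ≠ K → go K' = 0 ∧ halt K' = 0 := fun K' hne => by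
    have := hpt K'
    rw [SubDist.point_apply_of_ne hne, eq_comm, add_eq_zero] at this
    exact this
  have hhaltΘ : halt K ≤ Θ K := hhalt K
  refine ⟨halt K, go K, r K, V K, by rw [add_comm]; exact hone, ?_, fun h0 => ?_, fun h0 => ?_,
    fun d => ?_, fun h0 => ?_⟩
  · refine le_trans (le_of_eq ?_) (hle.trans hrle)
    congr 1
    · rw [expect, tsum_eq_single K fun K' h => by rw [(hzero K' h).2, zero_mul]]
    · rw [expect, tsum_eq_single K fun K' h => by rw [(hzero K' h).1, zero_mul]]
  · refine (step_comp hcM hB hs hK hp (hgo K h0)).mono le_rfl ?_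
    rintro s w ⟨K', hon, hpr, rfl, hlow⟩
    refine (low_comp hcM hB hs hon hpr hlow).mono ?_
    rintro s w ⟨K'', hon', hpr', rfl, hmem, rfl⟩
    obtain ⟨J', hJ', hRJ', hle'⟩ := hr K'' hmem
    exact .inr ⟨J', K'', B, rfl, hRJ', hJr.step hΔ hJ', hon', hpr', hB,
      (hg J' hJ').mono_right hle'⟩
  · refine hr K ((PMF.mem_support_iff _ _).2 fun hΘ0 => h0 ?_)
    exact le_antisymm (hΘ0 ▸ hhaltΘ) zero_le
  · have h1 : Θ K * (d - r K) ≤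
        expect Δ (fun J' => Set.indicator {J' | R J' K} (d - g ·) J') := by
      rw [ENNReal.mul_sub fun _ _ => Θ.apply_ne_top K, tsub_le_iff_left]
      exact hd K d
    calc halt K * d ≤ halt K * (r K + (d - r K)) := by gcongr; exact le_add_tsub
      _ = halt K * r K + halt K * (d - r K) := mul_add _ _ _
      _ ≤ halt K * r K + Θ K * (d - r K) := by gcongr
      _ ≤ _ := by gcongr
  · intro J' hJ'
    obtain ⟨K', hK', hRJ'⟩ := htotal J' hJ'
    rw [h0, zero_add] at hone
    -- If nothing moves, the answer is the point distribution at `K`, and the coupling relates every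
    -- successor to `K`.
    have hΘK : Θ K = 1 := le_antisymm (Θ.coe_le_one K) (hone ▸ hhaltΘ)
    have := (PMF.apply_eq_one_iff Θ K).1 hΘK
    rw [this, Set.mem_singleton_iff] at hK'
    exact hK' ▸ hRJ'

/-- Convergence of the simulated network makes the simulating network take a reduction. -/
theorem Sim.progress (hR : IsDFDeadSim D R) (hfin : Finitary D N) (hconv : Convergent D N)
    (hcN : Compat ΓN ΓT XN Y) (hcM : Compat Γ ΓT X Y) (hN : On ΓN XN N)
    (hinp : ∀ J K, On ΓN XN J → On Γ X K → J.inp = K.inp) {s : Network L}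
    (h : Sim D R N Γ ΓT X Y s u) :
    (netTS D).Low (netTS D).Final s u ∨
      (netTS D).Step ((netTS D).Low (Sim D R N Γ ΓT X Y)) s u := by
  rcases h with h | ⟨J₀, K, B, rfl, hJ₀K, hJ₀r, hK, hp, hB, hJ₀⟩
  · exact .inl (low_final_of_one_le h)
  by_contra! hno
  obtain ⟨hnl, hns⟩ := hno
  have hu : u ≠ ∞ := by
    rintro rfl
    exact hnl (low_final_of_one_le le_top)
  have htau : ∀ J w, Reaches D N J → R J K → w ≤ u →
      (netTS D).Low (netTS D).Final (J.comp ⟨ΓT, B⟩) w →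
      (¬ B.Successful D ∧ ∃ Δ, ETrans D J .tau Δ ∧ ∃ g : Network L → ℝ≥0∞,
        (∀ J' ∈ Δ.support, (netTS D).Low (netTS D).Final (J'.comp ⟨ΓT, B⟩) (g J')) ∧
        expect Δ g ≤ w) := by
    intro J w hJr hJK hw hJ
    have hon := hJr.on hN
    rcases Sim.progress_or_tau hR hcN hcM (hinp J K hon hK) hJK hJr hon hK hp hB hJ with h | h | h
    · exact absurd (h.mono_right hw) hnl
    · exact absurd (h.mono hw fun _ _ => id) hns
    · exact h
  -- As no guarded step is available at price `u`, every answer that moves costs strictly more.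
  have hstep : ∀ v, (netTS D).Step ((netTS D).Low (Sim D R N Γ ΓT X Y)) (K.comp ⟨ΓT, B⟩) v →
      u < v := fun v hv => lt_of_not_ge fun hle => hns (hv.mono hle fun _ _ => id)
  have hlower : ∀ J w, Reaches D N J → R J K →
      (netTS D).Low (netTS D).Final (J.comp ⟨ΓT, B⟩) w → u ≤ w := by
    -- The largest amount by which `J` undercuts `u`, and 0 where `J` is not related to `K`.
    set G : Network L → ℝ≥0∞ := Set.indicator {J | R J K} (fun J =>
      ⨆ w ∈ {w | (netTS D).Low (netTS D).Final (J.comp ⟨ΓT, B⟩) w}, (u - w)) with hG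
    have hGle : ∀ J w, R J K → (netTS D).Low (netTS D).Final (J.comp ⟨ΓT, B⟩) w →
        u - w ≤ G J := by
      intro J w hJK hw
      rw [hG, Set.indicator_of_mem (show J ∈ {J | R J K} from hJK)]
      exact le_iSup₂ (f := fun w (_ : w ∈ {w | (netTS D).Low (netTS D).Final
        (J.comp ⟨ΓT, B⟩) w}) => u - w) w hw
    have hkey : ∀ J w, Reaches D N J → R J K → w ≤ u →
        (netTS D).Low (netTS D).Final (J.comp ⟨ΓT, B⟩) w →
        ∃ Δ, ETrans D J .tau Δ ∧ u - w ≤ expect Δ G := by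
      intro J w hJr hJK hw hJ
      obtain ⟨hs, Δ, hΔ, g, hg, hle⟩ := htau J w hJr hJK hw hJ
      refine ⟨Δ, hΔ, tsub_le_iff_left.2 ?_⟩
      obtain ⟨h, h', ρ, v, hh, hval, hst, -, hd, -⟩ :=
        Sim.tau_match (N := N) hR hcM hJK hJr hK hp hB hs hΔ hg
      have h1 : h' * u ≤ h' * v := by
        by_cases h0 : h' = 0
        · simp [h0]
        · gcongr
          exact (hstep v (hst h0)).le
      have h2 : expect Δ (fun J' => Set.indicator {J' | R J' K} (u - g ·) J') ≤ expect Δ G := by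
        refine expect_le_of_support fun J' hJ' => ?_
        by_cases hJ'K : R J' K
        · rw [Set.indicator_of_mem (show J' ∈ {J' | R J' K} from hJ'K)]
          exact hGle J' _ hJ'K (hg J' ((PMF.mem_support_iff _ _).2 hJ'))
        · rw [Set.indicator_of_notMem (show J' ∉ {J' | R J' K} from hJ'K)]
          exact zero_le
      -- The moving part costs at least `u`, so the whole saving comes from the part that stays at
      -- `K`, where it is bounded by the average of `G`.
      calc u = h * u + h' * u := by rw [← add_mul, hh, one_mul]
        _ ≤ (h * ρ + expect Δ G) + h' * v := add_le_add ((hd u).trans (by gcongr)) h1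
        _ = (h * ρ + h' * v) + expect Δ G := by ring
        _ ≤ w + expect Δ G := by gcongr; exact hval.trans hle
    have hzero := eq_zero_of_le_expect (rel := fun J Δ => ETrans D J .tau Δ) hfin.states
      hconv.not_trap (g := G) (fun J => ?_) ?_
    · intro J w hJr hJK hJ
      have := hGle J w hJK hJ
      rw [hzero J hJr] at this
      exact tsub_eq_zero_iff_le.1 (le_antisymm this zero_le)
    · refine ne_top_of_le_ne_top hu ?_
      rw [hG]
      refine Set.indicator_apply_le' (fun _ => iSup₂_le fun w _ => tsub_le_self) fun _ => zero_le
    · intro J hJr hGJ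
      have hJK : R J K := by
        by_contra hJK
        exact hGJ (Set.indicator_of_notMem (show J ∉ {J | R J K} from hJK) _)
      have hfinΔ : {Δ | ETrans D J .tau Δ}.Finite :=
        (hfin.branching J hJr).subset fun Δ hΔ => ⟨_, hΔ⟩
      have hne : {Δ | ETrans D J .tau Δ}.Nonempty := by
        by_contra hemp
        refine hGJ (le_antisymm ?_ zero_le)
        rw [hG, Set.indicator_of_mem (show J ∈ {J | R J K} from hJK)]
        refine iSup₂_le fun w hw => ?_
        rcases le_total w u with hwu | hwu
        · obtain ⟨Δ, hΔ, -⟩ := hkey J w hJr hJK hwu hw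
          exact absurd ⟨Δ, hΔ⟩ hemp
        · exact (tsub_eq_zero_of_le hwu).le
      -- Different prices may use different τ-moves; as there are finitely many, one serves the
      -- supremum.
      obtain ⟨Δ, hΔ, hmax⟩ := hfinΔ.exists_maximalFor (fun Δ : PMF (Network L) => expect Δ G)
        {Δ | ETrans D J .tau Δ} hne
      refine ⟨Δ, hΔ, fun J' hJ' => Reaches.step hJr hΔ hJ', ?_⟩
      rw [hG, Set.indicator_of_mem (show J ∈ {J | R J K} from hJK), ← hG]
      refine iSup₂_le fun w hw => ?_
      rcases le_total w u with hwu | hwu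
      · obtain ⟨Δ', hΔ', hle⟩ := hkey J w hJr hJK hwu hw
        exact hle.trans ((le_total (expect Δ' G) (expect Δ G)).elim id (hmax hΔ'))
      · exact (tsub_eq_zero_of_le hwu).le.trans zero_le
  -- States of price exactly `u` that are related to `K` will turn out to form a trap.
  refine hconv.not_trap {J | Reaches D N J ∧ R J K ∧
    (netTS D).Low (netTS D).Final (J.comp ⟨ΓT, B⟩) u} (fun J hJ => hJ.1)
    ⟨J₀, hJ₀r, hJ₀K, hJ₀⟩ ?_
  rintro J ⟨hJr, hJK, hJ⟩
  obtain ⟨hs, Δ, hΔ, g, hg, hle⟩ := htau J u hJr hJK le_rfl hJ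
  obtain ⟨h, h', ρ, v, hh, hval, hst, hρ, -, hall⟩ :=
    Sim.tau_match (N := N) hR hcM hJK hJr hK hp hB hs hΔ hg
  have h1 : h * u ≤ h * ρ := by
    by_cases h0 : h = 0
    · simp [h0]
    · obtain ⟨J', hJ', hJ'K, hgρ⟩ := hρ h0
      gcongr
      exact (hlower J' _ (hJr.step hΔ hJ') hJ'K (hg J' hJ')).trans hgρ
  -- A part that moves would push the price strictly above `u`.
  have h0 : h' = 0 := by
    by_contra h0
    have hh1 : h ≤ 1 := hh ▸ le_self_add
    have hh1' : h' ≤ 1 := hh ▸ le_add_self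
    have h2 : h' * u < h' * v := by
      rw [ENNReal.mul_lt_mul_iff_right h0 (ne_top_of_le_ne_top ENNReal.one_ne_top hh1')]
      exact hstep v (hst h0)
    have h3 : h * u + h' * u < h * ρ + h' * v := ENNReal.add_lt_add_of_le_of_lt
      (ENNReal.mul_ne_top (ne_top_of_le_ne_top ENNReal.one_ne_top hh1) hu) h1 h2
    rw [← add_mul, hh, one_mul] at h3
    exact absurd (hval.trans hle) (not_le.2 h3)
  have hJ'u : ∀ J' ∈ Δ.support, g J' = u := eq_of_expect_le hu (fun J' hJ' =>
    hlower J' _ (hJr.step hΔ hJ') (hall h0 J' hJ') (hg J' hJ')) hle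
  exact ⟨Δ, hΔ, fun J' hJ' => ⟨hJr.step hΔ hJ', hall h0 J' hJ', hJ'u J' hJ' ▸ hg J' hJ'⟩⟩

end Simulation

/-! ### Assembly: from the simulation to the must preorder -/

theorem Network.WF.compat {M T : Network L} (hM : M.WF) (hT : T.WF) (h : M.Composable T) :
    Compat M.graph T.graph M.sys.nodes T.sys.nodes where
  conn := hM.conn
  disj n hn hn' := by
    have : n ∈ M.sys.nodes ∩ T.graph.V := ⟨hn, hn'⟩
    rw [h] at this
    exact this
  sub := hT.subset

theorem On.inp_eq {Γ : Graph L} {X : Set L.Node} {K K' : Network L} (h : On Γ X K)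
    (h' : On Γ X K') : K.inp = K'.inp := by
  simp only [Network.inp, Network.interface, h.graph, h.nodes, h'.graph, h'.nodes]

theorem mustLE_of_dfDeadSim {M N : Network L} (hM : M.WF) (hN : N.WF) (hfin : Finitary D N)
    (hconv : Convergent D N) (hp : M.Proper D) (hinp : M.inp = N.inp) (houtp : M.outp = N.outp)
    (h : DFDeadSim D N M) : MustLE D M N := by
  refine ⟨hinp, houtp, fun T hT hMT hNT q hq => ?_⟩
  obtain ⟨R, hR, hNM⟩ := h
  have hMon : On M.graph M.sys.nodes M := ⟨rfl, rfl⟩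
  have hNon : On N.graph N.sys.nodes N := ⟨rfl, rfl⟩
  have hlow := low_of_mem_results (T := netTS D) hq
  have hsim : Sim D R N M.graph T.graph M.sys.nodes T.sys.nodes (M.comp T) q :=
    .inr ⟨N, M, T.sys, rfl, hNM, .refl, hMon, hp, rfl, hlow⟩
  refine Low.exists_mem_results (T := netTS D) (fun _ _ h => Red.finite_support h)
    (Low.coinduction (fun s w h => Sim.progress hR hfin hconv (hN.compat hT hNT)
      (hM.compat hT hMT) hNon ?_ h) hsim)
  intro J K hJ hK
  rw [hJ.inp_eq hNon, hK.inp_eq hMon, hinp]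

end WNet

end

theorem theorem6p11 {L : WNet.Sig.{u}} (D : WNet.Defs L) (M N : WNet.Network L)
    (hM : M.WF) (hN : N.WF)
    (hMfin : WNet.Finitary D M) (hNfin : WNet.Finitary D N)
    (hMconv : WNet.Convergent D M) (hNconv : WNet.Convergent D N)
    (hMprop : M.Proper D)
    (hinp : M.inp = N.inp) (houtp : M.outp = N.outp)
    (hsim : WNet.DFDeadSim D N M) :
    WNet.MustLE D M N :=
  WNet.mustLE_of_dfDeadSim hM hN hNfin hNconv hMprop hinp houtp hsim
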